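/- **Setting.** Let $\mathsf H_{\mathbb R}$ be a real Hilbert space of finite dimension $d$, $(U_t)_{t\in\mathbb R}$ a strongly continuous orthogonal representation of $\mathbb R$ on it, and $\mathsf H_{\mathbb R}=\bigoplus_{i\in N}\mathsf H_{\mathbb R}^{(i)}$ an orthogonal decomposition into $U_t$-invariant subspaces. Let $-1<q(i,j)=q(j,i)<1$ for $i,j\in N$. On the complexification $\mathsf H_{\mathbb C}$, with involution $\xi\mapsto\bar\xi$, write $U_t=A^{it}$ with $A$ positive, and put $\langle\xi,\zeta\rangle_U=\langle\xi,2(1+A^{-1})^{-1}\zeta\rangle$ (inner products are linear in the second variable). Let $\mathsf H_U$ be $\mathsf H_{\mathbb C}$ with this inner product, and fix an orthonormal basis $e_1,\dots,e_d$ of $\mathsf H_U$ such that each $e_k$ lies in $\mathsf H_{\mathbb C}^{(j_k)}$ for some $j_k\in N$. Let $T$ be the operator on $\mathsf H_U\otimes\mathsf H_U$ with $T(\xi\otimes\eta)=q(i,j)\,\eta\otimes\xi$ for $\xi\in\mathsf H_{\mathbb C}^{(i)},\eta\in\mathsf H_{\mathbb C}^{(j)}$, let $T_k$ be $T$ acting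 on the tensor factors $k,k+1$, let $\Phi$ be the quasi-multiplicative map on $S_n$ with $\Phi(1)=1$ and $\Phi(\tau_k)=T_k$ for the transpositions $\tau_k=(k,k+1)$, and let $P^{(n)}=\sum_{\sigma\in S_n}\Phi(\sigma)$. The Fock space $\mathcal F_T(\mathsf H_U)$ is the completion of the algebraic Fock space $\mathcal F_{\rm alg}=\bigoplus_{n\ge 0}\mathsf H_U^{\otimes n}$ (algebraic sum, $\mathsf H_U^{\otimes 0}=\mathbb C\Omega$) for $\langle\xi,\eta\rangle_T=\langle\xi,P^{(n)}\eta\rangle$ on $\mathsf H_U^{\otimes n}$, different $n$ being orthogonal. Let $a^*(\xi)x=\xi\otimes x$ and $a(\xi)=l(\xi)(1+T_1+T_1T_2+\dots+T_1\cdots T_{n-1})$ on $\mathsf H_U^{\otimes n}$, where $l(\xi)\Omega=0$ and $l(\xi)(\xi_1\otimes\dots\otimes\xi_n)=\langle\xi,\xi_1\rangle_U\,\xi_2\otimes\dots\otimes\xi_n$. Let $A_k=a^*(e_k)+a(\bar e_k)$, a bounded operator on $\mathcal F_T(\mathsf H_U)$, and let $\varphi=\langle\Omega,\cdot\,\Omega\rangle_T$.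 A tuple $(D_1,\dots,D_d)$ of (unbounded) operators on $\mathcal F_T(\mathsf H_U)$ is a *normalized dual system* for $(A_1,\dots,A_d)$ if $\mathcal F_{\rm alg}$ is contained in the domain of each $D_k$, $\Omega$ is in the domain of each adjoint $D_k^*$, $D_k\Omega=0$, and $[D_k,A_l]=\langle\bar e_l,e_k\rangle_U P_{\mathbb C\Omega}=\varphi(A_lA_k)P_{\mathbb C\Omega}$ on $\mathcal F_{\rm alg}$ for all $k,l$, where $P_{\mathbb C\Omega}$ is the orthogonal projection onto $\mathbb C\Omega$. For $n\ge 0$ let $B(n+1)$ be the set of partitions $\pi$ of $\{0,1,\dots,n\}$ into singletons and pairs such that $0$ is paired with some $k\in\{1,\dots,n\}$, every $l\in\{1,\dots,k-1\}$ is paired with an element of $\{k+1,\dots,n\}$, and all other vertices are singletons. Let $p(\pi)$ and $s(\pi)$ be the sets of pairs and of singletons of $\pi$; write $\pi(k)$ for the partner of $k$, and $\pi(k)=k$ if $k\in s(\pi)$. **Proposition.** There are operators $D_1,\dots,D_d$ on $\mathcal F_T(\mathsf H_U)$ with domain $\mathcal F_{\rm alg}$ such that $D_\alpha\Omega=0$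 and, for all $\alpha,\alpha_1,\dots,\alpha_n\in\{1,\dots,d\}$, $$D_\alpha(e_{\alpha_n}\otimes\cdots\otimes e_{\alpha_1})=\sum_{\pi\in B(n+1)}(-1)^{\pi(0)-1}\,Q(\pi)\,E(\pi)\,e_{s(\pi)},$$ where, with $\alpha_0=\alpha$ and $e_{\alpha_k}\in\mathsf H_{\mathbb C}^{(i_k)}$ for $0\le k\le n$, $$Q(\pi)=\prod_{0\le v<u<\pi(0)}q(i_v,i_u)\cdot\prod_{\substack{0<v<u<\pi(0)\\ \pi(v)>\pi(u)}}q(i_{\pi(v)},i_{\pi(u)})\cdot\prod_{\substack{\pi(0)<v<u\le n\\ v\in s(\pi),\,u\notin s(\pi)}}q(i_v,i_u),$$ $$E(\pi)=\prod_{\substack{(k,l)\in p(\pi)\\ k>l}}\langle\bar e_{\alpha_k},e_{\alpha_l}\rangle_U,\qquad e_{s(\pi)}=e_{\alpha_{l_s}}\otimes\cdots\otimes e_{\alpha_{l_1}}\ \text{ for } s(\pi)=\{l_s>\dots>l_1\}$$ (and $e_{s(\pi)}=\Omega$ if $s(\pi)=\emptyset$). The tuple $(D_1,\dots,D_d)$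 is a normalized dual system for $(A_1,\dots,A_d)$, and if $(D'_1,\dots,D'_d)$ is any normalized dual system for $(A_1,\dots,A_d)$, then each $D'_\alpha$ extends $D_\alpha$. -/

import Mathlib

/-!
Mixed `q`-Araki-Woods setting over a finite-dimensional real Hilbert space: the complexification and
the deformed inner product `⟨·,·⟩_U`, the twist `T`, the operator `P^(n) = ∑_σ Φ(σ)`, the
`T`-deformed Fock space with its creation and annihilation operators, the operators `A_k = W(e_k)`,
normalized dual systems, and the singleton/pair partitions with their weights.

Inner products are linear in the second variable. All letters, vertices and tensor positions are
counted from `0`.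
-/

namespace MixedQ
open Equiv Finset

/-- The complexification `H + iH` of a real Hilbert space `H`; the pair `⟨x, y⟩` is `x + i y`. -/
@[ext] structure Complexification (H : Type*) where
  re : H
  im : H

namespace Complexification
variable {H : Type*}

section Algebraic

/-- `x + i y ↦ (x, y)` -/
def equivProd : Complexification H ≃ H × H where
  toFun ξ := (ξ.re, ξ.im)
  invFun p := ⟨p.1, p.2⟩
  left_inv _ := rfl
  right_inv _ := rfl

variable [NormedAddCommGroup H] [InnerProductSpace ℝ H]

/-- Componentwise addition. -/
abbrev preAddCommGroup : AddCommGroup (Complexification H) := equivProd.addCommGroup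

attribute [local instance] preAddCommGroup

/-- `(a + i b)(x + i y) = (a x - b y) + i (a y + b x)` -/
abbrev preModule : Module ℂ (Complexification H) where
  smul c ξ := ⟨c.re • ξ.re - c.im • ξ.im, c.re • ξ.im + c.im • ξ.re⟩
  one_smul ξ := by
    apply Complexification.ext
    · change (1 : ℂ).re • ξ.re - (1 : ℂ).im • ξ.im = ξ.re; simp
    · change (1 : ℂ).re • ξ.im + (1 : ℂ).im • ξ.re = ξ.im; simp
  mul_smul a b ξ := by
    apply Complexification.ext
    · change (a * b).re • ξ.re - (a * b).im • ξ.im = a.re • (b.re • ξ.re - b.im • ξ.im) -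
        a.im • (b.re • ξ.im + b.im • ξ.re)
      rw [Complex.mul_re, Complex.mul_im]; module
    · change (a * b).re • ξ.im + (a * b).im • ξ.re = a.re • (b.re • ξ.im + b.im • ξ.re) +
        a.im • (b.re • ξ.re - b.im • ξ.im)
      rw [Complex.mul_re, Complex.mul_im]; module
  smul_zero a := by
    apply Complexification.ext
    · change a.re • (0 : H) - a.im • (0 : H) = 0; simp
    · change a.re • (0 : H) + a.im • (0 : H) = 0; simp
  smul_add a ξ η := by
    apply Complexification.ext
    · change a.re • (ξ.re + η.re) - a.im • (ξ.im + η.im) =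
        (a.re • ξ.re - a.im • ξ.im) + (a.re • η.re - a.im • η.im)
      module
    · change a.re • (ξ.im + η.im) + a.im • (ξ.re + η.re) =
        (a.re • ξ.im + a.im • ξ.re) + (a.re • η.im + a.im • η.re)
      module
  add_smul a b ξ := by
    apply Complexification.ext
    · change (a + b).re • ξ.re - (a + b).im • ξ.im =
        (a.re • ξ.re - a.im • ξ.im) + (b.re • ξ.re - b.im • ξ.im)
      rw [Complex.add_re, Complex.add_im]; module
    · change (a + b).re • ξ.im + (a + b).im • ξ.re =
        (a.re • ξ.im + a.im • ξ.re) + (b.re • ξ.im + b.im • ξ.re)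
      rw [Complex.add_re, Complex.add_im]; module
  zero_smul ξ := by
    apply Complexification.ext
    · change (0 : ℂ).re • ξ.re - (0 : ℂ).im • ξ.im = 0; simp
    · change (0 : ℂ).re • ξ.im + (0 : ℂ).im • ξ.re = 0; simp

attribute [local instance] preModule

/-- The inner product of the complexification, linear in the second variable:
`⟨x + i y, x' + i y'⟩ = ⟨x, x'⟩ + ⟨y, y'⟩ + i (⟨x, y'⟩ - ⟨y, x'⟩)`. -/
noncomputable abbrev preCore : InnerProductSpace.Core ℂ (Complexification H) where
  inner ξ η :=
    ⟨inner ℝ ξ.re η.re + inner ℝ ξ.im η.im, inner ℝ ξ.re η.im - inner ℝ ξ.im η.re⟩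
  conj_inner_symm ξ η := by
    apply Complex.ext <;> simp [real_inner_comm]
  re_inner_nonneg ξ := by
    simpa using add_nonneg (real_inner_self_nonneg (x := ξ.re)) real_inner_self_nonneg
  add_left ξ η ζ := by
    apply Complex.ext
    · change inner ℝ (ξ.re + η.re) ζ.re + inner ℝ (ξ.im + η.im) ζ.im =
        (inner ℝ ξ.re ζ.re + inner ℝ ξ.im ζ.im) + (inner ℝ η.re ζ.re + inner ℝ η.im ζ.im)
      simp only [inner_add_left]; ring
    · change inner ℝ (ξ.re + η.re) ζ.im - inner ℝ (ξ.im + η.im) ζ.re =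
        (inner ℝ ξ.re ζ.im - inner ℝ ξ.im ζ.re) + (inner ℝ η.re ζ.im - inner ℝ η.im ζ.re)
      simp only [inner_add_left]; ring
  smul_left ξ η c := by
    apply Complex.ext
    · change inner ℝ (c.re • ξ.re - c.im • ξ.im) η.re + inner ℝ (c.re • ξ.im + c.im • ξ.re) η.im =
        _
      simp [inner_add_left, inner_sub_left, real_inner_smul_left]; ring
    · change inner ℝ (c.re • ξ.re - c.im • ξ.im) η.im - inner ℝ (c.re • ξ.im + c.im • ξ.re) η.re =
        _
      simp [inner_add_left, inner_sub_left, real_inner_smul_left]; ring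
  definite ξ h := by
    have h1 := congrArg Complex.re h
    simp only [Complex.zero_re] at h1
    have h2 := real_inner_self_nonneg (x := ξ.re)
    have h3 := real_inner_self_nonneg (x := ξ.im)
    apply Complexification.ext
    · exact inner_self_eq_zero.1 (by linarith : inner ℝ ξ.re ξ.re = 0)
    · exact inner_self_eq_zero.1 (by linarith : inner ℝ ξ.im ξ.im = 0)

end Algebraic

variable [NormedAddCommGroup H] [InnerProductSpace ℝ H]

noncomputable instance : NormedAddCommGroup (Complexification H) :=
  @InnerProductSpace.Core.toNormedAddCommGroup ℂ _ _ preAddCommGroup preModule preCore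

noncomputable instance : InnerProductSpace ℂ (Complexification H) :=
  @InnerProductSpace.ofCore ℂ (Complexification H) _ preAddCommGroup preModule
    (@InnerProductSpace.Core.toCore ℂ (Complexification H) _ preAddCommGroup preModule preCore)

noncomputable instance : Inner ℂ (Complexification H) := InnerProductSpace.toInner

@[simp] theorem add_re (ξ η : Complexification H) : (ξ + η).re = ξ.re + η.re := rfl
@[simp] theorem add_im (ξ η : Complexification H) : (ξ + η).im = ξ.im + η.im := rfl
@[simp] theorem zero_re : (0 : Complexification H).re = 0 := rfl
@[simp] theorem zero_im : (0 : Complexification H).im = 0 := rfl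
@[simp] theorem smul_re (c : ℂ) (ξ : Complexification H) :
    (c • ξ).re = c.re • ξ.re - c.im • ξ.im := rfl
@[simp] theorem smul_im (c : ℂ) (ξ : Complexification H) :
    (c • ξ).im = c.re • ξ.im + c.im • ξ.re := rfl
theorem inner_def (ξ η : Complexification H) : inner ℂ ξ η =
    ⟨inner ℝ ξ.re η.re + inner ℝ ξ.im η.im, inner ℝ ξ.re η.im - inner ℝ ξ.im η.re⟩ := rfl

theorem norm_sq_eq (ξ : Complexification H) : ‖ξ‖ ^ 2 = ‖ξ.re‖ ^ 2 + ‖ξ.im‖ ^ 2 := by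
  rw [← inner_self_eq_norm_sq (𝕜 := ℂ), inner_def, ← real_inner_self_eq_norm_sq,
    ← real_inner_self_eq_norm_sq]
  rfl

/-- The canonical involution `x + i y ↦ x - i y`. -/
def conj (ξ : Complexification H) : Complexification H := ⟨ξ.re, -ξ.im⟩

/-- The `ℂ`-linear extension of a linear isometric bijection of `H`. -/
noncomputable def extend (V : H ≃ₗᵢ[ℝ] H) : Complexification H →ₗᵢ[ℂ] Complexification H where
  toFun ξ := ⟨V ξ.re, V ξ.im⟩
  map_add' ξ η := by ext <;> simp
  map_smul' c ξ := by ext <;> simp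
  norm_map' ξ := by
    rw [← sq_eq_sq₀ (norm_nonneg _) (norm_nonneg _), norm_sq_eq, norm_sq_eq]
    simp

end Complexification
open Complexification

/-- The initial data: a real Hilbert space `H`, a strongly continuous one-parameter group `U` of
orthogonal transformations of `H`, an orthogonal decomposition `H = ⨁ i, H^(i)` into `U`-invariant
subspaces `comp i`, and real numbers `q i j = q j i` in `(-1, 1)`. (`H` is finite-dimensional as soon
as a finite basis as in `HomogeneousBasis` is given; then orthogonality and `comp_sup` say that `H` is
the Hilbert space direct sum of the `comp i`.) -/
structure MixedQData (H N : Type*) [NormedAddCommGroup H] [InnerProductSpace ℝ H] where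
  U : ℝ → H ≃ₗᵢ[ℝ] H
  U_add : ∀ s t ξ, U (s + t) ξ = U s (U t ξ)
  U_continuous : ∀ ξ, Continuous fun t => U t ξ
  comp : N → Submodule ℝ H
  comp_orthogonal : ∀ i j, i ≠ j → comp i ⟂ comp j
  comp_sup : ⨆ i, comp i = ⊤
  U_mem : ∀ t i, ∀ ξ ∈ comp i, U t ξ ∈ comp i
  q : N → N → ℝ
  q_symm : ∀ i j, q i j = q j i
  q_lt_one : ∀ i j, |q i j| < 1

namespace MixedQData
variable {H N : Type*} [NormedAddCommGroup H] [InnerProductSpace ℝ H] (S : MixedQData H N)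
/-- The extension of `U t` to a unitary of the complexification. -/
noncomputable def UC (t : ℝ) : Complexification H →L[ℂ] Complexification H :=
  (extend (S.U t)).toContinuousLinearMap

/-- The analytic generator `A` of `U`, the positive operator with `U_t = A^{it}`. In finite dimension
`U_t = exp(t G)` with `G` the derivative of `U` at `0`, so that `log A = -i G`, `A = exp(-i G)`. -/
noncomputable def generator : Complexification H →L[ℂ] Complexification H :=
  NormedSpace.exp (-Complex.I • deriv S.UC 0)

/-- The deformed inner product `⟨ξ, ζ⟩_U = ⟨ξ, 2 (1 + A⁻¹)⁻¹ ζ⟩`. -/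
noncomputable def innerU (ξ ζ : Complexification H) : ℂ :=
  inner ℂ ξ (((2 : ℂ) • Ring.inverse (1 + Ring.inverse S.generator)) ζ)
end MixedQData

/-! ### Products of a sequence satisfying the braid relations -/

section Braid
variable {R : Type*} [Ring R]

/-- The product `T 0 * T 1 * ⋯ * T (k - 1)`. -/
def prodT (T : ℕ → R) : ℕ → R
  | 0 => 1
  | k + 1 => prodT T k * T k

theorem prodT_comm (T : ℕ → R) (hc : ∀ j k, j + 2 ≤ k → T j * T k = T k * T j) (m k : ℕ)
    (h : m + 1 ≤ k) : prodT T m * T k = T k * prodT T m := by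
  induction m with
  | zero => simp [prodT]
  | succ m ih =>
    rw [prodT, mul_assoc, hc m k (by omega), ← mul_assoc, ih (by omega), mul_assoc]

theorem prodT_shift (T : ℕ → R) (hb : ∀ j, T j * T (j + 1) * T j = T (j + 1) * T j * T (j + 1))
    (hc : ∀ j k, j + 2 ≤ k → T j * T k = T k * T j) (m j : ℕ) (h : j + 2 ≤ m) :
    prodT T m * T j = T (j + 1) * prodT T m := by
  induction m with
  | zero => omega
  | succ m ih =>
    rcases Nat.lt_or_ge (j + 1) m with h1 | h1
    · rw [prodT, mul_assoc, ← hc j m (by omega), ← mul_assoc, ih (by omega), mul_assoc]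
    · obtain rfl : m = j + 1 := by omega
      have e := prodT_comm T hc j (j + 1) le_rfl
      calc prodT T (j + 1 + 1) * T j = prodT T j * (T j * T (j + 1) * T j) := by
            simp only [prodT, mul_assoc]
        _ = (prodT T j * T (j + 1)) * T j * T (j + 1) := by rw [hb]; simp only [mul_assoc]
        _ = _ := by rw [e]; simp only [prodT, mul_assoc]

theorem prodT_mul (T : ℕ → R) (hb : ∀ j, T j * T (j + 1) * T j = T (j + 1) * T j * T (j + 1))
    (hc : ∀ j k, j + 2 ≤ k → T j * T k = T k * T j) (m k : ℕ) (h : k < m) :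
    T 0 * (prodT T m * prodT T k) = prodT T (k + 1) * prodT T m := by
  induction k with
  | zero => simp [prodT]
  | succ k ih =>
    have e := prodT_shift T hb hc m k (by omega)
    calc T 0 * (prodT T m * prodT T (k + 1)) = (T 0 * (prodT T m * prodT T k)) * T k := by
          simp only [prodT, mul_assoc]
      _ = prodT T (k + 1) * (prodT T m * T k) := by rw [ih (by omega)]; simp only [mul_assoc]
      _ = _ := by rw [e]; simp only [prodT, mul_assoc]

/-- `1 + T 0 + T 0 * T 1 + ⋯ + T 0 * ⋯ * T (m - 2)` (that is, `m` summands). -/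
def sumT (T : ℕ → R) (m : ℕ) : R := ∑ k ∈ range m, prodT T k

theorem sumT_factor (T : ℕ → R) (hb : ∀ j, T j * T (j + 1) * T j = T (j + 1) * T j * T (j + 1))
    (hc : ∀ j k, j + 2 ≤ k → T j * T k = T k * T j) (m : ℕ) :
    sumT T (m + 1) * (1 - prodT T m) = (1 - T 0 * prodT T m) * sumT T m := by
  have h1 : T 0 * prodT T m * sumT T m = (sumT T (m + 1) - 1) * prodT T m := by
    have : sumT T (m + 1) - 1 = ∑ k ∈ range m, prodT T (k + 1) := by
      rw [sumT, sum_range_succ']; simp [prodT]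
    rw [this, sumT, mul_sum, sum_mul]
    refine sum_congr rfl fun k hk => ?_
    rw [mul_assoc, prodT_mul T hb hc m k (mem_range.1 hk)]
  have h2 : sumT T (m + 1) = sumT T m + prodT T m := by rw [sumT, sum_range_succ, ← sumT]
  rw [sub_mul, h1, mul_sub, sub_mul, mul_one, one_mul, one_mul]
  nth_rewrite 1 [h2]
  abel
end Braid

/-! ### The twist and the operator `P^(n)` in the coordinates of words of length `n` -/

section Coord
variable {ι : Type*}

/-- The product of `Q (w u) (w v)` over the inversions of `σ`, i.e. over the pairs `u < v` with
`σ u > σ v`. -/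
def invWeight (Q : ι → ι → ℝ) {n : ℕ} (σ : Perm (Fin n)) (w : Fin n → ι) : ℝ :=
  ∏ u, ∏ v, if u < v ∧ σ v < σ u then Q (w u) (w v) else 1

/-- The operator `T_k` in coordinates. -/
noncomputable def coordT (Q : ι → ι → ℝ) (n k : ℕ) : Module.End ℂ ((Fin n → ι) → ℂ) where
  toFun f w := if h : k + 1 < n then
    (Q (w ⟨k, by omega⟩) (w ⟨k + 1, h⟩) : ℂ) * f (w ∘ swap ⟨k, by omega⟩ ⟨k + 1, h⟩) else 0
  map_add' f g := by ext w; by_cases h : k + 1 < n <;> simp [h, mul_add]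
  map_smul' c f := by ext w; by_cases h : k + 1 < n <;> simp [h]; ring

/-- The operator `P^(n)` in coordinates. -/
noncomputable def coordP (Q : ι → ι → ℝ) (n : ℕ) : Module.End ℂ ((Fin n → ι) → ℂ) where
  toFun f w := ∑ σ : Perm (Fin n), (invWeight Q σ (w ∘ σ) : ℂ) * f (w ∘ σ)
  map_add' f g := by ext w; simp [mul_add, sum_add_distrib]
  map_smul' c f := by ext w; simp [mul_sum]; refine sum_congr rfl fun _ _ => by ring

theorem coordT_comm (Q : ι → ι → ℝ) (n j k : ℕ) (h : j + 2 ≤ k) :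
    coordT Q n j * coordT Q n k = coordT Q n k * coordT Q n j := by
  ext f w
  by_cases hk : k + 1 < n
  · have hj : j + 1 < n := by omega
    have hj0 : j < n := by omega
    have hk0 : k < n := by omega
    have e1 : swap (⟨j, hj0⟩ : Fin n) ⟨j+1, hj⟩ ⟨k, hk0⟩ = ⟨k, hk0⟩ :=
      swap_apply_of_ne_of_ne (by simp [Fin.ext_iff]; omega) (by simp [Fin.ext_iff]; omega)
    have e2 : swap (⟨j, hj0⟩ : Fin n) ⟨j+1, hj⟩ ⟨k+1, hk⟩ = ⟨k+1, hk⟩ :=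
      swap_apply_of_ne_of_ne (by simp [Fin.ext_iff]; omega) (by simp [Fin.ext_iff]; omega)
    have e3 : swap (⟨k, hk0⟩ : Fin n) ⟨k+1, hk⟩ ⟨j, hj0⟩ = ⟨j, hj0⟩ :=
      swap_apply_of_ne_of_ne (by simp [Fin.ext_iff]; omega) (by simp [Fin.ext_iff]; omega)
    have e4 : swap (⟨k, hk0⟩ : Fin n) ⟨k+1, hk⟩ ⟨j+1, hj⟩ = ⟨j+1, hj⟩ :=
      swap_apply_of_ne_of_ne (by simp [Fin.ext_iff]; omega) (by simp [Fin.ext_iff]; omega)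
    simp only [Module.End.mul_apply, coordT, LinearMap.coe_mk, AddHom.coe_mk, hk, hj, dif_pos,
      Function.comp_apply, e1, e2, e3, e4]
    have : (w ∘ swap (⟨j, hj0⟩ : Fin n) ⟨j+1, hj⟩) ∘ swap (⟨k, hk0⟩ : Fin n) ⟨k+1, hk⟩ =
        (w ∘ swap (⟨k, hk0⟩ : Fin n) ⟨k+1, hk⟩) ∘ swap (⟨j, hj0⟩ : Fin n) ⟨j+1, hj⟩ := by
      ext x
      simp only [Function.comp_apply, swap_apply_def]
      congr 1
      grind
    rw [this]; ring
  · simp [Module.End.mul_apply, coordT, hk]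

theorem coordT_braid (Q : ι → ι → ℝ) (n j : ℕ) :
    coordT Q n j * coordT Q n (j+1) * coordT Q n j =
      coordT Q n (j+1) * coordT Q n j * coordT Q n (j+1) := by
  ext f w
  by_cases hk : j + 1 + 1 < n
  · have hj : j + 1 < n := by omega
    have hj0 : j < n := by omega
    have e1 : swap (⟨j, hj0⟩ : Fin n) ⟨j+1, hj⟩ ⟨j+1+1, hk⟩ = ⟨j+1+1, hk⟩ :=
      swap_apply_of_ne_of_ne (by simp [Fin.ext_iff]; omega) (by simp [Fin.ext_iff])
    have e2 : swap (⟨j+1, hj⟩ : Fin n) ⟨j+1+1, hk⟩ ⟨j, hj0⟩ = ⟨j, hj0⟩ :=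
      swap_apply_of_ne_of_ne (by simp [Fin.ext_iff]) (by simp [Fin.ext_iff]; omega)
    simp only [Module.End.mul_apply, coordT, LinearMap.coe_mk, AddHom.coe_mk, hk, hj, dif_pos,
      Function.comp_apply, swap_apply_left, swap_apply_right, e1, e2]
    have : ((w ∘ swap (⟨j, hj0⟩ : Fin n) ⟨j+1, hj⟩) ∘ swap (⟨j+1, hj⟩ : Fin n) ⟨j+1+1, hk⟩) ∘
          swap (⟨j, hj0⟩ : Fin n) ⟨j+1, hj⟩ =
        ((w ∘ swap (⟨j+1, hj⟩ : Fin n) ⟨j+1+1, hk⟩) ∘ swap (⟨j, hj0⟩ : Fin n) ⟨j+1, hj⟩) ∘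
          swap (⟨j+1, hj⟩ : Fin n) ⟨j+1+1, hk⟩ := by
        ext x
        simp only [Function.comp_apply, swap_apply_def]
        congr 1
        grind
    rw [this]; ring
  · simp [Module.End.mul_apply, coordT, hk]

theorem coord_prodT (Q : ι → ι → ℝ) (n : ℕ) (f : (Fin (n + 1) → ι) → ℂ) (p : ℕ) (hp : p < n + 1)
    (w : Fin (n + 1) → ι) :
    prodT (coordT Q (n + 1)) p f w =
      ((∏ u : Fin n, if (u : ℕ) < p then Q (w 0) (w u.succ) else 1 : ℝ) : ℂ) *
        f (w ∘ Fin.cycleRange ⟨p, hp⟩) := by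
  induction p generalizing f with
  | zero =>
    have : Fin.cycleRange (⟨0, hp⟩ : Fin (n + 1)) = 1 := Fin.cycleRange_mk_zero _
    simp [prodT]
  | succ p ih =>
    have hp' : p < n + 1 := by omega
    rw [prodT, Module.End.mul_apply, ih _ hp']
    have e0 : Fin.cycleRange (⟨p, hp'⟩ : Fin (n + 1)) ⟨p, hp'⟩ = 0 := Fin.cycleRange_self _
    have e1 : Fin.cycleRange (⟨p, hp'⟩ : Fin (n + 1)) ⟨p + 1, hp⟩ = ⟨p + 1, hp⟩ :=
      Fin.cycleRange_of_gt (by simp [Fin.lt_def])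
    have e2 : (w ∘ Fin.cycleRange (⟨p, hp'⟩ : Fin (n + 1))) ∘ swap ⟨p, hp'⟩ ⟨p + 1, hp⟩ =
        w ∘ Fin.cycleRange ⟨p + 1, hp⟩ := by
      ext x
      simp only [Function.comp_apply]
      congr 1
      rcases lt_trichotomy (x : ℕ) p with h | h | h
      · rw [swap_apply_of_ne_of_ne (by simp [Fin.ext_iff]; omega) (by simp [Fin.ext_iff]; omega),
          Fin.ext_iff, Fin.coe_cycleRange_of_lt (by simpa [Fin.lt_def]),
          Fin.coe_cycleRange_of_lt (by simp [Fin.lt_def]; omega)]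
      · obtain rfl : x = ⟨p, hp'⟩ := Fin.ext h
        rw [swap_apply_left, e1, Fin.ext_iff, Fin.coe_cycleRange_of_lt (by simp [Fin.lt_def])]
      · rcases Nat.lt_or_ge (p + 1) x with h' | h'
        · rw [swap_apply_of_ne_of_ne (by simp [Fin.ext_iff]; omega) (by simp [Fin.ext_iff]; omega),
            Fin.cycleRange_of_gt (by simpa [Fin.lt_def]),
            Fin.cycleRange_of_gt (by simpa [Fin.lt_def])]
        · obtain rfl : x = ⟨p + 1, hp⟩ := Fin.ext (by simp; omega)
          rw [swap_apply_right, e0, Fin.cycleRange_self]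
    have e3 : (∏ u : Fin n, if (u : ℕ) < p + 1 then Q (w 0) (w u.succ) else 1) =
        (∏ u : Fin n, if (u : ℕ) < p then Q (w 0) (w u.succ) else 1) * Q (w 0) (w ⟨p + 1, hp⟩) := by
      have : Q (w 0) (w ⟨p + 1, hp⟩) =
          ∏ u : Fin n, if (⟨p, by omega⟩ : Fin n) = u then Q (w 0) (w u.succ) else 1 := by
        rw [prod_ite_eq]; simp
      rw [this, ← prod_mul_distrib]
      refine prod_congr rfl fun u _ => ?_
      rcases lt_trichotomy (u : ℕ) p with h | h | h
      · rw [if_pos (by omega), if_pos h, if_neg (by simp [Fin.ext_iff]; omega), mul_one]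
      · rw [if_pos (by omega), if_neg (by omega), if_pos (by simp [Fin.ext_iff]; omega), one_mul]
      · rw [if_neg (by omega), if_neg (by omega), if_neg (by simp [Fin.ext_iff]; omega), mul_one]
    rw [e3]
    simp only [coordT, LinearMap.coe_mk, AddHom.coe_mk, hp, dif_pos, e2, Function.comp_apply, e0, e1]
    push_cast; ring

/-- The permutation of `{0, …, n}` fixing `0` and acting as `ρ` on the rest -/
def liftPerm {n : ℕ} (ρ : Perm (Fin n)) : Perm (Fin (n + 1)) := Perm.decomposeFin.symm (0, ρ)

theorem liftPerm_zero {n : ℕ} (ρ : Perm (Fin n)) : liftPerm ρ 0 = 0 := by simp [liftPerm]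
theorem liftPerm_succ {n : ℕ} (ρ : Perm (Fin n)) (i : Fin n) :
    liftPerm ρ i.succ = (ρ i).succ := by simp [liftPerm]

theorem liftPerm_cycle_bij (n : ℕ) : Function.Bijective
    (fun x : Perm (Fin n) × Fin (n + 1) => liftPerm x.1 * Fin.cycleRange x.2) := by
  rw [Fintype.bijective_iff_injective_and_card]
  constructor
  · rintro ⟨ρ, p⟩ ⟨ρ', p'⟩ h
    simp only at h
    have hp : p = p' := by
      have h0 : (liftPerm ρ' * Fin.cycleRange p') p = 0 := by
        rw [← h]; simp [liftPerm_zero]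
      have h1 : (liftPerm ρ' * Fin.cycleRange p') p' = 0 := by simp [liftPerm_zero]
      exact (liftPerm ρ' * Fin.cycleRange p').injective (h0.trans h1.symm)
    subst hp
    have := mul_right_cancel h
    simp only [liftPerm, EmbeddingLike.apply_eq_iff_eq, Prod.mk.injEq, true_and] at this
    rw [this]
  · simp [Fintype.card_perm, Nat.factorial_succ, mul_comm]

theorem invWeight_succ (Q : ι → ι → ℝ) (hs : ∀ i j, Q i j = Q j i) (n : ℕ) (ρ : Perm (Fin n))
    (p : Fin (n + 1)) (w : Fin (n + 1) → ι) :
    invWeight Q (liftPerm ρ * Fin.cycleRange p) (w ∘ (liftPerm ρ * Fin.cycleRange p : Perm _)) =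
      invWeight Q ρ (Fin.tail w ∘ ρ) *
        ∏ u : Fin n, if (u : ℕ) < p then Q (w 0) (w (ρ u).succ) else 1 := by
  have h0 : (liftPerm ρ * Fin.cycleRange p) p = 0 := by simp [liftPerm_zero]
  have h1 : ∀ i, (liftPerm ρ * Fin.cycleRange p) (p.succAbove i) = (ρ i).succ := fun i => by
    simp [liftPerm_succ]
  simp only [invWeight, Function.comp_apply]
  rw [Fin.prod_univ_succAbove _ p]
  simp only [Fin.prod_univ_succAbove _ p, h0, h1]
  simp only [lt_self_iff_false, if_false, Fin.not_lt_zero, and_false, prod_const_one,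
    one_mul, prod_mul_distrib, Fin.succ_pos, and_true, Fin.succ_lt_succ_iff,
    Fin.succAbove_lt_succAbove_iff, Fin.tail]
  rw [mul_comm]
  congr 1
  refine prod_congr rfl fun u _ => ?_
  rw [hs (w 0)]
  have : p.succAbove u < p ↔ (u : ℕ) < p := Fin.succAbove_lt_iff_castSucc_lt p u
  simp only [this]

theorem coordP_succ (Q : ι → ι → ℝ) (hs : ∀ i j, Q i j = Q j i) (n : ℕ)
    (f : (Fin (n + 1) → ι) → ℂ) (w : Fin (n + 1) → ι) :
    coordP Q (n + 1) f w = coordP Q n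
      (fun w' => sumT (coordT Q (n + 1)) (n + 1) f (Fin.cons (w 0) w' : Fin (n + 1) → ι))
      (Fin.tail w) := by
  simp only [coordP, LinearMap.coe_mk, AddHom.coe_mk]
  rw [← (liftPerm_cycle_bij n).sum_comp (fun σ => (invWeight Q σ (w ∘ σ) : ℂ) * f (w ∘ σ)),
    Fintype.sum_prod_type]
  refine sum_congr rfl fun ρ _ => ?_
  rw [sumT, LinearMap.sum_apply, Finset.sum_apply, ← Fin.sum_univ_eq_sum_range
    (fun k => (prodT (coordT Q (n + 1)) k f) (Fin.cons (w 0) (Fin.tail w ∘ ρ) : Fin (n + 1) → ι)),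
    mul_sum]
  refine sum_congr rfl fun p _ => ?_
  rw [coord_prodT Q n f p p.2, invWeight_succ Q hs]
  have : (Fin.cons (w 0) (Fin.tail w ∘ ρ) : Fin (n + 1) → ι) = w ∘ liftPerm ρ := by
    ext x
    refine Fin.cases ?_ (fun i => ?_) x
    · simp [liftPerm_zero]
    · simp [liftPerm_succ, Fin.tail]
  rw [this]
  simp only [Function.comp_apply, liftPerm_zero, liftPerm_succ]
  push_cast
  rw [mul_assoc]
  rfl

theorem coordP_symm (Q : ι → ι → ℝ) (hs : ∀ i j, Q i j = Q j i) [Fintype ι] (n : ℕ)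
    (f g : (Fin n → ι) → ℂ) :
    ∑ w, star (f w) * coordP Q n g w = ∑ w, star (coordP Q n f w) * g w := by
  simp only [coordP, LinearMap.coe_mk, AddHom.coe_mk, mul_sum, star_sum, sum_mul]
  rw [sum_comm, sum_comm (s := univ) (t := univ) (γ := Fin n → ι)]
  rw [← Equiv.sum_comp (Equiv.inv (Perm (Fin n)))]
  refine sum_congr rfl fun σ _ => ?_
  rw [← Equiv.sum_comp (Equiv.arrowCongr σ.symm (Equiv.refl ι))]
  refine sum_congr rfl fun w _ => ?_
  have e1 : (Equiv.arrowCongr σ.symm (Equiv.refl ι)) w = w ∘ σ := by ext x; simp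
  have e2 : (w ∘ σ) ∘ (Equiv.inv (Perm (Fin n)) σ) = w := by ext x; simp
  have e3 : invWeight Q (Equiv.inv (Perm (Fin n)) σ) w = invWeight Q σ (w ∘ σ) := by
    simp only [invWeight, Equiv.inv_apply, Function.comp_apply]
    rw [← Equiv.prod_comp σ]
    rw [prod_comm (s := univ) (t := univ) (f := fun u v =>
      if u < v ∧ σ v < σ u then Q (w (σ u)) (w (σ v)) else 1)]
    refine prod_congr rfl fun u _ => ?_
    rw [← Equiv.prod_comp σ]
    refine prod_congr rfl fun v _ => ?_
    rw [hs]
    simp [and_comm]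
  rw [e1, e2, e3]
  simp
  ring

variable [Fintype ι]

theorem norm_coordT_le (Q : ι → ι → ℝ) {r : ℝ} (hr : 0 ≤ r) (hQ : ∀ i j, |Q i j| ≤ r) (n k : ℕ)
    (f : (Fin n → ι) → ℂ) : ‖coordT Q n k f‖ ≤ r * ‖f‖ := by
  rw [pi_norm_le_iff_of_nonneg (by positivity)]
  intro w
  by_cases h : k + 1 < n
  · simp only [coordT, LinearMap.coe_mk, AddHom.coe_mk, h, dif_pos, norm_mul, Complex.norm_real,
      Real.norm_eq_abs]
    gcongr
    · exact hQ _ _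
    · exact norm_le_pi_norm f _
  · simp only [coordT, LinearMap.coe_mk, AddHom.coe_mk, h, dif_neg, norm_zero, not_false_eq_true]
    positivity

theorem norm_prodT_le (Q : ι → ι → ℝ) {r : ℝ} (hr : 0 ≤ r) (hQ : ∀ i j, |Q i j| ≤ r) (n k : ℕ)
    (f : (Fin n → ι) → ℂ) : ‖prodT (coordT Q n) k f‖ ≤ r ^ k * ‖f‖ := by
  induction k generalizing f with
  | zero => simp [prodT]
  | succ k ih =>
    rw [prodT, Module.End.mul_apply]
    refine (ih _).trans ?_
    rw [pow_succ, mul_assoc]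
    gcongr
    exact norm_coordT_le Q hr hQ n k f

theorem injective_one_sub {n : ℕ} (X : Module.End ℂ ((Fin n → ι) → ℂ)) {r : ℝ} (hr : r < 1)
    (hX : ∀ f, ‖X f‖ ≤ r * ‖f‖) : Function.Injective (1 - X : Module.End ℂ _) := by
  rw [← LinearMap.ker_eq_bot, LinearMap.ker_eq_bot']
  intro f hf
  have h1 : f = X f := by
    simpa [sub_eq_zero] using hf
  have h2 := hX f
  rw [← h1] at h2
  have : ‖f‖ ≤ 0 := by nlinarith [norm_nonneg f]
  simpa using this

theorem sumT_injective (Q : ι → ι → ℝ) {r : ℝ} (hr : 0 ≤ r) (hr1 : r < 1)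
    (hQ : ∀ i j, |Q i j| ≤ r) (n m : ℕ) :
    Function.Injective (sumT (coordT Q n) (m + 1) : Module.End ℂ ((Fin n → ι) → ℂ)) := by
  induction m with
  | zero =>
    have : sumT (coordT Q n) (0 + 1) = 1 := by simp [sumT, prodT]
    rw [this]; exact fun _ _ h => h
  | succ m ih =>
    have key := sumT_factor (coordT Q n) (coordT_braid Q n) (coordT_comm Q n) (m + 1)
    have hp : ∀ f, ‖prodT (coordT Q n) (m + 1) f‖ ≤ r * ‖f‖ := fun f => by
      refine (norm_prodT_le Q hr hQ n _ f).trans ?_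
      gcongr
      simpa using pow_le_pow_of_le_one hr hr1.le (show 1 ≤ m + 1 by omega)
    have i1 := injective_one_sub _ hr1 hp
    have i2 : Function.Injective (1 - coordT Q n 0 * prodT (coordT Q n) (m + 1) :
        Module.End ℂ _) := by
      refine injective_one_sub _ hr1 fun f => ?_
      rw [Module.End.mul_apply]
      refine (norm_coordT_le Q hr hQ n 0 _).trans ?_
      calc r * ‖prodT (coordT Q n) (m + 1) f‖ ≤ 1 * (r * ‖f‖) := by
            gcongr
            exact hp f
        _ = _ := one_mul _
    have i3 : Function.Injective (sumT (coordT Q n) (m + 1 + 1) *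
        (1 - prodT (coordT Q n) (m + 1)) : Module.End ℂ ((Fin n → ι) → ℂ)) := by
      rw [key]; exact i2.comp ih
    have s1 := LinearMap.injective_iff_surjective.1 i1
    intro f g hfg
    obtain ⟨f', rfl⟩ := s1 f
    obtain ⟨g', rfl⟩ := s1 g
    rw [i3 hfg]

theorem coordP_injective (Q : ι → ι → ℝ) (hs : ∀ i j, Q i j = Q j i) {r : ℝ} (hr : 0 ≤ r)
    (hr1 : r < 1) (hQ : ∀ i j, |Q i j| ≤ r) (n : ℕ) : Function.Injective (coordP Q n) := by
  induction n with
  | zero =>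
    intro f g h
    ext w
    have := congrFun h w
    simpa [coordP, invWeight, Subsingleton.elim _ w] using this
  | succ n ih =>
    intro f g h
    refine sumT_injective Q hr hr1 hQ (n + 1) n ?_
    ext w
    have : (fun w' : Fin n → ι => sumT (coordT Q (n + 1)) (n + 1) f
          (Fin.cons (w 0) w' : Fin (n + 1) → ι)) =
        (fun w' : Fin n → ι => sumT (coordT Q (n + 1)) (n + 1) g
          (Fin.cons (w 0) w' : Fin (n + 1) → ι)) := by
      refine ih ?_
      ext w'
      have := congrFun h (Fin.cons (w 0) w')
      rw [coordP_succ Q hs, coordP_succ Q hs] at this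
      simpa using this
    have := congrFun this (Fin.tail w)
    simpa using this

/-- The quadratic form `⟨f, P^(n) f⟩`. -/
noncomputable def coordN (Q : ι → ι → ℝ) (n : ℕ) (f : (Fin n → ι) → ℂ) : ℝ :=
  (∑ w, star (f w) * coordP Q n f w).re

theorem coordN_null (Q : ι → ι → ℝ) (hs : ∀ i j, Q i j = Q j i) (n : ℕ)
    (hpos : ∀ f, 0 ≤ coordN Q n f) (f : (Fin n → ι) → ℂ) (hf : coordN Q n f = 0) :
    coordP Q n f = 0 := by
  set g := coordP Q n f with hg
  set a : ℝ := (∑ w, star (g w) * g w).re with ha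
  have ha' : a = ∑ w, ‖g w‖ ^ 2 := by
    rw [ha, Complex.re_sum]
    refine sum_congr rfl fun w _ => ?_
    rw [Complex.star_def, ← Complex.normSq_eq_conj_mul_self, Complex.ofReal_re,
      Complex.normSq_eq_norm_sq]
  have hexp : ∀ t : ℝ, coordN Q n (f + (t : ℂ) • g) = 2 * t * a + t ^ 2 * coordN Q n g := by
    intro t
    have e1 : ∑ w, star (f w) * coordP Q n g w = ∑ w, star (g w) * g w := by
      rw [coordP_symm Q hs]
    have : ∑ w, star ((f + (t : ℂ) • g) w) * coordP Q n (f + (t : ℂ) • g) w =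
        ∑ w, star (f w) * coordP Q n f w + (t : ℂ) * ∑ w, star (f w) * coordP Q n g w +
        (t : ℂ) * ∑ w, star (g w) * g w + ((t ^ 2 : ℝ) : ℂ) * ∑ w, star (g w) * coordP Q n g w := by
      simp only [map_add, map_smul, Pi.add_apply, Pi.smul_apply, smul_eq_mul, mul_sum,
        ← sum_add_distrib, star_add, star_mul', Complex.star_def, Complex.conj_ofReal, ← hg]
      refine sum_congr rfl fun w _ => ?_
      push_cast; ring
    rw [coordN, this, e1]
    simp only [Complex.add_re, Complex.re_ofReal_mul, ← ha]
    rw [← coordN, ← coordN, hf]; ring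
  have hb := hpos g
  have h0 : a ≤ 0 := by
    by_contra hc
    push Not at hc
    have h1 := hpos (f + ((-(a / (coordN Q n g + 1)) : ℝ) : ℂ) • g)
    rw [hexp] at h1
    have h2 : 2 * -(a / (coordN Q n g + 1)) * a + (-(a / (coordN Q n g + 1))) ^ 2 * coordN Q n g =
      - (a ^ 2 * (coordN Q n g + 2)) / (coordN Q n g + 1) ^ 2 := by
      field_simp; ring
    rw [h2] at h1
    have : 0 < (a ^ 2 * (coordN Q n g + 2)) / (coordN Q n g + 1) ^ 2 := by positivity
    rw [neg_div] at h1
    linarith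
  rw [ha'] at h0
  ext w
  have h3 := (sum_eq_zero_iff_of_nonneg (fun w _ => by positivity)).1
    (le_antisymm h0 (sum_nonneg fun w _ => by positivity)) w (mem_univ w)
  simpa using h3

theorem coordN_continuous (Q : ι → ι → ℝ) (n : ℕ) :
    Continuous fun x : ℝ × ((Fin n → ι) → ℂ) => coordN (fun i j => x.1 * Q i j) n x.2 := by
  unfold coordN coordP invWeight
  simp only [LinearMap.coe_mk, AddHom.coe_mk]
  refine Complex.continuous_re.comp (continuous_finsetSum _ fun w _ => ?_)
  refine (continuous_star.comp ((continuous_apply w).comp continuous_snd)).mul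
    (continuous_finsetSum _ fun σ _ => ?_)
  refine (Complex.continuous_ofReal.comp (continuous_finsetProd _ fun u _ =>
    continuous_finsetProd _ fun v _ => ?_)).mul ((continuous_apply _).comp continuous_snd)
  split_ifs <;> fun_prop

theorem coordN_smul (Q : ι → ι → ℝ) (n : ℕ) (c : ℝ) (f : (Fin n → ι) → ℂ) :
    coordN Q n ((c : ℂ) • f) = c ^ 2 * coordN Q n f := by
  have : ∑ w, star (((c : ℂ) • f) w) * coordP Q n ((c : ℂ) • f) w =
      ((c ^ 2 : ℝ) : ℂ) * ∑ w, star (f w) * coordP Q n f w := by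
    rw [mul_sum]
    refine sum_congr rfl fun w _ => ?_
    simp; ring
  rw [coordN, this, Complex.re_ofReal_mul, ← coordN]

theorem coordN_pos_iff_sphere (Q : ι → ι → ℝ) (n : ℕ) :
    (∀ f, f ≠ 0 → 0 < coordN Q n f) ↔ ∀ f ∈ Metric.sphere (0 : (Fin n → ι) → ℂ) 1, 0 < coordN Q n f := by
  constructor
  · intro h f hf
    exact h f (by rintro rfl; simp at hf)
  · intro h f hf
    have hn : 0 < ‖f‖ := norm_pos_iff.2 hf
    have := h (((‖f‖⁻¹ : ℝ) : ℂ) • f) (by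
      rw [mem_sphere_zero_iff_norm, norm_smul, Complex.norm_real, norm_inv, norm_norm,
        inv_mul_cancel₀ hn.ne'])
    rw [coordN_smul] at this
    exact pos_of_mul_pos_right this (by positivity)

open Topology in
theorem coordN_pos (Q : ι → ι → ℝ) (hs : ∀ i j, Q i j = Q j i) {r : ℝ} (hr : 0 ≤ r) (hr1 : r < 1)
    (hQ : ∀ i j, |Q i j| ≤ r) (n : ℕ) (f : (Fin n → ι) → ℂ) (hf : f ≠ 0) : 0 < coordN Q n f := by
  let Qs : ℝ → ι → ι → ℝ := fun s i j => s * Q i j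
  let S : Set ℝ := {s | ∀ f, f ≠ 0 → 0 < coordN (Qs s) n f}
  have hcont := coordN_continuous Q n
  have hcl : IsClosed (S ∩ Set.Icc 0 1) := by
    have : S ∩ Set.Icc 0 1 = (⋂ f, {s | 0 ≤ coordN (Qs s) n f}) ∩ Set.Icc 0 1 := by
      ext s
      simp only [Set.mem_inter_iff, Set.mem_iInter, Set.mem_ofPred_eq, and_congr_left_iff, S]
      intro hs01
      constructor
      · intro h f
        rcases eq_or_ne f 0 with rfl | hf
        · simp [coordN]
        · exact (h f hf).le
      · intro h f hf
        refine lt_of_le_of_ne (h f) fun h0 => hf ?_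
        have hsym : ∀ i j, Qs s i j = Qs s j i := fun i j => by simp only [Qs]; rw [hs]
        have := coordN_null (Qs s) hsym n h f h0.symm
        refine coordP_injective (Qs s) hsym hr hr1 (fun i j => ?_) n (by rw [this, map_zero])
        simp only [Qs, abs_mul]
        calc |s| * |Q i j| ≤ 1 * r := by
              gcongr
              · rw [abs_le]; constructor <;> linarith [hs01.1, hs01.2]
              · exact hQ i j
          _ = r := one_mul r
    rw [this]
    refine IsClosed.inter (isClosed_iInter fun f => ?_) isClosed_Icc
    exact isClosed_le continuous_const (hcont.comp (continuous_id.prodMk continuous_const))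
  have h0 : (0 : ℝ) ∈ S := by
    intro f hf
    have e : coordN (Qs 0) n f = ∑ w, ‖f w‖ ^ 2 := by
      rw [coordN, Complex.re_sum]
      refine sum_congr rfl fun w _ => ?_
      have : coordP (Qs 0) n f w = f w := by
        simp only [coordP, LinearMap.coe_mk, AddHom.coe_mk]
        rw [sum_eq_single 1]
        · have : invWeight (Qs 0) 1 (w ∘ (1 : Perm (Fin n))) = 1 := by
            refine prod_eq_one fun u _ => prod_eq_one fun v _ => if_neg ?_
            simp only [Perm.one_apply]; exact fun h => lt_asymm h.1 h.2
          rw [this]; simp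
        · intro σ _ hσ
          have : invWeight (Qs 0) σ (w ∘ σ) = 0 := by
            have : ¬ StrictMono σ := fun h => hσ (Equiv.ext fun x => by
              have := Subsingleton.elim (h.orderIsoOfSurjective σ σ.surjective) (OrderIso.refl _)
              exact congrArg (fun e => e x) this)
            simp only [StrictMono, not_forall, not_lt] at this
            obtain ⟨u, v, huv, h⟩ := this
            refine prod_eq_zero (mem_univ u) (prod_eq_zero (mem_univ v) ?_)
            rw [if_pos ⟨huv, lt_of_le_of_ne h (fun h => huv.ne' (σ.injective h))⟩]
            simp [Qs]
          rw [this]; simp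
        · simp
      rw [this, Complex.star_def, ← Complex.normSq_eq_conj_mul_self, Complex.ofReal_re,
        Complex.normSq_eq_norm_sq]
    rw [e]
    obtain ⟨w, hw⟩ := Function.ne_iff.1 hf
    exact sum_pos' (fun w _ => by positivity) ⟨w, mem_univ w, by
      have := norm_pos_iff.2 hw; positivity⟩
  have hop : ∀ x ∈ S ∩ Set.Ico 0 1, S ∈ 𝓝[>] x := by
    intro x hx
    refine mem_nhdsWithin_of_mem_nhds ?_
    have hx1 := (coordN_pos_iff_sphere _ n).1 hx.1
    have ho : IsOpen {y : ℝ × ((Fin n → ι) → ℂ) | 0 < coordN (Qs y.1) n y.2} :=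
      isOpen_lt continuous_const hcont
    obtain ⟨u, v, hu, -, hxu, hsv, huv⟩ := generalized_tube_lemma (isCompact_singleton (x := x))
      (isCompact_sphere (0 : (Fin n → ι) → ℂ) 1) ho (by
        rintro ⟨y, f⟩ ⟨hy, hf⟩
        obtain rfl : y = x := hy
        exact hx1 f hf)
    refine Filter.mem_of_superset (hu.mem_nhds (hxu rfl)) fun y hy => ?_
    exact (coordN_pos_iff_sphere _ n).2 fun f hf => huv (Set.mk_mem_prod hy (hsv hf))
  have := hcl.Icc_subset_of_forall_mem_nhdsWithin h0 hop (Set.right_mem_Icc.2 zero_le_one)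
  have := this f hf
  simpa [Qs] using this

theorem invWeight_one {ι : Type*} (Q : ι → ι → ℝ) {n : ℕ} (w : Fin n → ι) :
    invWeight Q 1 w = 1 :=
  prod_eq_one fun _ _ => prod_eq_one fun _ _ => if_neg fun h => lt_asymm h.1 h.2

theorem invWeight_swap_mul {ι : Type*} (Q : ι → ι → ℝ) {n k : ℕ} (h : k + 1 < n)
    (σ : Perm (Fin n)) (w : Fin n → ι)
    (hσ : σ⁻¹ ⟨k, by omega⟩ < σ⁻¹ ⟨k + 1, h⟩) :
    invWeight Q (swap ⟨k, by omega⟩ ⟨k + 1, h⟩ * σ) w =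
      Q (w (σ⁻¹ ⟨k, by omega⟩)) (w (σ⁻¹ ⟨k + 1, h⟩)) * invWeight Q σ w := by
  set u0 := σ⁻¹ ⟨k, by omega⟩ with hu0
  set v0 := σ⁻¹ ⟨k + 1, h⟩ with hv0
  have e0 : σ u0 = ⟨k, by omega⟩ := by rw [hu0]; simp
  have e1 : σ v0 = ⟨k + 1, h⟩ := by rw [hv0]; simp
  have hQ : Q (w u0) (w v0) = ∏ u, ∏ v, if u0 = u ∧ v0 = v then Q (w u) (w v) else 1 := by
    rw [prod_eq_single u0, prod_eq_single v0]
    · simp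
    · intro v _ hv; rw [if_neg fun hh => hv hh.2.symm]
    · simp
    · intro u _ hu; exact prod_eq_one fun v _ => if_neg fun hh => hu hh.1.symm
    · simp
  rw [hQ, invWeight, invWeight, ← prod_mul_distrib]
  refine prod_congr rfl fun u _ => ?_
  rw [← prod_mul_distrib]
  refine prod_congr rfl fun v _ => ?_
  by_cases huv : u0 = u ∧ v0 = v
  · obtain ⟨rfl, rfl⟩ := huv
    have hk : (⟨k, by omega⟩ : Fin n) < ⟨k + 1, h⟩ := Nat.lt_succ_self k
    rw [Perm.mul_apply, Perm.mul_apply, e0, e1, swap_apply_left, swap_apply_right,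
      if_pos ⟨hσ, hk⟩, if_pos ⟨rfl, rfl⟩, if_neg fun hh => lt_asymm hk hh.2, mul_one]
  · rw [if_neg huv, one_mul]
    congr 1
    simp only [eq_iff_iff, and_congr_right_iff, Perm.mul_apply]
    intro hlt
    have i0 : ∀ x, σ x = ⟨k, by omega⟩ ↔ x = u0 := fun x => by rw [← e0]; exact σ.injective.eq_iff
    have i1 : ∀ x, σ x = ⟨k + 1, h⟩ ↔ x = v0 := fun x => by rw [← e1]; exact σ.injective.eq_iff
    have hne : σ u ≠ σ v := fun hh => hlt.ne (σ.injective hh)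
    have c1 : ¬ (σ u = ⟨k, by omega⟩ ∧ σ v = ⟨k + 1, h⟩) := by
      rw [i0, i1]; exact fun hh => huv ⟨hh.1.symm, hh.2.symm⟩
    have c2 : ¬ (σ v = ⟨k, by omega⟩ ∧ σ u = ⟨k + 1, h⟩) := by
      rw [i0, i1]; rintro ⟨rfl, rfl⟩; exact lt_asymm hσ hlt
    simp only [Fin.ext_iff, Fin.lt_def, swap_apply_def, ne_eq] at c1 c2 hne ⊢
    split_ifs <;> simp_all <;> omega

end Coord

/-! ### The algebraic Fock space -/

/-- A basis `e_1, …, e_d` of the complexification `H_ℂ` (which is all of `H_U`, as the dimension is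
finite) that is orthonormal for `⟨·,·⟩_U` and such that `e_k ∈ H_ℂ^(col k)` for each `k`. -/
structure HomogeneousBasis {H N : Type*} [NormedAddCommGroup H] [InnerProductSpace ℝ H]
    (S : MixedQData H N) (d : ℕ) where
  vec : Module.Basis (Fin d) ℂ (Complexification H)
  orthonormal : ∀ k l, S.innerU (vec k) (vec l) = if k = l then 1 else 0
  col : Fin d → N
  vec_mem : ∀ k, (vec k).re ∈ S.comp (col k) ∧ (vec k).im ∈ S.comp (col k)

namespace HomogeneousBasis
variable {H N : Type*} [NormedAddCommGroup H] [InnerProductSpace ℝ H] {S : MixedQData H N} {d : ℕ}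
  (b : HomogeneousBasis S d)

/-- The algebraic Fock space: the direct sum of the algebraic tensor powers of `H_U = H_ℂ`. The
product is the tensor product of vectors, and `1` is the vacuum vector. -/
abbrev Tens (_ : HomogeneousBasis S d) : Type _ := TensorAlgebra ℂ (Complexification H)

/-- `q(i_k, i_l)`, where `i_k` is the colour of `e_k`. -/
def Q (k l : Fin d) : ℝ := S.q (b.col k) (b.col l)

/-- The simple tensor `e_w = e_{w 0} ⊗ ⋯ ⊗ e_{w (n-1)}`. -/
noncomputable def tens {n : ℕ} (w : Fin n → Fin d) : b.Tens :=
  TensorAlgebra.tprod ℂ (Complexification H) n fun k => b.vec (w k)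

/-- The linear basis of the algebraic Fock space formed by the simple tensors `e_w`, see
`wordBasis_apply`. -/
noncomputable def wordBasis : Module.Basis (Σ n, Fin n → Fin d) ℂ b.Tens :=
  b.vec.tensorAlgebra.reindex (FreeMonoid.toList.trans List.equivSigmaTuple)

theorem tensorAlgebra_apply (l : List (Fin d)) :
    b.vec.tensorAlgebra (FreeMonoid.ofList l) =
      (l.map fun k => TensorAlgebra.ι ℂ (b.vec k)).prod := by
  apply (TensorAlgebra.equivFreeAlgebra b.vec).injective
  rw [map_list_prod, List.map_map]
  have : (TensorAlgebra.equivFreeAlgebra b.vec) (b.vec.tensorAlgebra (FreeMonoid.ofList l)) =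
      FreeAlgebra.basisFreeMonoid ℂ (Fin d) (FreeMonoid.ofList l) := by
    simp [Module.Basis.tensorAlgebra]
  rw [this]
  simp only [Function.comp_def, TensorAlgebra.equivFreeAlgebra_ι_apply]
  have h2 : FreeAlgebra.basisFreeMonoid ℂ (Fin d) (FreeMonoid.ofList l) =
      FreeAlgebra.equivMonoidAlgebraFreeMonoid.symm
        (MonoidAlgebra.single (FreeMonoid.ofList l) 1) := rfl
  rw [h2]
  induction l with
  | nil =>
    have : MonoidAlgebra.single (FreeMonoid.ofList ([] : List (Fin d))) (1 : ℂ) = 1 := rfl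
    rw [this]; simp
  | cons a l ih =>
    have : MonoidAlgebra.single (FreeMonoid.ofList (a :: l)) (1 : ℂ) =
      MonoidAlgebra.single (FreeMonoid.of a) 1 * MonoidAlgebra.single (FreeMonoid.ofList l) 1 := by
      rw [MonoidAlgebra.single_mul_single, mul_one]; rfl
    rw [this, map_mul, List.map_cons, List.prod_cons]
    rw [← ih]
    · congr 1
      simp [FreeAlgebra.equivMonoidAlgebraFreeMonoid, AlgEquiv.ofAlgHom]
    · simp [Module.Basis.tensorAlgebra]
    · rfl

theorem wordBasis_apply {n : ℕ} (w : Fin n → Fin d) : b.wordBasis ⟨n, w⟩ = b.tens w := by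
  rw [wordBasis, Module.Basis.reindex_apply]
  have : (FreeMonoid.toList.trans List.equivSigmaTuple).symm ⟨n, w⟩ =
    FreeMonoid.ofList (List.ofFn w) := rfl
  rw [this, tensorAlgebra_apply, tens, TensorAlgebra.tprod_apply, List.map_ofFn]
  rfl

/-- The operator `T_k = 1 ⊗ ⋯ ⊗ 1 ⊗ T ⊗ 1 ⊗ ⋯ ⊗ 1`, with `T` acting on the positions `k, k + 1`, where
`T (ξ ⊗ η) = q_ij η ⊗ ξ` for `ξ ∈ H^(i)`, `η ∈ H^(j)`. (On tensors of length at most `k + 1`, where it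
is not needed, it is set to `0`.) -/
noncomputable def opT (k : ℕ) : Module.End ℂ b.Tens :=
  b.wordBasis.constr ℂ fun p => if h : k + 1 < p.1 then
    (b.Q (p.2 ⟨k, by omega⟩) (p.2 ⟨k + 1, h⟩) : ℂ) • b.tens (p.2 ∘ swap ⟨k, by omega⟩ ⟨k + 1, h⟩)
  else 0

/-- `Φ(σ) e_w`, where `Φ` is the quasi-multiplicative map on the symmetric group with `Φ(1) = 1` and
`Φ(τ_k) = T_k` for the adjacent transposition `τ_k`, see `phi_one` and `phi_swap_mul`: the letter in
position `t` is moved to position `σ t`, and each inversion `(u, v)` of `σ` contributes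
`q(i_u, i_v)`. -/
noncomputable def phi {n : ℕ} (σ : Perm (Fin n)) (w : Fin n → Fin d) : b.Tens :=
  (invWeight b.Q σ w : ℂ) • b.tens (w ∘ (σ⁻¹ : Perm (Fin n)))

/-- The operator `P^(n) = ∑_σ Φ(σ)` on tensors of length `n`, for all `n` at once. -/
noncomputable def opP : Module.End ℂ b.Tens :=
  b.wordBasis.constr ℂ fun p => ∑ σ : Perm (Fin p.1), b.phi σ p.2

/-- The undeformed inner product, for which the simple tensors `e_w` are orthonormal (tensors of
different length being orthogonal). -/
noncomputable def inner0 (x y : b.Tens) : ℂ :=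
  (b.wordBasis.repr x).sum fun p c => star c * b.wordBasis.repr y p

/-- The `T`-deformed inner product `⟨x, y⟩_T = ⟨x, P^(n) y⟩`. -/
noncomputable def innerT (x y : b.Tens) : ℂ := b.inner0 x (b.opP y)

/-- The coordinates of the component of length `n`. -/
noncomputable def coord (n : ℕ) : b.Tens →ₗ[ℂ] ((Fin n → Fin d) → ℂ) where
  toFun x w := b.wordBasis.repr x ⟨n, w⟩
  map_add' x y := by ext w; simp
  map_smul' c x := by ext w; simp

theorem coord_apply (n : ℕ) (x : b.Tens) (w) : b.coord n x w = b.wordBasis.repr x ⟨n, w⟩ := rfl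

theorem coord_tens (n : ℕ) (w w' : Fin n → Fin d) :
    b.coord n (b.tens w) w' = if w = w' then 1 else 0 := by
  rw [coord_apply, ← wordBasis_apply, Module.Basis.repr_self, Finsupp.single_apply]
  simp

theorem coord_tens_ne (n m : ℕ) (h : m ≠ n) (w : Fin m → Fin d) : b.coord n (b.tens w) = 0 := by
  ext w'
  rw [coord_apply, ← wordBasis_apply, Module.Basis.repr_self, Finsupp.single_apply, if_neg]
  · rfl
  · simp [h]

theorem Q_symm (k l : Fin d) : b.Q k l = b.Q l k := S.q_symm _ _

theorem opT_tens (k n : ℕ) (w : Fin n → Fin d) : b.opT k (b.tens w) = if h : k + 1 < n then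
    (b.Q (w ⟨k, by omega⟩) (w ⟨k + 1, h⟩) : ℂ) • b.tens (w ∘ swap ⟨k, by omega⟩ ⟨k + 1, h⟩)
    else 0 := by
  rw [← wordBasis_apply, opT, Module.Basis.constr_basis]

theorem phi_one {n : ℕ} (w : Fin n → Fin d) : b.phi 1 w = b.tens w := by
  simp [phi, invWeight_one]

theorem phi_swap_mul {n k : ℕ} (h : k + 1 < n) (σ : Perm (Fin n)) (w : Fin n → Fin d)
    (hσ : σ⁻¹ ⟨k, by omega⟩ < σ⁻¹ ⟨k + 1, h⟩) :
    b.phi (swap ⟨k, by omega⟩ ⟨k + 1, h⟩ * σ) w = b.opT k (b.phi σ w) := by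
  rw [phi, phi, invWeight_swap_mul _ h _ _ hσ, map_smul, opT_tens, dif_pos h, smul_smul,
    Complex.ofReal_mul, mul_comm]
  congr 2

theorem opP_tens (n : ℕ) (w : Fin n → Fin d) : b.opP (b.tens w) = ∑ σ : Perm (Fin n),
    (invWeight b.Q σ w : ℂ) • b.tens (w ∘ (σ⁻¹ : Perm (Fin n))) := by
  rw [← wordBasis_apply, opP, Module.Basis.constr_basis]
  rfl

theorem coord_opT (n k : ℕ) (x : b.Tens) : b.coord n (b.opT k x) = coordT b.Q n k (b.coord n x) := by
  have : b.coord n ∘ₗ b.opT k = coordT b.Q n k ∘ₗ b.coord n := by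
    refine b.wordBasis.ext fun ⟨m, w⟩ => ?_
    simp only [LinearMap.comp_apply, wordBasis_apply, opT_tens]
    rcases eq_or_ne m n with rfl | hmn
    · by_cases h : k + 1 < m
      · rw [dif_pos h, map_smul]
        ext w'
        rw [Pi.smul_apply, coord_tens]
        simp only [coordT, LinearMap.coe_mk, AddHom.coe_mk, h, dif_pos, coord_tens, smul_eq_mul]
        have e : w ∘ swap (⟨k, by omega⟩ : Fin m) ⟨k + 1, h⟩ = w' ↔
            w = w' ∘ swap (⟨k, by omega⟩ : Fin m) ⟨k + 1, h⟩ := by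
          constructor
          · rintro rfl; ext x; simp
          · rintro rfl; ext x; simp
        by_cases hw : w = w' ∘ swap (⟨k, by omega⟩ : Fin m) ⟨k + 1, h⟩
        · rw [if_pos (e.2 hw), if_pos hw, hw, b.Q_symm]; simp
        · rw [if_neg (mt e.1 hw), if_neg hw]; simp
      · rw [dif_neg h]; ext w'; simp [coordT, h]
    · rw [coord_tens_ne _ _ _ hmn, map_zero]
      split_ifs with h
      · rw [map_smul, coord_tens_ne _ _ _ hmn, smul_zero]
      · simp
  exact LinearMap.congr_fun this x

theorem coord_opP (n : ℕ) (x : b.Tens) : b.coord n (b.opP x) = coordP b.Q n (b.coord n x) := by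
  have : b.coord n ∘ₗ b.opP = coordP b.Q n ∘ₗ b.coord n := by
    refine b.wordBasis.ext fun ⟨m, w⟩ => ?_
    simp only [LinearMap.comp_apply, wordBasis_apply, opP_tens, map_sum, map_smul]
    rcases eq_or_ne m n with rfl | hmn
    · ext w'
      simp only [Finset.sum_apply, Pi.smul_apply, coord_tens, smul_eq_mul, coordP,
        LinearMap.coe_mk, AddHom.coe_mk]
      refine sum_congr rfl fun σ _ => ?_
      have e : w ∘ (σ⁻¹ : Perm (Fin m)) = w' ↔ w = w' ∘ σ := by
        constructor
        · rintro rfl; ext x; simp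
        · rintro rfl; ext x; simp
      by_cases hw : w = w' ∘ σ
      · rw [if_pos (e.2 hw), if_pos hw, hw]
      · rw [if_neg (mt e.1 hw), if_neg hw]; simp
    · simp [coord_tens_ne _ _ _ hmn]
  exact LinearMap.congr_fun this x

theorem exists_coord_eq_zero (x : b.Tens) : ∃ M, ∀ n, M ≤ n → b.coord n x = 0 := by
  refine ⟨(b.wordBasis.repr x).support.sup (fun p => p.1) + 1, fun n hn => ?_⟩
  ext w
  rw [coord_apply]
  by_contra h
  have := Finset.le_sup (f := fun p : Σ n, Fin n → Fin d => p.1) (Finsupp.mem_support_iff.2 h)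
  simp only at this
  omega

theorem inner0_eq (x y : b.Tens) (M : ℕ) (hM : ∀ n, M ≤ n → b.coord n x = 0) :
    b.inner0 x y = ∑ n ∈ range M, ∑ w, star (b.coord n x w) * b.coord n y w := by
  rw [inner0, Finsupp.sum_of_support_subset _
    (s := (range M).sigma fun _ => univ) _ _ (by simp), Finset.sum_sigma]
  · rfl
  · rintro ⟨n, w⟩ h
    simp only [mem_sigma, mem_range, mem_univ, and_true]
    by_contra hn
    push Not at hn
    exact Finsupp.mem_support_iff.1 h (congrFun (hM n hn) w)

theorem innerT_eq (x y : b.Tens) (M : ℕ) (hM : ∀ n, M ≤ n → b.coord n x = 0) :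
    b.innerT x y = ∑ n ∈ range M, ∑ w, star (b.coord n x w) * coordP b.Q n (b.coord n y) w := by
  rw [innerT, inner0_eq _ _ _ M hM]
  simp only [coord_opP]

theorem exists_Q_le : ∃ r : ℝ, 0 ≤ r ∧ r < 1 ∧ ∀ k l, |b.Q k l| ≤ r := by
  rcases isEmpty_or_nonempty (Fin d) with h | h
  · exact ⟨0, le_rfl, one_pos, fun k => isEmptyElim k⟩
  · obtain ⟨p, -, hp⟩ := exists_max_image (univ : Finset (Fin d × Fin d))
      (fun p => |b.Q p.1 p.2|) univ_nonempty
    exact ⟨|b.Q p.1 p.2|, abs_nonneg _, S.q_lt_one _ _, fun k l => hp (k, l) (mem_univ _)⟩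

theorem coordN_nonneg (n : ℕ) (f : (Fin n → Fin d) → ℂ) : 0 ≤ coordN b.Q n f := by
  obtain ⟨r, hr, hr1, hQ⟩ := b.exists_Q_le
  rcases eq_or_ne f 0 with rfl | hf
  · simp [coordN]
  · exact (coordN_pos b.Q b.Q_symm hr hr1 hQ n f hf).le

/-- The form `⟨·,·⟩_T` is an inner product: `P^(n)` is strictly positive. -/
noncomputable abbrev coreT : InnerProductSpace.Core ℂ b.Tens where
  inner x y := b.innerT x y
  conj_inner_symm x y := by
    obtain ⟨M, hM⟩ := b.exists_coord_eq_zero x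
    obtain ⟨M', hM'⟩ := b.exists_coord_eq_zero y
    rw [b.innerT_eq x y (max M M') fun n hn => hM n ((le_max_left _ _).trans hn),
      b.innerT_eq y x (max M M') fun n hn => hM' n ((le_max_right _ _).trans hn), map_sum]
    refine sum_congr rfl fun n _ => ?_
    rw [coordP_symm _ b.Q_symm, map_sum]
    refine sum_congr rfl fun w _ => ?_
    simp [mul_comm]
  re_inner_nonneg x := by
    obtain ⟨M, hM⟩ := b.exists_coord_eq_zero x
    rw [b.innerT_eq x x M hM, map_sum]
    exact sum_nonneg fun n _ => b.coordN_nonneg n _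
  add_left x y z := by
    obtain ⟨M, hM⟩ := b.exists_coord_eq_zero x
    obtain ⟨M', hM'⟩ := b.exists_coord_eq_zero y
    have h1 : ∀ n, max M M' ≤ n → b.coord n x = 0 := fun n hn => hM n ((le_max_left _ _).trans hn)
    have h2 : ∀ n, max M M' ≤ n → b.coord n y = 0 := fun n hn => hM' n ((le_max_right _ _).trans hn)
    rw [b.innerT_eq x z _ h1, b.innerT_eq y z _ h2, b.innerT_eq (x + y) z (max M M') fun n hn => by
      rw [map_add, h1 n hn, h2 n hn, add_zero]]
    simp [add_mul, sum_add_distrib]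
  smul_left x y c := by
    obtain ⟨M, hM⟩ := b.exists_coord_eq_zero x
    rw [b.innerT_eq x y M hM, b.innerT_eq (c • x) y M fun n hn => by
      rw [map_smul, hM n hn, smul_zero]]
    simp [mul_sum, mul_assoc]
  definite x h := by
    obtain ⟨M, hM⟩ := b.exists_coord_eq_zero x
    obtain ⟨r, hr, hr1, hQ⟩ := b.exists_Q_le
    have h0 := congrArg Complex.re h
    rw [b.innerT_eq x x M hM, Complex.re_sum, Complex.zero_re] at h0
    have h1 := (sum_eq_zero_iff_of_nonneg (fun n _ => b.coordN_nonneg n (b.coord n x))).1 h0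
    apply b.wordBasis.repr.injective
    ext ⟨n, w⟩
    rw [map_zero, Finsupp.zero_apply, ← coord_apply]
    rcases Nat.lt_or_ge n M with hn | hn
    · by_contra hne
      have hne' : b.coord n x ≠ 0 := fun h => hne (by rw [h]; rfl)
      exact (coordN_pos b.Q b.Q_symm hr hr1 hQ n _ hne').ne' (h1 n (mem_range.2 hn))
    · rw [hM n hn]; rfl

/-- The creation operator `a*(ξ) x = ξ ⊗ x`. -/
noncomputable def creation (ξ : Complexification H) : Module.End ℂ b.Tens :=
  LinearMap.mulLeft ℂ (TensorAlgebra.ι ℂ ξ)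

/-- The free annihilation operator: `l(ξ) Ω = 0`, `l(ξ) (ξ_1 ⊗ ⋯ ⊗ ξ_n) = ⟨ξ, ξ_1⟩_U ξ_2 ⊗ ⋯ ⊗ ξ_n`. -/
noncomputable def freeAnnihilation (ξ : Complexification H) : Module.End ℂ b.Tens :=
  b.wordBasis.constr ℂ fun p => match p with
    | ⟨0, _⟩ => 0
    | ⟨_ + 1, w⟩ => S.innerU ξ (b.vec (w 0)) • b.tens (Fin.tail w)

/-- `1 + T_1 + T_1 T_2 + ⋯ + T_1 ⋯ T_{n-1}` on tensors of length `n` (counting positions from `1`). -/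
noncomputable def opR : Module.End ℂ b.Tens :=
  b.wordBasis.constr ℂ fun p => ∑ k ∈ range p.1, prodT b.opT k (b.tens p.2)

/-- The annihilation operator `a(ξ) = l(ξ) (1 + T_1 + T_1 T_2 + ⋯ + T_1 ⋯ T_{n-1})`. -/
noncomputable def annihilation (ξ : Complexification H) : Module.End ℂ b.Tens :=
  b.freeAnnihilation ξ * b.opR

theorem opR_tens (n : ℕ) (w : Fin n → Fin d) :
    b.opR (b.tens w) = ∑ k ∈ range n, prodT b.opT k (b.tens w) := by
  rw [← wordBasis_apply, opR, Module.Basis.constr_basis]; simp only [wordBasis_apply]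

theorem freeAnnihilation_zero (ξ : Complexification H) (w : Fin 0 → Fin d) :
    b.freeAnnihilation ξ (b.tens w) = 0 := by
  rw [← wordBasis_apply, freeAnnihilation, Module.Basis.constr_basis]

theorem freeAnnihilation_succ (ξ : Complexification H) {n : ℕ} (w : Fin (n + 1) → Fin d) :
    b.freeAnnihilation ξ (b.tens w) = S.innerU ξ (b.vec (w 0)) • b.tens (Fin.tail w) := by
  rw [← wordBasis_apply, freeAnnihilation, Module.Basis.constr_basis]

theorem creation_tens {n : ℕ} (k : Fin d) (w : Fin n → Fin d) :
    b.creation (b.vec k) (b.tens w) = b.tens (Fin.cons k w : Fin (n + 1) → Fin d) := by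
  simp [creation, tens, TensorAlgebra.tprod_apply, List.ofFn_succ]

theorem coord_prodT_opT (n k : ℕ) (x : b.Tens) :
    b.coord n (prodT b.opT k x) = prodT (coordT b.Q n) k (b.coord n x) := by
  induction k generalizing x with
  | zero => rfl
  | succ k ih => rw [prodT, prodT, Module.End.mul_apply, Module.End.mul_apply, ih, coord_opT]

theorem coord_opR (n : ℕ) (x : b.Tens) :
    b.coord n (b.opR x) = sumT (coordT b.Q n) n (b.coord n x) := by
  have : b.coord n ∘ₗ b.opR = sumT (coordT b.Q n) n ∘ₗ b.coord n := by
    refine b.wordBasis.ext fun ⟨m, w⟩ => ?_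
    simp only [LinearMap.comp_apply, wordBasis_apply, opR_tens, map_sum, coord_prodT_opT]
    rcases eq_or_ne m n with rfl | hmn
    · rw [sumT, LinearMap.sum_apply]
    · simp [coord_tens_ne _ _ _ hmn]
  exact LinearMap.congr_fun this x

theorem coord_freeAnnihilation (k : Fin d) (n : ℕ) (x : b.Tens) (w : Fin n → Fin d) :
    b.coord n (b.freeAnnihilation (b.vec k) x) w = b.coord (n + 1) x (Fin.cons k w) := by
  have : (LinearMap.proj w) ∘ₗ b.coord n ∘ₗ b.freeAnnihilation (b.vec k) =
      (LinearMap.proj (Fin.cons k w : Fin (n + 1) → Fin d)) ∘ₗ b.coord (n + 1) := by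
    refine b.wordBasis.ext fun ⟨m, w'⟩ => ?_
    simp only [LinearMap.comp_apply, wordBasis_apply, LinearMap.proj_apply]
    cases m with
    | zero => rw [freeAnnihilation_zero, coord_tens_ne _ _ _ (by omega)]; simp
    | succ m =>
      rw [freeAnnihilation_succ, b.orthonormal, map_smul, Pi.smul_apply]
      rcases eq_or_ne m n with rfl | hmn
      · rw [coord_tens, coord_tens]
        have e : w' = Fin.cons k w ↔ k = w' 0 ∧ Fin.tail w' = w := by
          conv_lhs => rw [← Fin.cons_self_tail w', Fin.cons_inj]
          rw [eq_comm (a := k)]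
        by_cases h : w' = Fin.cons k w
        · rw [if_pos (e.1 h).1, if_pos (e.1 h).2, if_pos h]; simp
        · rw [if_neg h]
          split_ifs with h1 h2
          · exact absurd (e.2 ⟨h1, h2⟩) h
          all_goals simp
      · rw [coord_tens_ne _ _ _ hmn, coord_tens_ne _ _ _ (by omega)]; simp
  exact LinearMap.congr_fun this x

theorem coord_creation_zero (k : Fin d) (x : b.Tens) : b.coord 0 (b.creation (b.vec k) x) = 0 := by
  have : b.coord 0 ∘ₗ b.creation (b.vec k) = 0 := by
    refine b.wordBasis.ext fun ⟨m, w'⟩ => ?_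
    simp only [LinearMap.comp_apply, wordBasis_apply, creation_tens]
    rw [coord_tens_ne _ _ _ (by omega)]; simp
  exact LinearMap.congr_fun this x

theorem coord_creation_succ (k : Fin d) (n : ℕ) (x : b.Tens) (l : Fin d) (w : Fin n → Fin d) :
    b.coord (n + 1) (b.creation (b.vec k) x) (Fin.cons l w) =
      if k = l then b.coord n x w else 0 := by
  have : (LinearMap.proj (Fin.cons l w : Fin (n + 1) → Fin d)) ∘ₗ b.coord (n + 1) ∘ₗ
      b.creation (b.vec k) = (if k = l then (1 : ℂ) else 0) • (LinearMap.proj w ∘ₗ b.coord n) := by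
    refine b.wordBasis.ext fun ⟨m, w'⟩ => ?_
    simp only [LinearMap.comp_apply, wordBasis_apply, creation_tens, LinearMap.proj_apply,
      LinearMap.smul_apply]
    rcases eq_or_ne m n with rfl | hmn
    · rw [coord_tens, coord_tens]
      by_cases h1 : k = l <;> by_cases h2 : w' = w <;> simp [Fin.cons_inj, h1, h2]
    · rw [coord_tens_ne _ _ _ hmn, coord_tens_ne _ _ _ (by omega)]; simp
  have h := LinearMap.congr_fun this x
  simp only [LinearMap.comp_apply, LinearMap.proj_apply, LinearMap.smul_apply] at h
  rw [h]; split_ifs <;> simp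

theorem innerT_creation (k : Fin d) (x y : b.Tens) :
    b.innerT (b.creation (b.vec k) x) y = b.innerT x (b.annihilation (b.vec k) y) := by
  obtain ⟨M, hM⟩ := b.exists_coord_eq_zero x
  rw [b.innerT_eq x _ M hM, b.innerT_eq (b.creation (b.vec k) x) y (M + 1) ?_, sum_range_succ']
  · rw [coord_creation_zero]
    simp only [Pi.zero_apply, star_zero, zero_mul, sum_const_zero, add_zero]
    refine sum_congr rfl fun n _ => ?_
    rw [← (Fin.consEquiv fun _ => Fin d).sum_comp, Fintype.sum_prod_type, sum_eq_single k]
    · refine sum_congr rfl fun w _ => ?_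
      have e : (Fin.consEquiv fun _ => Fin d) (k, w) = (Fin.cons k w : Fin (n + 1) → Fin d) := rfl
      rw [e, coord_creation_succ, if_pos rfl, coordP_succ _ b.Q_symm, Fin.cons_zero, Fin.tail_cons]
      rw [annihilation, Module.End.mul_apply]
      refine congrArg _ (congrFun (congrArg _ (funext fun w' => ?_)) w)
      rw [coord_freeAnnihilation, coord_opR]
    · intro l _ hl
      refine sum_eq_zero fun w _ => ?_
      have e : (Fin.consEquiv fun _ => Fin d) (l, w) = (Fin.cons l w : Fin (n + 1) → Fin d) := rfl
      rw [e, coord_creation_succ, if_neg hl.symm]; simp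
    · simp
  · intro n hn
    obtain ⟨n, rfl⟩ : ∃ m, n = m + 1 := ⟨n - 1, by omega⟩
    ext w
    rw [← Fin.cons_self_tail w, coord_creation_succ, hM n (by omega)]; simp

theorem opT_creation (k : ℕ) (l : Fin d) (x : b.Tens) :
    b.opT (k + 1) (b.creation (b.vec l) x) = b.creation (b.vec l) (b.opT k x) := by
  have : b.opT (k + 1) ∘ₗ b.creation (b.vec l) = b.creation (b.vec l) ∘ₗ b.opT k := by
    refine b.wordBasis.ext fun ⟨n, w⟩ => ?_
    simp only [LinearMap.comp_apply, wordBasis_apply, creation_tens, opT_tens]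
    by_cases h : k + 1 < n
    · rw [dif_pos h, dif_pos (by omega), map_smul, creation_tens]
      have e1 : (⟨k + 1, by omega⟩ : Fin (n + 1)) = Fin.succ ⟨k, by omega⟩ := rfl
      have e2 : (⟨k + 1 + 1, by omega⟩ : Fin (n + 1)) = Fin.succ ⟨k + 1, h⟩ := rfl
      rw [e1, e2, Fin.cons_succ, Fin.cons_succ]
      congr 2
      ext x
      refine Fin.cases ?_ (fun i => ?_) x
      · rw [Function.comp_apply, swap_apply_of_ne_of_ne (Fin.succ_ne_zero _).symm
          (Fin.succ_ne_zero _).symm]; simp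
      · rw [Function.comp_apply, (Fin.succ_injective n).swap_apply]; simp
    · rw [dif_neg h, dif_neg (by omega), map_zero]
  exact LinearMap.congr_fun this x

theorem prodT_creation (k : ℕ) (l : Fin d) (x : b.Tens) :
    prodT b.opT (k + 1) (b.creation (b.vec l) x) =
      b.opT 0 (b.creation (b.vec l) (prodT b.opT k x)) := by
  induction k generalizing x with
  | zero => simp [prodT]
  | succ k ih =>
    rw [prodT, Module.End.mul_apply, opT_creation, ih, prodT, Module.End.mul_apply]

theorem freeAnnihilation_opT_creation (k l : Fin d) (x : b.Tens) :
    b.freeAnnihilation (b.vec k) (b.opT 0 (b.creation (b.vec l) x)) =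
      (b.Q k l : ℂ) • b.creation (b.vec l) (b.freeAnnihilation (b.vec k) x) := by
  have : b.freeAnnihilation (b.vec k) ∘ₗ b.opT 0 ∘ₗ b.creation (b.vec l) =
      (b.Q k l : ℂ) • (b.creation (b.vec l) ∘ₗ b.freeAnnihilation (b.vec k)) := by
    refine b.wordBasis.ext fun ⟨n, w⟩ => ?_
    simp only [LinearMap.comp_apply, wordBasis_apply, creation_tens, opT_tens, LinearMap.smul_apply]
    cases n with
    | zero => rw [freeAnnihilation_zero, dif_neg (by omega)]; simp
    | succ n =>
      rw [dif_pos (by omega), map_smul, freeAnnihilation_succ, freeAnnihilation_succ, map_smul,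
        creation_tens]
      have e0 : (⟨0, by omega⟩ : Fin (n + 1 + 1)) = 0 := rfl
      have e1 : (⟨0 + 1, by omega⟩ : Fin (n + 1 + 1)) = Fin.succ 0 := rfl
      rw [e0, e1, Function.comp_apply, swap_apply_left, Fin.cons_zero, Fin.cons_succ, b.orthonormal]
      have e2 : Fin.tail ((Fin.cons l w : Fin (n + 1 + 1) → Fin d) ∘ swap 0 (Fin.succ 0)) =
          (Fin.cons l (Fin.tail w) : Fin (n + 1) → Fin d) := by
        ext x
        refine Fin.cases ?_ (fun i => ?_) x
        · simp [Fin.tail]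
        · rw [Fin.tail, Function.comp_apply, swap_apply_of_ne_of_ne (Fin.succ_ne_zero _) (by
            exact fun h => Fin.succ_ne_zero _ (Fin.succ_injective _ h))]
          simp [Fin.tail]
      rw [e2]
      by_cases h : k = w 0
      · subst h; simp [b.Q_symm l]
      · simp [h]
  exact LinearMap.congr_fun this x

theorem annihilation_creation (k l : Fin d) (x : b.Tens) :
    b.annihilation (b.vec k) (b.creation (b.vec l) x) = (if k = l then (1 : ℂ) else 0) • x +
      (b.Q k l : ℂ) • b.creation (b.vec l) (b.annihilation (b.vec k) x) := by
  have : b.annihilation (b.vec k) ∘ₗ b.creation (b.vec l) =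
      (if k = l then (1 : ℂ) else 0) • LinearMap.id +
      (b.Q k l : ℂ) • (b.creation (b.vec l) ∘ₗ b.annihilation (b.vec k)) := by
    refine b.wordBasis.ext fun ⟨n, w⟩ => ?_
    simp only [LinearMap.comp_apply, wordBasis_apply, LinearMap.smul_apply, LinearMap.add_apply,
      LinearMap.id_apply, annihilation, Module.End.mul_apply]
    rw [← freeAnnihilation_opT_creation, opR_tens, map_sum, map_sum (b.opT 0)]
    simp only [← prodT_creation]
    rw [← b.orthonormal]
    have e : S.innerU (b.vec k) (b.vec l) • b.tens w =
        b.freeAnnihilation (b.vec k) (b.creation (b.vec l) (b.tens w)) := by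
      rw [creation_tens, freeAnnihilation_succ]; simp
    rw [e, ← map_add]
    refine congrArg _ ?_
    rw [creation_tens, opR_tens, sum_range_succ', add_comm]
    simp [prodT]
  exact LinearMap.congr_fun this x

theorem annihilation_pow_tens (k : Fin d) (n : ℕ) (w : Fin n → Fin d) :
    (b.annihilation (b.vec k) ^ (n + 1)) (b.tens w) = 0 := by
  have hT : ∀ (n j : ℕ) (w : Fin n → Fin d), ∃ (c : ℂ) (w' : Fin n → Fin d),
      prodT b.opT j (b.tens w) = c • b.tens w' := by
    intro n j
    induction j with
    | zero => exact fun w => ⟨1, w, by simp [prodT]⟩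
    | succ j ih =>
      intro w
      rw [prodT, Module.End.mul_apply, opT_tens]
      split_ifs with h
      · obtain ⟨c, w', h'⟩ := ih (w ∘ swap ⟨j, by omega⟩ ⟨j + 1, h⟩)
        exact ⟨_, w', by rw [map_smul, h', smul_smul]⟩
      · exact ⟨0, w, by simp⟩
  induction n with
  | zero =>
    simp [annihilation, opR_tens]
  | succ n ih =>
    rw [pow_succ, Module.End.mul_apply, annihilation, Module.End.mul_apply, opR_tens, ← annihilation,
      map_sum, map_sum]
    refine sum_eq_zero fun j _ => ?_
    obtain ⟨c, w', h'⟩ := hT (n + 1) j w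
    rw [h', map_smul, freeAnnihilation_succ, map_smul, map_smul, ih, smul_zero, smul_zero]

theorem annihilation_nilpotent (k : Fin d) (x : b.Tens) :
    ∃ n, (b.annihilation (b.vec k) ^ n) x = 0 := by
  have hx := b.wordBasis.mem_span x
  induction hx using Submodule.span_induction with
  | mem x h =>
    obtain ⟨⟨n, w⟩, rfl⟩ := h
    exact ⟨n + 1, by rw [wordBasis_apply, annihilation_pow_tens]⟩
  | zero => exact ⟨0, map_zero _⟩
  | add x y _ _ hx hy =>
    obtain ⟨n, hn⟩ := hx
    obtain ⟨m, hm⟩ := hy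
    refine ⟨n + m, ?_⟩
    rw [map_add, pow_add, Module.End.mul_apply, Module.End.mul_apply, hm, map_zero, add_zero,
      ← Module.End.mul_apply, ← pow_add, add_comm, pow_add, Module.End.mul_apply, hn, map_zero]
  | smul c x _ hx =>
    obtain ⟨n, hn⟩ := hx
    exact ⟨n, by rw [map_smul, hn, smul_zero]⟩

/-! ### The Fock space and its bounded operators -/

/-- The algebraic Fock space with the inner product `⟨·,·⟩_T`. -/
def PreFock (b : HomogeneousBasis S d) : Type _ := b.Tens

noncomputable instance : NormedAddCommGroup b.PreFock :=
  @InnerProductSpace.Core.toNormedAddCommGroup ℂ b.Tens _ _ _ b.coreT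

noncomputable instance : InnerProductSpace ℂ b.PreFock :=
  @InnerProductSpace.ofCore ℂ b.Tens _ _ _
    (@InnerProductSpace.Core.toCore ℂ b.Tens _ _ _ b.coreT)

noncomputable instance : Inner ℂ b.PreFock := InnerProductSpace.toInner

/-- The identity map. -/
noncomputable def toPre : b.Tens ≃ₗ[ℂ] b.PreFock where
  toFun x := x
  invFun x := x
  map_add' _ _ := rfl
  map_smul' _ _ := rfl
  left_inv _ := rfl
  right_inv _ := rfl

theorem inner_toPre (x y : b.Tens) : inner ℂ (b.toPre x) (b.toPre y) = b.innerT x y := rfl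

theorem norm_sq_toPre (x : b.Tens) : ‖b.toPre x‖ ^ 2 = (b.innerT x x).re := by
  rw [← inner_self_eq_norm_sq (𝕜 := ℂ), inner_toPre]; rfl

theorem norm_creation_aux (k : Fin d) (n : ℕ) (x : b.Tens)
    (hx : (b.annihilation (b.vec k) ^ n) x = 0) :
    ‖b.toPre (b.creation (b.vec k) x)‖ ^ 2 ≤ (1 - |b.Q k k|)⁻¹ * ‖b.toPre x‖ ^ 2 := by
  have hQ : |b.Q k k| < 1 := S.q_lt_one _ _
  have hpos : 0 < 1 - |b.Q k k| := by linarith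
  set C := (1 - |b.Q k k|)⁻¹ with hC
  have hC0 : 0 < C := inv_pos.2 hpos
  have hC1 : 1 + |b.Q k k| * C = C := by rw [hC]; field_simp; ring
  induction n generalizing x with
  | zero =>
    rw [pow_zero, Module.End.one_apply] at hx
    simp [hx]
  | succ n ih =>
    set y := b.annihilation (b.vec k) x with hy
    have h1 := ih y (by rw [hy, ← Module.End.mul_apply, ← pow_succ, hx])
    have h2 : ‖b.toPre (b.creation (b.vec k) x)‖ ^ 2 =
        ‖b.toPre x‖ ^ 2 + b.Q k k * ‖b.toPre y‖ ^ 2 := by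
      rw [norm_sq_toPre, innerT_creation, annihilation_creation, if_pos rfl, one_smul, ← hy,
        ← inner_toPre, map_add, inner_add_right, map_smul, inner_smul_right, ← inner_conj_symm,
        ← inner_conj_symm (b.toPre x) (b.toPre (b.creation (b.vec k) y)), inner_toPre, inner_toPre,
        innerT_creation, ← hy, Complex.add_re, Complex.re_ofReal_mul, Complex.conj_re,
        Complex.conj_re, ← norm_sq_toPre, ← norm_sq_toPre]
    have h3 : ‖b.toPre y‖ ^ 2 ≤ ‖b.toPre (b.creation (b.vec k) y)‖ * ‖b.toPre x‖ := by
      rw [norm_sq_toPre]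
      nth_rewrite 2 [hy]
      rw [← innerT_creation, ← inner_toPre]
      exact (Complex.re_le_norm _).trans (norm_inner_le_norm _ _)
    have h4 : ‖b.toPre y‖ ^ 2 ≤ C * ‖b.toPre x‖ ^ 2 := by
      rcases eq_or_lt_of_le (sq_nonneg ‖b.toPre y‖) with h | h
      · rw [← h]; positivity
      · have h5 : (‖b.toPre y‖ ^ 2) ^ 2 ≤
            (C * ‖b.toPre y‖ ^ 2) * ‖b.toPre x‖ ^ 2 := by
          calc (‖b.toPre y‖ ^ 2) ^ 2 ≤
              (‖b.toPre (b.creation (b.vec k) y)‖ * ‖b.toPre x‖) ^ 2 := by gcongr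
            _ = ‖b.toPre (b.creation (b.vec k) y)‖ ^ 2 * ‖b.toPre x‖ ^ 2 := by ring
            _ ≤ _ := by gcongr
        nlinarith
    rw [h2]
    calc ‖b.toPre x‖ ^ 2 + b.Q k k * ‖b.toPre y‖ ^ 2
        ≤ ‖b.toPre x‖ ^ 2 + |b.Q k k| * (C * ‖b.toPre x‖ ^ 2) := by
          gcongr
          exact le_abs_self _
      _ = (1 + |b.Q k k| * C) * ‖b.toPre x‖ ^ 2 := by ring
      _ = _ := by rw [hC1]

/-- `T` extends to a bounded operator. -/
def IsBdd (T : Module.End ℂ b.Tens) : Prop := ∃ C, ∀ x, ‖b.toPre (T x)‖ ≤ C * ‖b.toPre x‖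

variable {b} in
theorem IsBdd.add {T T' : Module.End ℂ b.Tens} (h : b.IsBdd T) (h' : b.IsBdd T') :
    b.IsBdd (T + T') := by
  obtain ⟨C, hC⟩ := h
  obtain ⟨C', hC'⟩ := h'
  refine ⟨C + C', fun x => ?_⟩
  rw [LinearMap.add_apply, map_add, add_mul]
  exact (norm_add_le _ _).trans (add_le_add (hC x) (hC' x))

variable {b} in
theorem IsBdd.smul {T : Module.End ℂ b.Tens} (c : ℂ) (h : b.IsBdd T) : b.IsBdd (c • T) := by
  obtain ⟨C, hC⟩ := h
  refine ⟨‖c‖ * C, fun x => ?_⟩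
  rw [LinearMap.smul_apply, map_smul, norm_smul, mul_assoc]
  gcongr
  exact hC x

theorem isBdd_sum {ι : Type*} (s : Finset ι) (T : ι → Module.End ℂ b.Tens)
    (h : ∀ i, b.IsBdd (T i)) : b.IsBdd (∑ i ∈ s, T i) := by
  induction s using Finset.cons_induction with
  | empty => exact ⟨0, fun x => by simp⟩
  | cons i s hi ih => rw [sum_cons]; exact (h i).add ih

theorem isBdd_creation_vec (k : Fin d) : b.IsBdd (b.creation (b.vec k)) := by
  refine ⟨√(1 - |b.Q k k|)⁻¹, fun x => ?_⟩
  obtain ⟨n, hn⟩ := b.annihilation_nilpotent k x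
  have := Real.sqrt_le_sqrt (b.norm_creation_aux k n x hn)
  rwa [Real.sqrt_mul' _ (sq_nonneg _), Real.sqrt_sq (norm_nonneg _),
    Real.sqrt_sq (norm_nonneg _)] at this

theorem isBdd_annihilation_vec (k : Fin d) : b.IsBdd (b.annihilation (b.vec k)) := by
  obtain ⟨C, hC⟩ := b.isBdd_creation_vec k
  refine ⟨C, fun x => ?_⟩
  set y := b.annihilation (b.vec k) x with hy
  have h3 : ‖b.toPre y‖ ^ 2 ≤ C * ‖b.toPre y‖ * ‖b.toPre x‖ := by
    rw [norm_sq_toPre]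
    nth_rewrite 2 [hy]
    rw [← innerT_creation, ← inner_toPre]
    refine (Complex.re_le_norm _).trans ((norm_inner_le_norm _ _).trans ?_)
    gcongr
    exact hC y
  rcases eq_or_lt_of_le (norm_nonneg (b.toPre y)) with h | h
  · have h0 : b.toPre y = 0 := norm_eq_zero.1 h.symm
    rcases eq_or_ne (b.toPre x) 0 with hx | hx
    · rw [h0, hx]; simp
    · have hc := hC x
      have : 0 ≤ C * ‖b.toPre x‖ := (norm_nonneg _).trans hc
      rw [h0, norm_zero]; exact this
  · nlinarith

theorem isBdd_creation (ξ : Complexification H) : b.IsBdd (b.creation ξ) := by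
  have : b.creation ξ = ∑ k, b.vec.repr ξ k • b.creation (b.vec k) := by
    refine LinearMap.ext fun x => ?_
    have e : TensorAlgebra.ι ℂ ξ = ∑ k, b.vec.repr ξ k • TensorAlgebra.ι ℂ (b.vec k) := by
      conv_lhs => rw [← b.vec.sum_repr ξ]
      rw [map_sum]
      simp only [map_smul]
    simp [creation, LinearMap.sum_apply, e, Finset.sum_mul]
  rw [this]
  exact b.isBdd_sum _ _ fun k => (b.isBdd_creation_vec k).smul _

theorem isBdd_annihilation (ξ : Complexification H) : b.IsBdd (b.annihilation ξ) := by
  have h : b.freeAnnihilation ξ =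
      ∑ k, S.innerU ξ (b.vec k) • b.freeAnnihilation (b.vec k) := by
    refine b.wordBasis.ext fun ⟨n, w⟩ => ?_
    rw [wordBasis_apply, LinearMap.sum_apply]
    cases n with
    | zero => simp [freeAnnihilation_zero]
    | succ n => simp [freeAnnihilation_succ, b.orthonormal]
  have : b.annihilation ξ = ∑ k, S.innerU ξ (b.vec k) • b.annihilation (b.vec k) := by
    simp only [annihilation]
    rw [h, sum_mul]
    simp
  rw [this]
  exact b.isBdd_sum _ _ fun k => (b.isBdd_annihilation_vec k).smul _

/-- The `T`-deformed Fock space, the completion of the algebraic Fock space for `⟨·,·⟩_T`. -/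
abbrev Fock (b : HomogeneousBasis S d) : Type _ := UniformSpace.Completion b.PreFock

noncomputable instance : Inner ℂ b.Fock := InnerProductSpace.toInner

/-- The inclusion of the algebraic Fock space in the Fock space. -/
noncomputable def emb : b.Tens →ₗ[ℂ] b.Fock :=
  (UniformSpace.Completion.toComplₗᵢ (𝕜 := ℂ) (E := b.PreFock)).toLinearMap ∘ₗ b.toPre.toLinearMap

theorem emb_injective : Function.Injective b.emb :=
  (UniformSpace.Completion.toComplₗᵢ (𝕜 := ℂ) (E := b.PreFock)).injective.comp b.toPre.injective

/-- The bounded extension to the Fock space of an operator that is bounded on the algebraic Fock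
space. -/
noncomputable def extendBdd (T : Module.End ℂ b.Tens) (h : b.IsBdd T) : b.Fock →L[ℂ] b.Fock :=
  ContinuousLinearMap.completion
    (LinearMap.mkContinuousOfExistsBound
      (b.toPre.toLinearMap ∘ₗ T ∘ₗ b.toPre.symm.toLinearMap : b.PreFock →ₗ[ℂ] b.PreFock) h)

theorem extendBdd_emb (T : Module.End ℂ b.Tens) (h : b.IsBdd T) (x : b.Tens) :
    b.extendBdd T h (b.emb x) = b.emb (T x) := by
  simp only [extendBdd, emb, LinearMap.comp_apply, LinearEquiv.coe_coe,
    LinearIsometry.coe_toLinearMap, UniformSpace.Completion.coe_toComplₗᵢ]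
  exact UniformSpace.Completion.map_coe (ContinuousLinearMap.uniformContinuous _) _

end HomogeneousBasis

/-! ### Dual systems -/

namespace HomogeneousBasis
variable {H N : Type*} [NormedAddCommGroup H] [InnerProductSpace ℝ H] {S : MixedQData H N} {d : ℕ}
  (b : HomogeneousBasis S d)

/-- The algebraic Fock space inside the Fock space: the span of the finite simple tensors. -/
noncomputable def fockAlg : Submodule ℂ b.Fock := LinearMap.range b.emb

/-- The vacuum vector `Ω`. -/
noncomputable def vacuum : b.Fock := b.emb 1

/-- The operator `W(ξ) = a*(ξ) + a(ξ̄)` for `ξ ∈ H_ℂ`, as a bounded operator on the Fock space. For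
`ξ = x + i y` it is `s(x) + i s(y)`, where `s(x) = a*(x) + a(x)`, and `W(ξ) Ω = ξ`. -/
noncomputable def wick (ξ : Complexification H) : b.Fock →L[ℂ] b.Fock :=
  b.extendBdd (b.creation ξ + b.annihilation ξ.conj)
    ((b.isBdd_creation ξ).add (b.isBdd_annihilation ξ.conj))

theorem wick_emb (ξ : Complexification H) (x : b.Tens) :
    b.wick ξ (b.emb x) = b.emb (b.creation ξ x + b.annihilation ξ.conj x) :=
  b.extendBdd_emb _ _ _

/-- The generators `A_k = W(e_k)`. -/
noncomputable def gen (k : Fin d) : b.Fock →L[ℂ] b.Fock := b.wick (b.vec k)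

/-- The unbounded operators `D_1, …, D_d` on the Fock space form a normalized dual system for
`(A_1, …, A_d)`: their domains contain the algebraic Fock space, `Ω` lies in the domains of their
adjoints (`x ↦ ⟨Ω, D_k x⟩` is continuous on the domain of `D_k`), `D_k Ω = 0`, and on the algebraic
Fock space `[D_k, A_l] = ⟨ē_l, e_k⟩_U P_{ℂΩ} = φ(A_l A_k) P_{ℂΩ}`, where `φ = ⟨Ω, · Ω⟩` and `P_{ℂΩ}`
is the orthogonal projection onto `ℂΩ`. -/
structure IsNormalizedDualSystem (D : Fin d → b.Fock →ₗ.[ℂ] b.Fock) : Prop where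
  fockAlg_le_domain : ∀ k, b.fockAlg ≤ (D k).domain
  vacuum_mem_adjointDomain : ∀ k, b.vacuum ∈ (D k).adjointDomain
  commutator : ∀ k l, ∀ x ∈ b.fockAlg,
    ∃ (hx : x ∈ (D k).domain) (hAx : b.gen l x ∈ (D k).domain),
      D k ⟨b.gen l x, hAx⟩ - b.gen l (D k ⟨x, hx⟩) =
        S.innerU (b.vec l).conj (b.vec k) • (ℂ ∙ b.vacuum).starProjection x
  innerU_eq_vacuum_state : ∀ k l,
    S.innerU (b.vec l).conj (b.vec k) = inner ℂ b.vacuum (b.gen l (b.gen k b.vacuum))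
  map_vacuum : ∀ k, ∃ h : b.vacuum ∈ (D k).domain, D k ⟨b.vacuum, h⟩ = 0

end HomogeneousBasis

/-! ### Singleton/pair partitions and their weights -/

/-- The set `B(n+1)` of partitions of `{0, …, n}` into singletons and pairs such that, with `k` the
partner of `0`, each `l ∈ {1, …, k-1}` is paired with an element of `{k+1, …, n}`, and the other
vertices are singletons. A partition into singletons and pairs is encoded as the involution `π` that
exchanges the two elements of each pair and fixes the singletons; thus `k = π 0`. -/
def dualPartitions (n : ℕ) : Finset (Perm (Fin (n + 1))) :=
  univ.filter fun π => (∀ k, π (π k) = k) ∧ π 0 ≠ 0 ∧ (∀ l, 0 < l → l < π 0 → π 0 < π l) ∧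
    ∀ m, π 0 < m → π m ≠ m → π m < π 0

namespace HomogeneousBasis
variable {H N : Type*} [NormedAddCommGroup H] [InnerProductSpace ℝ H] {S : MixedQData H N} {d : ℕ}
  (b : HomogeneousBasis S d)

/-- The weight `Q(π)`, the product of
`∏_{0 ≤ v < u < π(0)} q(i_v, i_u)`, `∏_{0 < v < u < π(0), π(v) > π(u)} q(i_{π(v)}, i_{π(u)})` and
`∏_{π(0) < v < u ≤ n, v ∈ s(π), u ∉ s(π)} q(i_v, i_u)`. Here `c k` is the letter at the vertex `k`. -/
def crossingWeight {n : ℕ} (π : Perm (Fin (n + 1))) (c : Fin (n + 1) → Fin d) : ℝ :=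
  (∏ u, ∏ v, if v < u ∧ u < π 0 then b.Q (c v) (c u) else 1) *
  (∏ u, ∏ v, if 0 < v ∧ v < u ∧ u < π 0 ∧ π u < π v then b.Q (c (π v)) (c (π u)) else 1) *
  ∏ u, ∏ v, if π 0 < v ∧ v < u ∧ π v = v ∧ π u ≠ u then b.Q (c v) (c u) else 1

/-- The weight `E(π) = ∏ ⟨ē_{α_k}, e_{α_l}⟩_U` over the pairs `{k, l}` of `π` with `k > l`. -/
noncomputable def pairWeight {n : ℕ} (π : Perm (Fin (n + 1))) (c : Fin (n + 1) → Fin d) : ℂ :=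
  ∏ k, if π k < k then S.innerU (b.vec (c k)).conj (b.vec (c (π k))) else 1

/-- The simple tensor `e_{s(π)}` of the letters at the singletons of `π`, in decreasing order of the
vertices. -/
noncomputable def singletonTensor {n : ℕ} (π : Perm (Fin (n + 1))) (c : Fin (n + 1) → Fin d) :
    b.Tens :=
  (((List.finRange (n + 1)).reverse.filter fun k => π k = k).map
    fun k => TensorAlgebra.ι ℂ (b.vec (c k))).prod

end HomogeneousBasis

end MixedQ

/-!
The operators `D_α` are defined on words by the partition formula. That they satisfy
`[D_α, A_l] = ⟨ē_l, e_α⟩ P_{ℂΩ}` is checked on words. Appending a letter `e_l` on the left of a word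
adds a new last vertex to the partitions. Those in which it is a singleton give `a*(e_l) D_α`.
In `D_α a(ē_l)` the letter `e_l` first absorbs a vertex `p` and a partition `σ` of the remaining
vertices is chosen afterwards. If `p` lies after `σ 0`, the same term occurs in `a(ē_l) D_α`, where
`p` is a singleton of the partition obtained from `σ` by inserting `p` (`dualCoeff_insFix`). If `p`
lies before `σ 0`, the term is, up to the sign, that of the partition in which `p` is paired with the
new vertex (`dualCoeff_insPair`). The weights agree because paired letters have the same colour
whenever the pairing does not vanish: `⟨·,·⟩_U` vanishes between distinct colours, as the generator
`A` commutes with the orthogonal projections onto the `H_ℂ^(i)`.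

That `Ω` lies in the domain of `D_α^*` means that `x ↦ ⟨Ω, D_α x⟩` is bounded. Only partitions
without singletons contribute to it on words of length `n`. For these `π 0 ≥ n / 2`, and the crossings
before `π 0` make the weight at most `r ^ (0 + 1 + ⋯ + (n / 2 - 1))` with `r < 1`, which beats the
number of partitions and every geometric sequence. The passage to the norm of `⟨·,·⟩_T` costs only a
geometric factor, since `‖(P^(n))⁻¹‖ ≤ C ^ n` in the supremum norm
(`exists_norm_le_pow_mul_norm_coordP`), by the factorization of `1 + T_1 + ⋯ + T_1 ⋯ T_m`.

Uniqueness holds because `e_l ⊗ x = A_l x - a(ē_l) x`, so that `D_α Ω = 0` and the commutators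
determine `D_α` on words by induction on the length.
-/

namespace MixedQ
open Equiv Finset Complexification

/-! ### Orthogonality of the colours for the deformed inner product -/

theorem commute_ringInverse {M : Type*} [MonoidWithZero M] {a c : M} (h : Commute a c) :
    Commute a (Ring.inverse c) := by
  by_cases hc : IsUnit c
  · obtain ⟨u, rfl⟩ := hc
    rw [Ring.inverse_unit]
    exact h.units_inv_right
  · rw [Ring.inverse_non_unit _ hc]
    exact Commute.zero_right _

namespace MixedQData
variable {H N : Type*} [NormedAddCommGroup H] [InnerProductSpace ℝ H] (S : MixedQData H N)

/-- The complexification `H_ℂ^(i)` of the summand `H^(i)`, as a subspace of `H_ℂ`. -/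
def compC (i : N) : Submodule ℂ (Complexification H) where
  carrier := {ξ | ξ.re ∈ S.comp i ∧ ξ.im ∈ S.comp i}
  add_mem' h h' := ⟨add_mem h.1 h'.1, add_mem h.2 h'.2⟩
  zero_mem' := ⟨zero_mem _, zero_mem _⟩
  smul_mem' _ _ h := ⟨sub_mem (Submodule.smul_mem _ _ h.1) (Submodule.smul_mem _ _ h.2),
    add_mem (Submodule.smul_mem _ _ h.2) (Submodule.smul_mem _ _ h.1)⟩

theorem conj_mem_compC {i : N} {ξ : Complexification H} (h : ξ ∈ S.compC i) :
    ξ.conj ∈ S.compC i :=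
  ⟨h.1, neg_mem h.2⟩

theorem inner_compC_eq_zero {i j : N} (hij : i ≠ j) {ξ ζ : Complexification H}
    (hξ : ξ ∈ S.compC i) (hζ : ζ ∈ S.compC j) : inner ℂ ξ ζ = 0 := by
  have h := fun x hx y hy => Submodule.isOrtho_iff_inner_eq.1 (S.comp_orthogonal i j hij) x hx y hy
  rw [inner_def, h _ hξ.1 _ hζ.1, h _ hξ.2 _ hζ.2, h _ hξ.1 _ hζ.2, h _ hξ.2 _ hζ.1]
  simp; rfl

theorem UC_mem_compC (t : ℝ) {i : N} {ξ : Complexification H} (h : ξ ∈ S.compC i) :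
    S.UC t ξ ∈ S.compC i :=
  ⟨S.U_mem t i _ h.1, S.U_mem t i _ h.2⟩

theorem UC_UC_neg (t : ℝ) (ξ : Complexification H) : S.UC t (S.UC (-t) ξ) = ξ := by
  have h0 : ∀ x, S.U 0 x = x := fun x => (S.U 0).injective (by rw [← S.U_add, add_zero])
  have h : ∀ x, S.U t (S.U (-t) x) = x := fun x => by rw [← S.U_add, add_neg_cancel, h0]
  exact Complexification.ext (h _) (h _)

theorem inner_UC (t : ℝ) (ξ ζ : Complexification H) :
    inner ℂ (S.UC t ξ) (S.UC t ζ) = inner ℂ ξ ζ :=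
  (extend (S.U t)).inner_map_map ξ ζ

/-- As `U_t` is unitary and preserves `H_ℂ^(i)`, it also preserves the orthogonal complement. -/
theorem commute_starProjection_UC (i : N) [(S.compC i).HasOrthogonalProjection] (t : ℝ) :
    Commute (S.compC i).starProjection (S.UC t) := by
  refine ContinuousLinearMap.ext fun ξ => ?_
  change (S.compC i).starProjection (S.UC t ξ) = S.UC t ((S.compC i).starProjection ξ)
  refine Submodule.eq_starProjection_of_mem_of_inner_eq_zero
    (S.UC_mem_compC t (Submodule.starProjection_apply_mem _ _)) fun w hw => ?_
  rw [← map_sub, ← S.UC_UC_neg t w, inner_UC]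
  exact Submodule.starProjection_inner_eq_zero _ _ (S.UC_mem_compC _ hw)

theorem commute_starProjection_generator (i : N) [(S.compC i).HasOrthogonalProjection] :
    Commute (S.compC i).starProjection S.generator := by
  refine Commute.exp_right (Commute.smul_right ?_ _)
  by_cases hd : DifferentiableAt ℝ S.UC 0
  · have h : (fun t => (S.compC i).starProjection * S.UC t) =
        fun t => S.UC t * (S.compC i).starProjection :=
      funext fun t => (S.commute_starProjection_UC i t).eq
    rw [Commute, SemiconjBy, ← deriv_const_mul _ hd, ← deriv_mul_const hd, h]
  · rw [deriv_zero_of_not_differentiableAt hd]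
    exact Commute.zero_right _

/-- The operator `2 (1 + A⁻¹)⁻¹` preserves each `H_ℂ^(j)`, so that distinct `H_ℂ^(i)` stay
orthogonal for the deformed inner product. -/
theorem innerU_eq_zero [FiniteDimensional ℂ (Complexification H)] {i j : N} (hij : i ≠ j)
    {ξ ζ : Complexification H} (hξ : ξ ∈ S.compC i) (hζ : ζ ∈ S.compC j) : S.innerU ξ ζ = 0 := by
  have hc : Commute (S.compC j).starProjection
      ((2 : ℂ) • Ring.inverse (1 + Ring.inverse S.generator)) :=
    (commute_ringInverse ((Commute.one_right _).add_right
      (commute_ringInverse (S.commute_starProjection_generator j)))).smul_right _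
  have h := congrArg (fun X : Complexification H →L[ℂ] Complexification H => X ζ) hc.eq
  simp only [mul_apply_eq_comp,
    (S.compC j).starProjection_eq_self_iff.2 hζ] at h
  rw [innerU, ← h]
  exact S.inner_compC_eq_zero hij hξ (Submodule.starProjection_apply_mem _ _)

end MixedQData

namespace HomogeneousBasis
variable {H N : Type*} [NormedAddCommGroup H] [InnerProductSpace ℝ H] {S : MixedQData H N} {d : ℕ}
  (b : HomogeneousBasis S d)

theorem col_eq_of_innerU_ne_zero {k l : Fin d} (h : S.innerU (b.vec k).conj (b.vec l) ≠ 0) :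
    b.col k = b.col l := by
  by_contra hne
  have := Module.Basis.finiteDimensional_of_finite b.vec
  exact h (S.innerU_eq_zero hne (S.conj_mem_compC (b.vec_mem k)) (b.vec_mem l))

end HomogeneousBasis

/-! ### Annihilation operators on simple tensors -/

namespace HomogeneousBasis
variable {H N : Type*} [NormedAddCommGroup H] [InnerProductSpace ℝ H] {S : MixedQData H N} {d : ℕ}
  (b : HomogeneousBasis S d)

/-- The simple tensor of the letters `e_{c k}` at the positions `k` selected by `s`, in decreasing
order of the positions. Both the words `e_{α_n} ⊗ ⋯ ⊗ e_{α_1}` and the tensors `e_{s(π)}` are of this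
form, see `tensorOn_ne_zero` and `singletonTensor_eq`. -/
noncomputable def tensorOn {n : ℕ} (s : Fin n → Bool) (c : Fin n → Fin d) : b.Tens :=
  (((List.finRange n).reverse.filter s).map fun k => TensorAlgebra.ι ℂ (b.vec (c k))).prod

theorem singletonTensor_eq {n : ℕ} (π : Perm (Fin (n + 1))) (c : Fin (n + 1) → Fin d) :
    b.singletonTensor π c = b.tensorOn (fun k => π k = k) c := rfl

theorem tensorOn_snoc {n : ℕ} (s : Fin (n + 1) → Bool) (c : Fin (n + 1) → Fin d) :
    b.tensorOn s c = (if s (Fin.last n) then b.creation (b.vec (c (Fin.last n))) else 1)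
      (b.tensorOn (s ∘ Fin.castSucc) (c ∘ Fin.castSucc)) := by
  have h : ∀ l : List (Fin n), (l.map Fin.castSucc).filter s =
      (l.filter (s ∘ Fin.castSucc)).map Fin.castSucc := fun l => List.filter_map
  simp only [tensorOn, List.finRange_succ_last, List.reverse_append, List.reverse_cons,
    List.reverse_nil, List.nil_append, List.cons_append, List.filter_cons, ← List.map_reverse, h]
  split_ifs <;> simp [creation, Function.comp_def]

theorem tensorOn_eq_tens {n : ℕ} (c : Fin n → Fin d) :
    b.tensorOn (fun _ => true) c = b.tens (c ∘ Fin.rev) := by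
  induction n with
  | zero => simp [tensorOn, tens, TensorAlgebra.tprod_apply]
  | succ n ih =>
    have h := b.tensorOn_snoc (fun _ => true) c
    rw [if_pos rfl] at h
    rw [h]
    change b.creation _ (b.tensorOn (fun _ => true) _) = _
    rw [ih, creation_tens]
    refine congrArg _ (funext fun x => ?_)
    refine Fin.cases ?_ (fun i => ?_) x
    · simp
    · simp [Fin.rev_succ]

theorem tensorOn_ne_zero {n : ℕ} (c : Fin (n + 1) → Fin d) :
    b.tensorOn (fun k => k ≠ 0) c = b.tens (Fin.tail c ∘ Fin.rev) := by
  rw [← tensorOn_eq_tens]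
  simp only [tensorOn, List.finRange_succ, List.reverse_cons, List.filter_append, List.map_append,
    ← List.map_reverse]
  simp [List.filter_map, Function.comp_def, Fin.tail]

theorem annihilation_eq_sum (ξ : Complexification H) :
    b.annihilation ξ = ∑ k, S.innerU ξ (b.vec k) • b.annihilation (b.vec k) := by
  have h : b.freeAnnihilation ξ =
      ∑ k, S.innerU ξ (b.vec k) • b.freeAnnihilation (b.vec k) := by
    refine b.wordBasis.ext fun ⟨n, w⟩ => ?_
    rw [wordBasis_apply, LinearMap.sum_apply]
    cases n with
    | zero => simp [freeAnnihilation_zero]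
    | succ n => simp [freeAnnihilation_succ, b.orthonormal]
  simp only [annihilation]
  rw [h, sum_mul]
  simp

theorem annihilation_one (ξ : Complexification H) : b.annihilation ξ 1 = 0 := by
  have h : (1 : b.Tens) = b.tens (Fin.elim0 : Fin 0 → Fin d) := by
    simp [tens, TensorAlgebra.tprod_apply]
  rw [h, annihilation, Module.End.mul_apply, opR_tens]
  simp

/-- The commutation relation of `a(ē_l)` and `a*(e_k)`. Only letters of the colour of `e_l`
contribute to the expansion of `a(ē_l)` in the `a(e_j)`, so the exchange factor is `q(i_l, i_k)`. -/
theorem annihilation_conj_creation (l k : Fin d) (x : b.Tens) :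
    b.annihilation (b.vec l).conj (b.creation (b.vec k) x) =
      S.innerU (b.vec l).conj (b.vec k) • x +
        (b.Q l k : ℂ) • b.creation (b.vec k) (b.annihilation (b.vec l).conj x) := by
  rw [annihilation_eq_sum]
  simp only [LinearMap.sum_apply, LinearMap.smul_apply, annihilation_creation, smul_add,
    sum_add_distrib, map_sum, map_smul, smul_sum]
  congr 1
  · simp [ite_smul, smul_ite]
  · refine sum_congr rfl fun j _ => ?_
    by_cases h : S.innerU (b.vec l).conj (b.vec j) = 0
    · simp [h]
    · rw [smul_comm, Q, Q, b.col_eq_of_innerU_ne_zero h]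

/-- The product of `q(i_l, i_{c u})` over the selected positions `u > p`: the factor picked up by the
letter at `p` on its way to the left end of the tensor. -/
def passWeight {n : ℕ} (l : Fin d) (s : Fin n → Bool) (c : Fin n → Fin d) (p : Fin n) : ℝ :=
  ∏ u, if p < u ∧ s u then b.Q l (c u) else 1

theorem annihilation_tensorOn {n : ℕ} (l : Fin d) (s : Fin (n + 1) → Bool)
    (c : Fin (n + 1) → Fin d) : b.annihilation (b.vec l).conj (b.tensorOn s c) =
      ∑ p with s p, (S.innerU (b.vec l).conj (b.vec (c p)) * (b.passWeight l s c p : ℂ)) •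
        b.tensorOn (s ∘ p.succAbove) (c ∘ p.succAbove) := by
  rw [sum_filter]
  induction n with
  | zero =>
    have h0 : ∀ (s : Fin 0 → Bool) c, b.tensorOn s c = 1 := fun s c => by simp [tensorOn]
    rw [tensorOn_snoc, Fin.sum_univ_one, h0, h0]
    by_cases h : s 0 <;>
      simp [h, annihilation_conj_creation, annihilation_one, passWeight]
  | succ n ih =>
    have e1 : ∀ p : Fin (n + 1), p.castSucc.succAbove (Fin.last n) = Fin.last (n + 1) :=
      fun p => Fin.succAbove_castSucc_of_le p _ (Fin.le_last _)
    have e2 : ∀ p : Fin (n + 1), p.castSucc.succAbove ∘ Fin.castSucc =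
        Fin.castSucc ∘ p.succAbove := fun p => funext fun x => by
      simp
    have e3 : ∀ p : Fin (n + 1), b.passWeight l s c p.castSucc =
        b.passWeight l (s ∘ Fin.castSucc) (c ∘ Fin.castSucc) p *
          if s (Fin.last _) then b.Q l (c (Fin.last _)) else 1 := fun p => by
      simp [passWeight, Fin.prod_univ_castSucc, Fin.castSucc_lt_last]
    have e4 : b.passWeight l s c (Fin.last _) = 1 := by
      simp [passWeight, Fin.not_lt.2 (Fin.le_last _)]
    have e5 : ∀ p : Fin (n + 1), b.tensorOn (s ∘ p.castSucc.succAbove)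
        (c ∘ p.castSucc.succAbove) =
        (if s (Fin.last _) then b.creation (b.vec (c (Fin.last _))) else 1)
          (b.tensorOn ((s ∘ Fin.castSucc) ∘ p.succAbove) ((c ∘ Fin.castSucc) ∘ p.succAbove)) :=
      fun p => by
        rw [tensorOn_snoc]
        simp only [Function.comp_apply, e1, Function.comp_assoc, e2]
    rw [Fin.sum_univ_castSucc, tensorOn_snoc]
    simp only [e3, e4, e5, Fin.succAbove_last]
    have ih' := ih (s ∘ Fin.castSucc) (c ∘ Fin.castSucc)
    by_cases h : s (Fin.last _)
    · simp only [h, if_true, annihilation_conj_creation, ih', map_sum, smul_sum]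
      rw [add_comm]
      congr 1
      · refine sum_congr rfl fun p _ => ?_
        simp only [Function.comp_apply]
        split_ifs
        · rw [map_smul, smul_smul]; congr 1; push_cast; ring
        · simp
      · simp
    · simp only [h, if_false, Module.End.one_apply, ih', Bool.false_eq_true, add_zero, mul_one]
      rfl

end HomogeneousBasis

/-! ### Singleton/pair partitions and the insertion of vertices -/

section Insertion

/-- The permutation of `{0, …, n}` that fixes `p` and acts as `σ` on the other vertices, which are
numbered by `p.succAbove`. -/
def insFix {n : ℕ} (p : Fin (n + 1)) (σ : Perm (Fin n)) : Perm (Fin (n + 1)) :=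
  (finSuccEquiv' p).symm.permCongr (optionCongr σ)

/-- The permutation of `{0, …, n + 1}` that exchanges `p` with the last vertex and acts as `σ` on the
other vertices, which are numbered in increasing order. -/
def insPair {n : ℕ} (p : Fin (n + 1)) (σ : Perm (Fin n)) : Perm (Fin (n + 2)) :=
  insFix (Fin.last _) (insFix p σ) * swap p.castSucc (Fin.last _)

variable {n : ℕ} (p : Fin (n + 1)) (σ : Perm (Fin n))

@[simp] theorem insFix_self : insFix p σ p = p := by simp [insFix, permCongr_apply]

@[simp] theorem insFix_succAbove (i : Fin n) :
    insFix p σ (p.succAbove i) = p.succAbove (σ i) := by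
  simp [insFix, permCongr_apply]

@[simp] theorem insFix_last_castSucc (i : Fin n) :
    insFix (Fin.last n) σ i.castSucc = (σ i).castSucc := by
  simpa using insFix_succAbove (Fin.last n) σ i

@[simp] theorem insPair_last : insPair p σ (Fin.last _) = p.castSucc := by
  simp [insPair]

@[simp] theorem insPair_castSucc_self : insPair p σ p.castSucc = Fin.last _ := by
  simp [insPair]

@[simp] theorem insPair_succAbove (i : Fin n) :
    insPair p σ (p.succAbove i).castSucc = (p.succAbove (σ i)).castSucc := by
  rw [insPair, Perm.mul_apply, swap_apply_of_ne_of_ne]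
  · simp
  · simp [Fin.succAbove_ne]
  · exact Fin.castSucc_ne_last _

theorem insFix_injective : Function.Injective (insFix p) :=
  (Equiv.injective _).comp optionCongr_injective

theorem insPair_injective : Function.Injective (insPair p) := fun _ _ h =>
  insFix_injective p (insFix_injective _ (mul_right_cancel h))

variable {p} in
theorem exists_insFix {π : Perm (Fin (n + 1))} (h : π p = p) : ∃ σ, insFix p σ = π := by
  refine ⟨removeNone ((finSuccEquiv' p).permCongr π), ?_⟩
  rw [insFix, map_equiv_removeNone]
  have : (finSuccEquiv' p).permCongr π none = none := by simp [permCongr_apply, h]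
  rw [this, swap_self]
  ext x
  simp [permCongr_apply]

variable {p} in
theorem exists_insPair {π : Perm (Fin (n + 2))} (hπ : ∀ k, π (π k) = k)
    (h : π (Fin.last _) = p.castSucc) : ∃ σ, insPair p σ = π := by
  obtain ⟨ρ, hρ⟩ := exists_insFix (π := π * swap p.castSucc (Fin.last _)) (p := Fin.last _)
    (by rw [Perm.mul_apply, swap_apply_right, ← h, hπ])
  obtain ⟨σ, rfl⟩ := exists_insFix (π := ρ) (p := p) (by
    have := congrArg (fun τ => τ p.castSucc) hρ
    simpa [h] using this)
  refine ⟨σ, ?_⟩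
  rw [insPair, hρ, mul_assoc, swap_mul_self, mul_one]

end Insertion

theorem mem_dualPartitions {n : ℕ} {π : Perm (Fin (n + 1))} : π ∈ dualPartitions n ↔
    (∀ k, π (π k) = k) ∧ π 0 ≠ 0 ∧ (∀ l, 0 < l → l < π 0 → π 0 < π l) ∧
      ∀ m, π 0 < m → π m ≠ m → π m < π 0 := by
  simp [dualPartitions]

section Membership
variable {m : ℕ} {p : Fin (m + 2)} {σ : Perm (Fin (m + 1))}

theorem insFix_zero (hp : p ≠ 0) : insFix p σ 0 = p.succAbove (σ 0) := by
  rw [← insFix_succAbove, Fin.succAbove_ne_zero_zero hp]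

theorem insPair_zero (hp : p ≠ 0) : insPair p σ 0 = (p.succAbove (σ 0)).castSucc := by
  rw [← insPair_succAbove, Fin.succAbove_ne_zero_zero hp, Fin.castSucc_zero]

theorem succAbove_pos_iff (hp : p ≠ 0) (i : Fin (m + 1)) : 0 < p.succAbove i ↔ 0 < i := by
  rw [Fin.pos_iff_ne_zero, Fin.pos_iff_ne_zero, Ne, Fin.succAbove_eq_zero_iff hp]

theorem insFix_mem_dualPartitions (hp : p ≠ 0) :
    insFix p σ ∈ dualPartitions (m + 1) ↔ σ ∈ dualPartitions m ∧ (σ 0).castSucc < p := by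
  have h0 := Fin.pos_iff_ne_zero.2 hp
  simp only [mem_dualPartitions, Fin.forall_iff_succAbove p, insFix_zero hp, insFix_self,
    insFix_succAbove, succAbove_pos_iff hp, Fin.succAbove_lt_succAbove_iff,
    (Fin.succAbove_right_injective (p := p)).eq_iff, Fin.succAbove_eq_zero_iff hp, ne_eq,
    Fin.lt_succAbove_iff_le_castSucc, Fin.succAbove_lt_iff_castSucc_lt, not_true]
  constructor
  · rintro ⟨⟨-, h1⟩, h2, ⟨h3, h4⟩, -, h5⟩
    exact ⟨⟨h1, h2, h4, h5⟩, by_contra fun h => h (h3 h0 (not_lt.1 h))⟩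
  · rintro ⟨⟨h1, h2, h4, h5⟩, h⟩
    exact ⟨⟨trivial, h1⟩, h2, ⟨fun _ h' => absurd h (not_lt.2 h'), h4⟩, fun _ h => h.elim, h5⟩

theorem insFix_last_mem_dualPartitions :
    insFix (Fin.last _) σ ∈ dualPartitions (m + 1) ↔ σ ∈ dualPartitions m := by
  rw [insFix_mem_dualPartitions (Fin.last_pos' ).ne', and_iff_left (Fin.castSucc_lt_last _)]

theorem insPair_mem_dualPartitions (hp : p ≠ 0) :
    insPair p σ ∈ dualPartitions (m + 2) ↔ σ ∈ dualPartitions m ∧ p ≤ (σ 0).castSucc := by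
  have h0 := Fin.pos_iff_ne_zero.2 hp
  have hl : ∀ x : Fin (m + 2), ¬ Fin.last (m + 2) < x.castSucc :=
    fun x => not_lt.2 (Fin.le_last _)
  simp only [mem_dualPartitions, Fin.forall_fin_succ' (n := m + 2), Fin.forall_iff_succAbove p, insPair_zero hp,
    insPair_last, insPair_castSucc_self, insPair_succAbove, Fin.castSucc_pos_iff,
    succAbove_pos_iff hp, Fin.castSucc_lt_castSucc_iff, Fin.succAbove_lt_succAbove_iff,
    (Fin.castSucc_injective _).eq_iff, Fin.castSucc_eq_zero_iff, hl,
    (Fin.succAbove_right_injective (p := p)).eq_iff, Fin.succAbove_eq_zero_iff hp, ne_eq,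
    Fin.lt_succAbove_iff_le_castSucc, Fin.succAbove_lt_iff_castSucc_lt, Fin.castSucc_lt_last]
  constructor
  · rintro ⟨⟨⟨-, h1⟩, -⟩, h2, ⟨⟨-, h4⟩, -⟩, ⟨-, h5⟩, h⟩
    exact ⟨⟨h1, h2, h4, h5⟩, h trivial (Fin.castSucc_ne_last _)⟩
  · rintro ⟨⟨h1, h2, h4, h5⟩, h⟩
    exact ⟨⟨⟨trivial, h1⟩, trivial⟩, h2, ⟨⟨fun _ _ => trivial, h4⟩, fun _ h => h.elim⟩,
      ⟨fun h' _ => absurd h (not_le.2 h'), h5⟩, fun _ _ => h⟩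

end Membership

section Sums
variable {M : Type*} [AddCommMonoid M] {m : ℕ}

/-- A partition in `B(n + 2)` with `n ≥ 1` arises by appending the last vertex either as a singleton
or as the partner of some vertex before `π 0`. -/
theorem sum_dualPartitions_add_two (F : Perm (Fin (m + 3)) → M) :
    ∑ π ∈ dualPartitions (m + 2), F π =
      ∑ σ ∈ dualPartitions (m + 1), F (insFix (Fin.last _) σ) +
      ∑ p with p ≠ 0, ∑ σ ∈ dualPartitions m with p ≤ (σ 0).castSucc, F (insPair p σ) := by
  rw [← sum_filter_add_sum_filter_not _ (fun π => π (Fin.last _) = Fin.last _), sum_sigma']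
  congr 1
  · symm
    refine sum_nbij (insFix (Fin.last _)) (fun σ hσ => ?_) (insFix_injective _).injOn
      (fun π hπ => ?_) fun _ _ => rfl
    · exact mem_filter.2 ⟨insFix_last_mem_dualPartitions.2 hσ, insFix_self _ _⟩
    · obtain ⟨h1, h2⟩ := mem_filter.1 hπ
      obtain ⟨σ, rfl⟩ := exists_insFix h2
      exact ⟨σ, insFix_last_mem_dualPartitions.1 h1, rfl⟩
  · symm
    refine sum_nbij (fun x => insPair x.1 x.2) (fun x hx => ?_) (fun x hx y hy h => ?_)
      (fun π hπ => ?_) fun _ _ => rfl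
    · simp only [mem_sigma, mem_filter, mem_univ, true_and] at hx
      exact mem_filter.2 ⟨(insPair_mem_dualPartitions hx.1).2 hx.2, by
        rw [insPair_last]; exact Fin.castSucc_ne_last _⟩
    · obtain ⟨p, σ⟩ := x
      obtain ⟨p', σ'⟩ := y
      have hp : p = p' := by simpa using congrArg (fun τ => τ (Fin.last _)) h
      subst hp
      obtain rfl : σ = σ' := insPair_injective p h
      rfl
    · obtain ⟨h1, h2⟩ := mem_filter.1 hπ
      obtain ⟨p, hp⟩ := Fin.exists_castSucc_eq.2 h2
      have h3 := mem_dualPartitions.1 h1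
      obtain ⟨σ, rfl⟩ := exists_insPair h3.1 hp.symm
      have hp0 : p ≠ 0 := by
        rintro rfl
        -- if `0` were paired with the last vertex, vertex `1` would need a partner beyond it
        have h4 : insPair 0 σ 0 = Fin.last _ := insPair_castSucc_self 0 σ
        have h5 := h3.2.2.1 1 (by simp) (by rw [h4]; simp [Fin.lt_def])
        rw [h4] at h5
        exact not_lt.2 (Fin.le_last _) h5
      refine ⟨⟨p, σ⟩, ?_, rfl⟩
      simpa [hp0] using (insPair_mem_dualPartitions hp0).1 h1

/-- Removing a singleton `p` from `π ∈ B(n + 1)` leaves a partition `σ ∈ B(n)` with `σ 0` before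
`p`. -/
theorem sum_dualPartitions_fixed (G : Fin (m + 2) → Perm (Fin (m + 2)) → M) :
    ∑ π ∈ dualPartitions (m + 1), ∑ p with π p = p, G p π =
      ∑ p with p ≠ 0, ∑ σ ∈ dualPartitions m with (σ 0).castSucc < p, G p (insFix p σ) := by
  rw [sum_sigma', sum_sigma']
  symm
  refine sum_nbij (fun x => ⟨insFix x.1 x.2, x.1⟩) (fun x hx => ?_) (fun x hx y hy h => ?_)
    (fun x hx => ?_) fun _ _ => rfl
  · simp only [mem_sigma, mem_filter, mem_univ, true_and] at hx ⊢
    exact ⟨(insFix_mem_dualPartitions hx.1).2 hx.2, insFix_self _ _⟩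
  · obtain ⟨p, σ⟩ := x
    obtain ⟨p', σ'⟩ := y
    simp only [Sigma.mk.injEq, heq_eq_eq] at h
    obtain ⟨h, rfl⟩ := h
    rw [insFix_injective p h]
  · obtain ⟨π, p⟩ := x
    simp only [coe_sigma, Set.mem_sigma_iff, mem_coe, mem_filter, mem_univ, true_and] at hx
    obtain ⟨σ, rfl⟩ := exists_insFix hx.2
    have hp0 : p ≠ 0 := by
      rintro rfl
      exact (mem_dualPartitions.1 hx.1).2.1 hx.2
    refine ⟨⟨p, σ⟩, ?_, rfl⟩
    simpa [hp0] using (insFix_mem_dualPartitions hp0).1 hx.1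

end Sums

namespace HomogeneousBasis
variable {H N : Type*} [NormedAddCommGroup H] [InnerProductSpace ℝ H] {S : MixedQData H N} {d : ℕ}
  (b : HomogeneousBasis S d)

theorem pairWeight_insFix {n : ℕ} (p : Fin (n + 2)) (σ : Perm (Fin (n + 1)))
    (c : Fin (n + 2) → Fin d) :
    b.pairWeight (insFix p σ) c = b.pairWeight σ (c ∘ p.succAbove) := by
  simp [pairWeight, Fin.prod_univ_succAbove _ p]

theorem pairWeight_insPair {n : ℕ} (p : Fin (n + 2)) (σ : Perm (Fin (n + 1)))
    (c : Fin (n + 2) → Fin d) (l : Fin d) :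
    b.pairWeight (insPair p σ) (Fin.snoc c l : Fin (n + 3) → Fin d) =
      S.innerU (b.vec l).conj (b.vec (c p)) * b.pairWeight σ (c ∘ p.succAbove) := by
  have h : ¬ Fin.last (n + 2) < p.castSucc := not_lt.2 (Fin.le_last _)
  simp [pairWeight, Fin.prod_univ_castSucc (n := n + 2), Fin.prod_univ_succAbove _ p,
    Fin.castSucc_lt_last, h]
  ring

/-- If the product of the pairings does not vanish, paired letters have the same colour. -/
theorem col_eq_of_pairWeight_ne_zero {n : ℕ} {π : Perm (Fin (n + 1))} (hπ : ∀ k, π (π k) = k)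
    {c : Fin (n + 1) → Fin d} (h : b.pairWeight π c ≠ 0) (k : Fin (n + 1)) :
    b.col (c (π k)) = b.col (c k) := by
  have h1 := fun k => Finset.prod_ne_zero_iff.1 h k (mem_univ k)
  rcases lt_trichotomy (π k) k with hk | hk | hk
  · have := h1 k
    rw [if_pos hk] at this
    exact (b.col_eq_of_innerU_ne_zero this).symm
  · rw [hk]
  · have := h1 (π k)
    rw [hπ, if_pos hk] at this
    exact b.col_eq_of_innerU_ne_zero this

variable {m : ℕ} {p : Fin (m + 2)} {σ : Perm (Fin (m + 1))}

theorem crossingWeight_insFix (hp : p ≠ 0) (hσ : (σ 0).castSucc < p) (c : Fin (m + 2) → Fin d) :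
    b.crossingWeight (insFix p σ) c = b.crossingWeight σ (c ∘ p.succAbove) *
      ∏ i, if p ≤ i.castSucc ∧ σ i ≠ i then b.Q (c p) (c (p.succAbove i)) else 1 := by
  have h1 : ∀ (i : Fin (m + 1)) (q : Prop), (p ≤ i.castSucc ∧ i < σ 0 ∧ q) ↔ False :=
    fun i q => iff_false_intro fun h =>
      (h.1.trans_lt ((Fin.castSucc_lt_castSucc_iff.2 h.2.1).trans hσ)).false
  have h2 : ∀ i : Fin (m + 1), (p ≤ i.castSucc ∧ i < σ 0) ↔ False := fun i => by
    simpa using h1 i True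
  have h3 : ¬ p ≤ (σ 0).castSucc := not_le.2 hσ
  simp only [crossingWeight, Fin.prod_univ_succAbove _ p, insFix_zero hp, insFix_self,
    insFix_succAbove, succAbove_pos_iff hp, Fin.succAbove_lt_succAbove_iff,
    (Fin.succAbove_right_injective (p := p)).eq_iff, ne_eq, Function.comp_apply,
    Fin.lt_succAbove_iff_le_castSucc, Fin.succAbove_lt_iff_castSucc_lt, not_true, h3, hσ,
    prod_mul_distrib, lt_self_iff_false, and_false, false_and, if_false, prod_const_one, one_mul,
    true_and, h1, h2]
  ring

/-- If `f` is constant on the pairs of `σ`, its product over the vertices before `σ 0` is its product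
over their partners, the vertices from `σ 0` on that are not singletons. -/
theorem prod_lt_eq_prod_partners (hσ : σ ∈ dualPartitions m) (f : Fin (m + 1) → ℝ)
    (hf : ∀ i, f (σ i) = f i) :
    (∏ i, if i < σ 0 then f i else 1) =
      ∏ i, if σ 0 ≤ i ∧ ¬ (σ 0 < i ∧ σ i = i) then f i else 1 := by
  obtain ⟨h1, h2, h3, h4⟩ := mem_dualPartitions.1 hσ
  rw [← Equiv.prod_comp σ]
  refine prod_congr rfl fun i _ => ?_
  rw [hf]
  congr 1
  rw [eq_iff_iff]
  have h5 := h3 i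
  have h6 := h4 i
  rcases lt_trichotomy i (σ 0) with h | rfl | h
  · rcases eq_or_ne i 0 with rfl | hi
    · simpa using h2
    · have := h5 (Fin.pos_iff_ne_zero.2 hi) h
      simp [not_lt.2 this.le, not_le.2 h]
  · simp [h1, Fin.pos_iff_ne_zero, h2]
  · by_cases h7 : σ i = i
    · simp [h7, not_lt.2 h.le, h]
    · simp [h7, h6 h h7, h.le]

theorem crossingWeight_insPair (hp : p ≠ 0) (hσ : σ ∈ dualPartitions m)
    (hpσ : p ≤ (σ 0).castSucc) (c : Fin (m + 2) → Fin d) (l : Fin d)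
    (hl : b.col l = b.col (c p))
    (hc : ∀ i, b.col (c (p.succAbove (σ i))) = b.col (c (p.succAbove i))) :
    b.crossingWeight (insPair p σ) (Fin.snoc c l : Fin (m + 3) → Fin d) =
      b.crossingWeight σ (c ∘ p.succAbove) * b.passWeight l (fun k => k ≠ 0) c p := by
  have hl' : ∀ x : Fin (m + 2), ¬ Fin.last (m + 2) < x.castSucc :=
    fun x => not_lt.2 (Fin.le_last _)
  have hpl : ¬ p.castSucc = Fin.last (m + 2) := Fin.castSucc_ne_last p
  have h0 : 0 < p := Fin.pos_iff_ne_zero.2 hp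
  have hQ : ∀ i, b.Q (c p) i = b.Q l i := fun i => by rw [Q, Q, hl]
  have hQ1 : ∀ i, b.Q i (c p) = b.Q l i := fun i => by rw [Q_symm, hQ]
  have hQ2 : ∀ i, b.Q i l = b.Q l i := fun i => b.Q_symm _ _
  have hQ3 : ∀ i, b.Q l (c (p.succAbove (σ i))) = b.Q l (c (p.succAbove i)) := fun i => by
    rw [Q, Q, hc]
  have hlt : ¬ (σ 0).castSucc < p := not_lt.2 hpσ
  have hlt' : ∀ (i : Fin (m + 1)) (q : Prop), (σ 0 < i ∧ i.castSucc < p ∧ q) ↔ False :=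
    fun i q => iff_false_intro fun h =>
      (h.2.1.trans_le (hpσ.trans (Fin.castSucc_le_castSucc_iff.2 h.1.le))).false
  have hne : ∀ i : Fin (m + 1), (p ≤ i.castSucc ∧ decide (¬ i = 0) = true) ↔ p ≤ i.castSucc :=
    fun i => and_iff_left_of_imp fun h => by
      rw [decide_eq_true_eq]
      rintro rfl
      exact h0.not_ge h
  simp only [passWeight, crossingWeight, Fin.prod_univ_castSucc (n := m + 2),
    Fin.prod_univ_succAbove _ p, insPair_zero hp,
    insPair_last, insPair_castSucc_self, insPair_succAbove, Fin.castSucc_pos_iff,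
    succAbove_pos_iff hp, Fin.castSucc_lt_castSucc_iff, Fin.succAbove_lt_succAbove_iff,
    (Fin.castSucc_injective _).eq_iff, hl',
    (Fin.succAbove_right_injective (p := p)).eq_iff, Fin.succAbove_eq_zero_iff hp, ne_eq,
    Fin.lt_succAbove_iff_le_castSucc, Fin.succAbove_lt_iff_castSucc_lt, Fin.castSucc_lt_last,
    prod_mul_distrib, lt_self_iff_false, and_false, false_and, if_false, prod_const_one, one_mul,
    true_and, hlt, Fin.snoc_last, Fin.snoc_castSucc, hpσ, mul_one, and_true, hQ, hQ1, hQ2, hQ3,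
    Function.comp_apply, h0, hpl, Ne.symm hpl, not_false_eq_true, hlt', hne]
  set f : Fin (m + 1) → ℝ := fun i => b.Q l (c (p.succAbove i))
  -- the factors of `p` from the first product run over all vertices before `σ 0`, which is turned
  -- into a product over their partners
  have h1 : (∏ i, if i.castSucc < p then f i else 1) *
      (∏ i, if p ≤ i.castSucc ∧ i < σ 0 then f i else 1) =
        ∏ i, if i < σ 0 then f i else 1 := by
    rw [← prod_mul_distrib]
    refine prod_congr rfl fun i _ => ?_
    by_cases h : i.castSucc < p
    · have h2 : i < σ 0 := Fin.castSucc_lt_castSucc_iff.1 (h.trans_le hpσ)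
      simp [h, h2, not_le.2 h]
    · simp [h, not_lt.1 h]
  have h2 : (∏ i, if i < σ 0 then f i else 1) *
      (∏ i, if p ≤ i.castSucc ∧ i < σ 0 then f i else 1) *
      (∏ i, if σ 0 < i ∧ σ i = i then f i else 1) = ∏ i, if p ≤ i.castSucc then f i else 1 := by
    rw [prod_lt_eq_prod_partners hσ f hQ3, ← prod_mul_distrib, ← prod_mul_distrib]
    refine prod_congr rfl fun i _ => ?_
    rcases lt_or_ge i (σ 0) with h | h
    · simp [h, not_le.2 h, not_lt.2 h.le]
    · have h3 : p ≤ i.castSucc := hpσ.trans (Fin.castSucc_le_castSucc_iff.2 h)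
      by_cases h4 : σ 0 < i ∧ σ i = i <;> simp [h, not_lt.2 h, h3, h4]
  rw [← h2, ← h1]
  ring

theorem passWeight_insFix (hp : p ≠ 0) (hσ : (σ 0).castSucc < p) (c : Fin (m + 2) → Fin d)
    (l : Fin d) (hl : b.col l = b.col (c p)) :
    b.crossingWeight (insFix p σ) c * b.passWeight l (fun k => insFix p σ k = k) c p =
      b.crossingWeight σ (c ∘ p.succAbove) * b.passWeight l (fun k => k ≠ 0) c p := by
  have h0 : 0 < p := Fin.pos_iff_ne_zero.2 hp
  have hne : ∀ i : Fin (m + 1), (p ≤ i.castSucc ∧ ¬ i = 0) ↔ p ≤ i.castSucc :=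
    fun i => and_iff_left_of_imp fun h => by
      rintro rfl
      exact h0.not_ge h
  rw [b.crossingWeight_insFix hp hσ, mul_assoc]
  congr 1
  simp only [passWeight, Fin.prod_univ_succAbove _ p, lt_self_iff_false, false_and, if_false,
    one_mul, insFix_succAbove, (Fin.succAbove_right_injective (p := p)).eq_iff,
    Fin.lt_succAbove_iff_le_castSucc, ne_eq, Fin.succAbove_eq_zero_iff hp, decide_eq_true_eq]
  rw [← prod_mul_distrib]
  refine prod_congr rfl fun i _ => ?_
  have h2 : b.Q (c p) (c (p.succAbove i)) = b.Q l (c (p.succAbove i)) := by rw [Q, Q, hl]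
  have h3 := hne i
  rw [h2]
  simp only [h3]
  by_cases h1 : σ i = i <;> simp [h1]

end HomogeneousBasis

/-! ### The commutation relations on the algebraic Fock space -/

namespace HomogeneousBasis
variable {H N : Type*} [NormedAddCommGroup H] [InnerProductSpace ℝ H] {S : MixedQData H N} {d : ℕ}
  (b : HomogeneousBasis S d)

/-- The coefficient `(-1)^(π(0) - 1) Q(π) E(π)` of `e_{s(π)}`. -/
noncomputable def dualCoeff {n : ℕ} (π : Perm (Fin (n + 1))) (c : Fin (n + 1) → Fin d) : ℂ :=
  (-1) ^ ((π 0 : ℕ) - 1) * (b.crossingWeight π c : ℂ) * b.pairWeight π c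

/-- The operator `D_α` on the algebraic Fock space. -/
noncomputable def dualMap (α : Fin d) : Module.End ℂ b.Tens :=
  b.wordBasis.constr ℂ fun x => ∑ π ∈ dualPartitions x.1,
    b.dualCoeff π (Fin.cons α (x.2 ∘ Fin.rev)) •
      b.singletonTensor π (Fin.cons α (x.2 ∘ Fin.rev))

theorem dualMap_tens (α : Fin d) {n : ℕ} (a : Fin n → Fin d) :
    b.dualMap α (b.tens (a ∘ Fin.rev)) = ∑ π ∈ dualPartitions n,
      b.dualCoeff π (Fin.cons α a) • b.singletonTensor π (Fin.cons α a) := by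
  have h : (a ∘ Fin.rev) ∘ Fin.rev = a := funext fun i => by simp
  rw [← wordBasis_apply, dualMap, Module.Basis.constr_basis]
  simp only [h]

theorem dualMap_tensorOn {n : ℕ} (c : Fin (n + 1) → Fin d) :
    b.dualMap (c 0) (b.tensorOn (fun k => k ≠ 0) c) = ∑ π ∈ dualPartitions n,
      b.dualCoeff π c • b.tensorOn (fun k => π k = k) c := by
  rw [tensorOn_ne_zero, dualMap_tens, Fin.cons_self_tail]
  rfl

theorem tens_zero (w : Fin 0 → Fin d) : b.tens w = 1 := by
  simp [tens, TensorAlgebra.tprod_apply]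

theorem dualPartitions_zero : dualPartitions 0 = ∅ := by
  refine filter_eq_empty_iff.2 fun π _ h => h.2.1 (Subsingleton.elim (α := Fin 1) _ _)

theorem dualMap_one (α : Fin d) : b.dualMap α 1 = 0 := by
  have h := b.dualMap_tens α (Fin.elim0 : Fin 0 → Fin d)
  rwa [tens_zero, dualPartitions_zero, sum_empty] at h

theorem dualPartitions_one : dualPartitions 1 = {swap 0 1} := by
  decide

theorem dualMap_creation_one (α l : Fin d) :
    b.dualMap α (b.creation (b.vec l) 1) = S.innerU (b.vec l).conj (b.vec α) • 1 := by
  have h := b.dualMap_tens α (fun _ : Fin 1 => l)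
  have e : b.tens ((fun _ : Fin 1 => l) ∘ Fin.rev) = b.creation (b.vec l) 1 := by
    rw [← b.tens_zero Fin.elim0, creation_tens]
    exact congrArg _ (funext fun i => by rw [Subsingleton.elim i 0]; rfl)
  rw [e, dualPartitions_one, sum_singleton] at h
  rw [h]
  simp [dualCoeff, crossingWeight, pairWeight, singletonTensor, Fin.prod_univ_two,
    List.finRange_succ]

section Recursion
variable {m : ℕ} {p : Fin (m + 2)} {σ : Perm (Fin (m + 1))}

theorem creation_tensorOn_ne_zero {n : ℕ} (c : Fin (n + 1) → Fin d) (l : Fin d) :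
    b.creation (b.vec l) (b.tensorOn (fun k => k ≠ 0) c) =
      b.tensorOn (fun k => k ≠ 0) (Fin.snoc c l : Fin (n + 2) → Fin d) := by
  rw [b.tensorOn_snoc (n := n + 1)]
  simp [Function.comp_def]

theorem tensorOn_insFix_last (σ : Perm (Fin (m + 2))) (c : Fin (m + 2) → Fin d) (l : Fin d) :
    b.tensorOn (fun k => insFix (Fin.last _) σ k = k) (Fin.snoc c l : Fin (m + 3) → Fin d) =
      b.creation (b.vec l) (b.tensorOn (fun k => σ k = k) c) := by
  rw [b.tensorOn_snoc (n := m + 2)]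
  simp [Function.comp_def]

theorem tensorOn_insFix (p : Fin (m + 2)) (σ : Perm (Fin (m + 1))) (c : Fin (m + 2) → Fin d) :
    b.tensorOn ((fun k => decide (insFix p σ k = k)) ∘ p.succAbove) (c ∘ p.succAbove) =
      b.tensorOn (fun k => σ k = k) (c ∘ p.succAbove) := by
  simp [Function.comp_def]

theorem tensorOn_comp_succAbove_of_false {n : ℕ} (p : Fin (n + 1)) (s : Fin (n + 1) → Bool)
    (c : Fin (n + 1) → Fin d) (h : s p = false) :
    b.tensorOn s c = b.tensorOn (s ∘ p.succAbove) (c ∘ p.succAbove) := by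
  induction n with
  | zero =>
    rw [Subsingleton.elim (α := Fin 1) p (Fin.last 0)] at h
    rw [tensorOn_snoc, h]
    simp [tensorOn]
  | succ n ih =>
    refine Fin.lastCases (fun h => ?_) (fun p h => ?_) p h
    · rw [tensorOn_snoc, h]
      simp
    · have e1 : p.castSucc.succAbove (Fin.last n) = Fin.last (n + 1) :=
        Fin.succAbove_castSucc_of_le p _ (Fin.le_last _)
      have e2 : p.castSucc.succAbove ∘ Fin.castSucc = Fin.castSucc ∘ p.succAbove :=
        funext fun x => by simp
      rw [tensorOn_snoc, b.tensorOn_snoc (s ∘ p.castSucc.succAbove),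
        ih p (s ∘ Fin.castSucc) (c ∘ Fin.castSucc) h]
      simp only [Function.comp_apply, e1, Function.comp_assoc, e2]

theorem tensorOn_insPair (p : Fin (m + 2)) (σ : Perm (Fin (m + 1))) (c : Fin (m + 2) → Fin d)
    (l : Fin d) :
    b.tensorOn (fun k => insPair p σ k = k) (Fin.snoc c l : Fin (m + 3) → Fin d) =
      b.tensorOn (fun k => σ k = k) (c ∘ p.succAbove) := by
  have h : ¬ p.castSucc = Fin.last (m + 2) := Fin.castSucc_ne_last p
  rw [b.tensorOn_snoc (n := m + 2), b.tensorOn_comp_succAbove_of_false p]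
  · simp [Function.comp_def, h]
  · simp [Ne.symm h]

theorem dualCoeff_insFix_last (σ : Perm (Fin (m + 2))) (c : Fin (m + 2) → Fin d) (l : Fin d) :
    b.dualCoeff (insFix (Fin.last _) σ) (Fin.snoc c l : Fin (m + 3) → Fin d) =
      b.dualCoeff σ c := by
  have hp : Fin.last (m + 2) ≠ 0 := Fin.last_pos'.ne'
  have hlast : ∀ x : Fin (m + 2), ¬ Fin.last (m + 2) ≤ x.castSucc :=
    fun x => not_le.2 (Fin.castSucc_lt_last x)
  have hc : (Fin.snoc c l : Fin (m + 3) → Fin d) ∘ (Fin.last (m + 2)).succAbove = c :=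
    funext fun i => by simp
  rw [dualCoeff, dualCoeff, pairWeight_insFix,
    b.crossingWeight_insFix hp (Fin.castSucc_lt_last _), hc, insFix_zero hp]
  simp [hlast]

/-- When `σ(0) < p`, the term of `a(ē_l) D_α` that pairs the new letter with the singleton `p` equals
the term of `D_α a(ē_l)` given by `σ`. -/
theorem dualCoeff_insFix (hp : p ≠ 0) (hσ : (σ 0).castSucc < p) (c : Fin (m + 2) → Fin d)
    (l : Fin d) :
    b.dualCoeff (insFix p σ) c * (S.innerU (b.vec l).conj (b.vec (c p)) *
        (b.passWeight l (fun k => insFix p σ k = k) c p : ℂ)) =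
      S.innerU (b.vec l).conj (b.vec (c p)) * (b.passWeight l (fun k => k ≠ 0) c p : ℂ) *
        b.dualCoeff σ (c ∘ p.succAbove) := by
  by_cases h : S.innerU (b.vec l).conj (b.vec (c p)) = 0
  · simp [h]
  · have key := congrArg (Complex.ofReal) <|
      b.passWeight_insFix hp hσ c l (b.col_eq_of_innerU_ne_zero h)
    push_cast at key
    rw [dualCoeff, dualCoeff, pairWeight_insFix, insFix_zero hp,
      Fin.succAbove_of_castSucc_lt _ _ hσ, Fin.val_castSucc]
    linear_combination (-1) ^ ((σ 0 : ℕ) - 1) * b.pairWeight σ (c ∘ p.succAbove) *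
      S.innerU (b.vec l).conj (b.vec (c p)) * key

/-- When `p ≤ σ(0)`, the term of `-D_α a(ē_l)` given by `p` and `σ` is the term of the partition in
which `p` is paired with the new letter. -/
theorem dualCoeff_insPair (hp : p ≠ 0) (hσ : σ ∈ dualPartitions m) (hpσ : p ≤ (σ 0).castSucc)
    (c : Fin (m + 2) → Fin d) (l : Fin d) :
    b.dualCoeff (insPair p σ) (Fin.snoc c l : Fin (m + 3) → Fin d) =
      - (S.innerU (b.vec l).conj (b.vec (c p)) * (b.passWeight l (fun k => k ≠ 0) c p : ℂ) *
        b.dualCoeff σ (c ∘ p.succAbove)) := by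
  rw [dualCoeff, dualCoeff, pairWeight_insPair, insPair_zero hp,
    Fin.succAbove_of_le_castSucc _ _ hpσ]
  by_cases h : S.innerU (b.vec l).conj (b.vec (c p)) = 0
  · simp [h]
  by_cases h' : b.pairWeight σ (c ∘ p.succAbove) = 0
  · simp [h']
  have hm := mem_dualPartitions.1 hσ
  rw [b.crossingWeight_insPair hp hσ hpσ c l (b.col_eq_of_innerU_ne_zero h)
    (b.col_eq_of_pairWeight_ne_zero hm.1 h')]
  have h0 : (σ 0 : ℕ) ≠ 0 := fun h => hm.2.1 (Fin.ext h)
  obtain ⟨j, hj⟩ := Nat.exists_eq_succ_of_ne_zero h0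
  simp only [Fin.val_castSucc, Fin.val_succ, hj, Nat.succ_eq_add_one, Nat.add_sub_cancel]
  push_cast
  ring

theorem dualMap_annihilation_tensorOn (c : Fin (m + 2) → Fin d) (l : Fin d) :
    b.dualMap (c 0) (b.annihilation (b.vec l).conj (b.tensorOn (fun k => k ≠ 0) c)) =
      ∑ p with p ≠ 0, ∑ σ ∈ dualPartitions m,
        (S.innerU (b.vec l).conj (b.vec (c p)) * (b.passWeight l (fun k => k ≠ 0) c p : ℂ) *
          b.dualCoeff σ (c ∘ p.succAbove)) • b.tensorOn (fun k => σ k = k) (c ∘ p.succAbove) := by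
  rw [annihilation_tensorOn, map_sum]
  simp only [decide_eq_true_eq]
  refine sum_congr rfl fun p hp => ?_
  have hp : p ≠ 0 := by simpa using hp
  have h0 : c 0 = (c ∘ p.succAbove) 0 := by simp [Fin.succAbove_ne_zero_zero hp]
  have hs : (fun k : Fin (m + 2) => decide (k ≠ 0)) ∘ p.succAbove = fun k => decide (k ≠ 0) :=
    funext fun k => by simp [Fin.succAbove_eq_zero_iff hp]
  rw [map_smul, hs, h0, dualMap_tensorOn, smul_sum]
  simp only [smul_smul]

theorem annihilation_dualMap_tensorOn (c : Fin (m + 2) → Fin d) (l : Fin d) :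
    b.annihilation (b.vec l).conj (b.dualMap (c 0) (b.tensorOn (fun k => k ≠ 0) c)) =
      ∑ p with p ≠ 0, ∑ σ ∈ dualPartitions m with (σ 0).castSucc < p,
        (S.innerU (b.vec l).conj (b.vec (c p)) * (b.passWeight l (fun k => k ≠ 0) c p : ℂ) *
          b.dualCoeff σ (c ∘ p.succAbove)) • b.tensorOn (fun k => σ k = k) (c ∘ p.succAbove) := by
  rw [dualMap_tensorOn, map_sum]
  simp only [map_smul, annihilation_tensorOn, smul_sum, smul_smul, decide_eq_true_eq]
  rw [sum_dualPartitions_fixed fun p π => (b.dualCoeff π c *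
    (S.innerU (b.vec l).conj (b.vec (c p)) * (b.passWeight l (fun k => π k = k) c p : ℂ))) •
      b.tensorOn ((fun k => decide (π k = k)) ∘ p.succAbove) (c ∘ p.succAbove)]
  refine sum_congr rfl fun p hp => sum_congr rfl fun σ hσ => ?_
  simp only [mem_filter, mem_univ, true_and] at hp hσ
  rw [b.dualCoeff_insFix hp hσ.2, tensorOn_insFix]

theorem dualMap_creation_tensorOn (c : Fin (m + 2) → Fin d) (l : Fin d) :
    b.dualMap (c 0) (b.creation (b.vec l) (b.tensorOn (fun k => k ≠ 0) c)) =
      b.creation (b.vec l) (b.dualMap (c 0) (b.tensorOn (fun k => k ≠ 0) c)) -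
      ∑ p with p ≠ 0, ∑ σ ∈ dualPartitions m with p ≤ (σ 0).castSucc,
        (S.innerU (b.vec l).conj (b.vec (c p)) * (b.passWeight l (fun k => k ≠ 0) c p : ℂ) *
          b.dualCoeff σ (c ∘ p.succAbove)) • b.tensorOn (fun k => σ k = k) (c ∘ p.succAbove) := by
  have h0 : c 0 = (Fin.snoc c l : Fin (m + 3) → Fin d) 0 :=
    (Fin.snoc_castSucc (α := fun _ => Fin d) l c 0).symm
  rw [creation_tensorOn_ne_zero, dualMap_tensorOn, h0, dualMap_tensorOn,
    sum_dualPartitions_add_two, map_sum, sub_eq_add_neg, ← sum_neg_distrib]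
  simp only [← sum_neg_distrib]
  congr 1
  · refine sum_congr rfl fun σ _ => ?_
    rw [dualCoeff_insFix_last, tensorOn_insFix_last, map_smul]
  · refine sum_congr rfl fun p hp => sum_congr rfl fun σ hσ => ?_
    simp only [mem_filter, mem_univ, true_and] at hp hσ
    rw [b.dualCoeff_insPair hp hσ.1 hσ.2, tensorOn_insPair, neg_smul]

end Recursion

/-- The commutator `[D_α, A_l]` on the simple tensors. -/
theorem dualMap_commutator_tens (α l : Fin d) {n : ℕ} (w : Fin n → Fin d) :
    b.dualMap α ((b.creation (b.vec l) + b.annihilation (b.vec l).conj) (b.tens w)) -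
      (b.creation (b.vec l) + b.annihilation (b.vec l).conj) (b.dualMap α (b.tens w)) =
        (S.innerU (b.vec l).conj (b.vec α) * if n = 0 then 1 else 0) • 1 := by
  cases n with
  | zero =>
    rw [tens_zero, dualMap_one, LinearMap.add_apply, annihilation_one, add_zero,
      dualMap_creation_one]
    simp
  | succ m =>
    have hw : b.tens w = b.tensorOn (fun k => k ≠ 0) (Fin.cons α (w ∘ Fin.rev) : _ → Fin d) := by
      rw [tensorOn_ne_zero, Fin.tail_cons]
      exact congrArg _ (funext fun i => by simp)
    have hα : α = (Fin.cons α (w ∘ Fin.rev) : Fin (m + 2) → Fin d) 0 := rfl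
    generalize (Fin.cons α (w ∘ Fin.rev) : Fin (m + 2) → Fin d) = c at hw hα
    subst hα
    rw [hw, LinearMap.add_apply, LinearMap.add_apply, map_add, dualMap_creation_tensorOn,
      dualMap_annihilation_tensorOn, annihilation_dualMap_tensorOn]
    have hsplit : ∀ T : Fin (m + 2) → Perm (Fin (m + 1)) → b.Tens,
        ∑ p with p ≠ 0, ∑ σ ∈ dualPartitions m, T p σ =
          ∑ p with p ≠ 0, ∑ σ ∈ dualPartitions m with p ≤ (σ 0).castSucc, T p σ +
          ∑ p with p ≠ 0, ∑ σ ∈ dualPartitions m with (σ 0).castSucc < p, T p σ := fun T => by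
      rw [← sum_add_distrib]
      refine sum_congr rfl fun p _ => ?_
      simp only [← not_le]
      exact (sum_filter_add_sum_filter_not _ _ _).symm
    rw [hsplit, if_neg (by omega), mul_zero, zero_smul]
    abel

end HomogeneousBasis

/-! ### Functionals on the algebraic Fock space bounded for the deformed norm -/

section InverseBound
variable {ι : Type*} [Fintype ι]

theorem one_add_pow_le_exp {r : ℝ} (hr : 0 ≤ r) (hr1 : r < 1) (j : ℕ) :
    1 + r ^ (j + 1) ≤ Real.exp (r ^ j) := by
  have h1 := Real.add_one_le_exp (r ^ j)
  have h2 : r ^ (j + 1) ≤ r ^ j := pow_le_pow_of_le_one hr hr1.le (Nat.le_succ j)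
  linarith

theorem one_le_exp_mul_one_sub_pow {r : ℝ} (hr : 0 ≤ r) (hr1 : r < 1) (j : ℕ) :
    1 ≤ Real.exp (r ^ j / (1 - r)) * (1 - r ^ (j + 2)) := by
  set t := r ^ (j + 2)
  have h0 : 0 ≤ t := by positivity
  have h1 : t ≤ r := by
    simpa using pow_le_pow_of_le_one hr hr1.le (show 1 ≤ j + 2 by omega)
  have h2 : t ≤ r ^ j := pow_le_pow_of_le_one hr hr1.le (by omega)
  have h3 : 0 < 1 - t := by linarith
  have h4 : 0 < 1 - r := by linarith
  have h5 : t / (1 - t) ≤ r ^ j / (1 - r) := by gcongr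
  have h6 := Real.add_one_le_exp (r ^ j / (1 - r))
  calc 1 = (t / (1 - t) + 1) * (1 - t) := by
        rw [add_mul, div_mul_cancel₀ _ h3.ne']
        ring
    _ ≤ _ := by gcongr; linarith

/-- The factorization `sumT_factor` bounds the inverse of `1 + T_1 + ⋯ + T_1 ⋯ T_m` by a product of
factors `(1 + r^(j+1)) / (1 - r^(j+2))`, which stays bounded as `m` grows. -/
theorem norm_le_exp_mul_norm_sumT (Q : ι → ι → ℝ) {r : ℝ} (hr : 0 ≤ r) (hr1 : r < 1)
    (hQ : ∀ i j, |Q i j| ≤ r) (n m : ℕ) (f : (Fin n → ι) → ℂ) :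
    ‖f‖ ≤ Real.exp ((1 + 1 / (1 - r)) * ∑ j ∈ range m, r ^ j) *
      ‖sumT (coordT Q n) (m + 1) f‖ := by
  induction m generalizing f with
  | zero => simp [sumT, prodT]
  | succ m ih =>
    have key := sumT_factor (coordT Q n) (coordT_braid Q n) (coordT_comm Q n) (m + 1)
    have hp : ∀ f, ‖prodT (coordT Q n) (m + 1) f‖ ≤ r ^ (m + 1) * ‖f‖ :=
      norm_prodT_le Q hr hQ n _
    have i1 : Function.Injective
        (1 - prodT (coordT Q n) (m + 1) : Module.End ℂ ((Fin n → ι) → ℂ)) := by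
      refine injective_one_sub _ hr1 fun f => (hp f).trans ?_
      gcongr
      simpa using pow_le_pow_of_le_one hr hr1.le (show 1 ≤ m + 1 by omega)
    obtain ⟨f, rfl⟩ := LinearMap.injective_iff_surjective.1 i1 f
    set g := sumT (coordT Q n) (m + 1) f with hg
    have h1 : sumT (coordT Q n) (m + 1 + 1) ((1 - prodT (coordT Q n) (m + 1)) f) =
        g - coordT Q n 0 (prodT (coordT Q n) (m + 1) g) := by
      have := LinearMap.congr_fun key f
      simpa [Module.End.mul_apply, sub_mul] using this
    have h2 : ‖(1 - prodT (coordT Q n) (m + 1)) f‖ ≤ (1 + r ^ (m + 1)) * ‖f‖ := by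
      rw [LinearMap.sub_apply, Module.End.one_apply]
      refine (norm_sub_le _ _).trans ?_
      rw [add_mul, one_mul]
      gcongr
      exact hp f
    have h3 : (1 - r ^ (m + 2)) * ‖g‖ ≤ ‖g - coordT Q n 0 (prodT (coordT Q n) (m + 1) g)‖ := by
      have h4 : ‖coordT Q n 0 (prodT (coordT Q n) (m + 1) g)‖ ≤ r ^ (m + 2) * ‖g‖ := by
        refine (norm_coordT_le Q hr hQ n 0 _).trans ?_
        rw [pow_succ' r (m + 1), mul_assoc]
        gcongr
        exact hp g
      have := norm_sub_norm_le g (coordT Q n 0 (prodT (coordT Q n) (m + 1) g))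
      linarith
    rw [h1, sum_range_succ, mul_add, Real.exp_add]
    have h5 := one_add_pow_le_exp hr hr1 m
    have h6 := one_le_exp_mul_one_sub_pow hr hr1 m
    set E := Real.exp ((1 + 1 / (1 - r)) * ∑ j ∈ range m, r ^ j)
    have h7 : Real.exp ((1 + 1 / (1 - r)) * r ^ m) =
        Real.exp (r ^ m) * Real.exp (r ^ m / (1 - r)) := by
      rw [← Real.exp_add]; congr 1; ring
    calc ‖(1 - prodT (coordT Q n) (m + 1)) f‖ ≤ (1 + r ^ (m + 1)) * ‖f‖ := h2
      _ ≤ Real.exp (r ^ m) * (E * ‖g‖) := by gcongr; exact ih f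
      _ = E * Real.exp (r ^ m) * (1 * ‖g‖) := by ring
      _ ≤ E * Real.exp (r ^ m) * (Real.exp (r ^ m / (1 - r)) * (1 - r ^ (m + 2)) * ‖g‖) := by
        gcongr
      _ = E * (Real.exp (r ^ m) * Real.exp (r ^ m / (1 - r))) * ((1 - r ^ (m + 2)) * ‖g‖) := by
        ring
      _ ≤ _ := by rw [h7]; gcongr

/-- In the supremum norm, the inverse of `P^(n)` grows at most geometrically in `n`. -/
theorem exists_norm_le_pow_mul_norm_coordP (Q : ι → ι → ℝ) (hs : ∀ i j, Q i j = Q j i) {r : ℝ}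
    (hr : 0 ≤ r) (hr1 : r < 1) (hQ : ∀ i j, |Q i j| ≤ r) :
    ∃ C : ℝ, 1 ≤ C ∧ ∀ n (f : (Fin n → ι) → ℂ), ‖f‖ ≤ C ^ n * ‖coordP Q n f‖ := by
  have h0 : 0 < 1 - r := by linarith
  set C := Real.exp ((1 + 1 / (1 - r)) * (1 - r)⁻¹) with hC
  have hC0 : 0 ≤ C := (Real.exp_pos _).le
  refine ⟨C, Real.one_le_exp (by positivity), fun n => ?_⟩
  induction n with
  | zero =>
    intro f
    have : coordP Q 0 f = f := by
      ext w
      simp [coordP, invWeight, Subsingleton.elim _ w]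
    rw [this, pow_zero, one_mul]
  | succ n ih =>
    intro f
    have h1 : ‖f‖ ≤ C * ‖sumT (coordT Q (n + 1)) (n + 1) f‖ := by
      refine (norm_le_exp_mul_norm_sumT Q hr hr1 hQ (n + 1) n f).trans ?_
      have h2 : ∑ j ∈ range n, r ^ j ≤ (1 - r)⁻¹ := by
        rw [← tsum_geometric_of_lt_one hr hr1]
        exact (summable_geometric_of_lt_one hr hr1).sum_le_tsum _ fun _ _ => by positivity
      rw [hC]
      gcongr
    have h3 : ‖sumT (coordT Q (n + 1)) (n + 1) f‖ ≤ C ^ n * ‖coordP Q (n + 1) f‖ := by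
      rw [pi_norm_le_iff_of_nonneg (by positivity)]
      intro w
      set g : (Fin n → ι) → ℂ := fun w' =>
        sumT (coordT Q (n + 1)) (n + 1) f (Fin.cons (w 0) w' : Fin (n + 1) → ι) with hg
      have h4 : sumT (coordT Q (n + 1)) (n + 1) f w = g (Fin.tail w) := by
        rw [hg]; simp only [Fin.cons_self_tail]
      rw [h4]
      refine (norm_le_pi_norm g _).trans ((ih g).trans ?_)
      gcongr
      rw [pi_norm_le_iff_of_nonneg (by positivity)]
      intro w'
      have h5 := coordP_succ Q hs n f (Fin.cons (w 0) w')
      simp only [Fin.cons_zero, Fin.tail_cons] at h5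
      rw [← h5]
      exact norm_le_pi_norm _ _
    calc ‖f‖ ≤ C * (C ^ n * ‖coordP Q (n + 1) f‖) := h1.trans (by gcongr)
      _ = _ := by ring

end InverseBound

namespace HomogeneousBasis
variable {H N : Type*} [NormedAddCommGroup H] [InnerProductSpace ℝ H] {S : MixedQData H N} {d : ℕ}
  (b : HomogeneousBasis S d)

/-- A functional on the tensors of length `n` with coefficients `g` in the words is represented for
`⟨·,·⟩_T` by the vector with coordinates `(P^(n))⁻¹ ḡ`. -/
theorem exists_innerT_eq {C : ℝ} {n : ℕ}
    (hC : ∀ f : (Fin n → Fin d) → ℂ, ‖f‖ ≤ C ^ n * ‖coordP b.Q n f‖) (g : (Fin n → Fin d) → ℂ) :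
    ∃ y : b.Tens, (∀ x, b.innerT y x = ∑ w, g w * b.coord n x w) ∧
      ‖b.toPre y‖ ^ 2 ≤ (d * C) ^ n * ‖g‖ ^ 2 := by
  obtain ⟨r, hr, hr1, hQ⟩ := b.exists_Q_le
  obtain ⟨f, hf⟩ := LinearMap.injective_iff_surjective.1
    (coordP_injective b.Q b.Q_symm hr hr1 hQ n) (star g)
  have h1 : b.coord n (∑ w, f w • b.tens w) = f := by
    ext w
    simp [coord_tens]
  have h2 : ∀ m, m ≠ n → b.coord m (∑ w, f w • b.tens w) = 0 := fun m hm => by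
    simp [b.coord_tens_ne _ _ hm.symm]
  have h3 : ∀ x, b.innerT (∑ w, f w • b.tens w) x = ∑ w, g w * b.coord n x w := fun x => by
    rw [b.innerT_eq _ x (n + 1) fun m hm => h2 m (by omega), sum_range_succ,
      sum_eq_zero fun m hm => ?_, zero_add, h1, coordP_symm _ b.Q_symm, hf]
    · simp
    · rw [h2 m (mem_range.1 hm).ne]
      simp
  refine ⟨_, h3, ?_⟩
  rw [norm_sq_toPre, h3, h1]
  have hfg : ‖f‖ ≤ C ^ n * ‖g‖ := by
    refine (hC f).trans_eq ?_
    rw [hf, norm_star]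
  calc (∑ w, g w * f w).re ≤ ‖∑ w, g w * f w‖ := Complex.re_le_norm _
    _ ≤ ∑ w, ‖g w * f w‖ := norm_sum_le _ _
    _ ≤ ∑ _w : Fin n → Fin d, ‖g‖ * (C ^ n * ‖g‖) := by
      refine sum_le_sum fun w _ => ?_
      rw [norm_mul]
      exact mul_le_mul (norm_le_pi_norm g w) ((norm_le_pi_norm f w).trans hfg) (norm_nonneg _)
        (norm_nonneg _)
    _ = _ := by
      rw [sum_const, card_univ, Fintype.card_fun, Fintype.card_fin, Fintype.card_fin,
        nsmul_eq_mul]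
      push_cast
      ring

theorem apply_eq_sum (φ : b.Tens →ₗ[ℂ] ℂ) (x : b.Tens) (M : ℕ)
    (hM : ∀ n, M ≤ n → b.coord n x = 0) :
    φ x = ∑ n ∈ range M, ∑ w, φ (b.tens w) * b.coord n x w := by
  conv_lhs => rw [← b.wordBasis.linearCombination_repr x]
  rw [Finsupp.linearCombination_apply, map_finsuppSum, Finsupp.sum_of_support_subset _
    (s := (range M).sigma fun _ => univ) _ _ (by simp), Finset.sum_sigma]
  · refine sum_congr rfl fun n _ => sum_congr rfl fun w _ => ?_
    rw [map_smul, wordBasis_apply, smul_eq_mul, mul_comm]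
    rfl
  · rintro ⟨n, w⟩ h
    simp only [mem_sigma, mem_range, mem_univ, and_true]
    by_contra hn
    push Not at hn
    exact Finsupp.mem_support_iff.1 h (congrFun (hM n hn) w)

/-- A linear functional on the algebraic Fock space whose values on the words of length `n` decay
faster than every geometric sequence is bounded. -/
theorem exists_bound_of_summable (φ : b.Tens →ₗ[ℂ] ℂ) (G : ℕ → ℝ)
    (hG : ∀ n (w : Fin n → Fin d), ‖φ (b.tens w)‖ ≤ G n) (hG0 : ∀ n, 0 ≤ G n)
    (hsum : ∀ L : ℝ, 1 ≤ L → Summable fun n => L ^ n * G n) :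
    ∃ K, ∀ x, ‖φ x‖ ≤ K * ‖b.toPre x‖ := by
  obtain ⟨r, hr, hr1, hQ⟩ := b.exists_Q_le
  obtain ⟨C, hC1, hC⟩ := exists_norm_le_pow_mul_norm_coordP b.Q b.Q_symm hr hr1 hQ
  have hL : 1 ≤ d * C + 1 := by
    have : 0 ≤ d * C := by positivity
    linarith
  set L := d * C + 1 with hLdef
  have hS := hsum L hL
  refine ⟨∑' n, L ^ n * G n, fun x => ?_⟩
  obtain ⟨M, hM⟩ := b.exists_coord_eq_zero x
  have h1 : ∀ n, ‖∑ w, φ (b.tens w) * b.coord n x w‖ ≤ L ^ n * G n * ‖b.toPre x‖ := fun n => by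
    obtain ⟨y, hy, hy2⟩ := b.exists_innerT_eq (hC n) fun w => φ (b.tens w)
    rw [← hy, ← inner_toPre]
    refine (norm_inner_le_norm _ _).trans ?_
    gcongr
    refine le_of_sq_le_sq ?_ (by have := hG0 n; positivity)
    refine hy2.trans ?_
    rw [show (L ^ n * G n) ^ 2 = (L ^ 2) ^ n * G n ^ 2 by
      rw [mul_pow, ← pow_mul, ← pow_mul, mul_comm n 2]]
    have h2 : d * C ≤ L ^ 2 := by nlinarith
    have h3 : ‖fun w : Fin n → Fin d => φ (b.tens w)‖ ≤ G n :=
      (pi_norm_le_iff_of_nonneg (hG0 n)).2 (hG n)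
    gcongr
  rw [b.apply_eq_sum φ x M hM]
  calc ‖∑ n ∈ range M, ∑ w, φ (b.tens w) * b.coord n x w‖
      ≤ ∑ n ∈ range M, L ^ n * G n * ‖b.toPre x‖ :=
        (norm_sum_le _ _).trans (sum_le_sum fun n _ => h1 n)
    _ = (∑ n ∈ range M, L ^ n * G n) * ‖b.toPre x‖ := by rw [sum_mul]
    _ ≤ _ := by
      gcongr
      exact hS.sum_le_tsum _ fun n _ => by have := hG0 n; positivity

end HomogeneousBasis

open Filter Topology in
theorem summable_factorial_mul_pow_mul_pow_sq {s B : ℝ} (hs : 0 < s) (hs1 : s < 1) (hB : 0 < B) :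
    Summable fun n : ℕ => ((n + 1).factorial : ℝ) * B ^ n * s ^ (n ^ 2) := by
  have hpos : ∀ n : ℕ, 0 < ((n + 1).factorial : ℝ) * B ^ n * s ^ (n ^ 2) := fun n => by positivity
  refine summable_of_ratio_test_tendsto_lt_one zero_lt_one
    (Eventually.of_forall fun n => (hpos n).ne') ?_
  have h1 : ∀ n : ℕ, ‖((n + 1 + 1).factorial : ℝ) * B ^ (n + 1) * s ^ ((n + 1) ^ 2)‖ /
      ‖((n + 1).factorial : ℝ) * B ^ n * s ^ (n ^ 2)‖ =
        B * s * (n * (s ^ 2) ^ n + 2 * (s ^ 2) ^ n) := fun n => by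
    have h2 : s ^ ((n + 1) ^ 2) = s ^ (n ^ 2) * (s ^ 2) ^ n * s := by
      rw [← pow_mul, ← pow_add, ← pow_succ, add_sq, mul_one, one_pow]
    rw [Real.norm_of_nonneg (hpos n).le, Real.norm_of_nonneg (hpos (n + 1)).le,
      div_eq_iff (hpos n).ne', Nat.factorial_succ (n + 1), h2]
    push_cast
    ring
  simp only [h1]
  have hs2 : s ^ 2 < 1 := by nlinarith
  have h2 := (tendsto_self_mul_const_pow_of_lt_one (sq_nonneg s) hs2).add
    ((tendsto_pow_atTop_nhds_zero_of_lt_one (sq_nonneg s) hs2).const_mul 2)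
  simpa using h2.const_mul (B * s)

/-- The Gaussian decay of `r ^ (0 + 1 + ⋯ + (n / 2 - 1))` beats the factorial. -/
theorem summable_factorial_mul_pow_mul_pow_sum {r B : ℝ} (hr : 0 < r) (hr1 : r < 1) (hB : 0 < B) :
    Summable fun n : ℕ => ((n + 1).factorial : ℝ) * B ^ n * r ^ (∑ i ∈ range (n / 2), i) := by
  set s := r ^ ((8 : ℕ) : ℝ)⁻¹ with hs
  have hs8 : s ^ 8 = r := Real.rpow_inv_natCast_pow hr.le (by norm_num)
  have hs0 : 0 < s := Real.rpow_pos_of_pos hr _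
  have hs1 : s < 1 := Real.rpow_lt_one hr.le hr1 (by norm_num)
  refine Summable.of_nonneg_of_le (fun n => by positivity) (fun n => ?_)
    (summable_factorial_mul_pow_mul_pow_sq hs0 hs1 (B := B / s ^ 4) (by positivity))
  rw [div_pow, ← hs8, ← pow_mul]
  have h1 : n ^ 2 ≤ 8 * (∑ i ∈ range (n / 2), i) + 4 * n := by
    have h2 := Finset.sum_range_id_mul_two (n / 2)
    generalize (∑ i ∈ range (n / 2), i) = t at h2
    rcases Nat.even_or_odd' n with ⟨h, rfl | rfl⟩
    · rw [Nat.mul_div_cancel_left _ (by norm_num)] at h2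
      cases h with
      | zero => simp
      | succ h => simp only [Nat.add_sub_cancel] at h2; nlinarith
    · rw [show (2 * h + 1) / 2 = h by omega] at h2
      cases h with
      | zero => simp
      | succ h => simp only [Nat.add_sub_cancel] at h2; nlinarith
  have h3 : s ^ (8 * (∑ i ∈ range (n / 2), i)) * (s ^ 4) ^ n ≤ s ^ (n ^ 2) := by
    rw [← pow_mul, ← pow_add]
    exact pow_le_pow_of_le_one hs0.le hs1.le h1
  have h4 : s ^ (8 * (∑ i ∈ range (n / 2), i)) ≤ s ^ (n ^ 2) / (s ^ 4) ^ n := by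
    rwa [le_div_iff₀ (by positivity)]
  calc _ ≤ ((n + 1).factorial : ℝ) * B ^ n * (s ^ (n ^ 2) / (s ^ 4) ^ n) := by gcongr
    _ = _ := by ring

/-! ### Boundedness of the vacuum functional -/

/-- A partition of `B(n + 1)` without singletons pairs the vertices after `π 0` with vertices up to
`π 0`, so that `π 0` is at least `n / 2`. -/
theorem half_le_of_fixedPointFree {n : ℕ} {π : Perm (Fin (n + 1))} (hπ : π ∈ dualPartitions n)
    (hf : ∀ k, π k ≠ k) : n / 2 ≤ (π 0 : ℕ) := by
  have h := (mem_dualPartitions.1 hπ).2.2.2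
  have hcard := card_le_card_of_injOn (s := Ioi (π 0)) (t := Iio (π 0)) π
    (fun k hk => by
      simp only [coe_Ioi, Set.mem_Ioi] at hk
      simpa using h k hk (hf k))
    π.injective.injOn
  rw [Fin.card_Ioi, Fin.card_Iio] at hcard
  omega

namespace HomogeneousBasis
variable {H N : Type*} [NormedAddCommGroup H] [InnerProductSpace ℝ H] {S : MixedQData H N} {d : ℕ}
  (b : HomogeneousBasis S d)

theorem abs_prod_ite_le_one {n : ℕ} (P : Fin n → Fin n → Prop) [∀ u v, Decidable (P u v)]
    (x y : Fin n → Fin n → Fin d) :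
    |∏ u, ∏ v, if P u v then b.Q (x u v) (y u v) else 1| ≤ 1 := by
  simp only [Finset.abs_prod]
  refine prod_le_one (fun _ _ => by positivity) fun u _ =>
    prod_le_one (fun _ _ => by positivity) fun v _ => ?_
  split_ifs
  · exact (S.q_lt_one _ _).le
  · simp

/-- The crossings among the vertices before `π 0` make the weight decay like `r ^ (n² / 8)`. -/
theorem abs_crossingWeight_le {r : ℝ} (hr : 0 ≤ r) (hQ : ∀ k l, |b.Q k l| ≤ r) {n h : ℕ}
    (π : Perm (Fin (n + 1))) (hh : h ≤ (π 0 : ℕ)) (c : Fin (n + 1) → Fin d) :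
    |b.crossingWeight π c| ≤ r ^ (∑ i ∈ range h, i) := by
  have hQ1 : ∀ k l, |b.Q k l| ≤ 1 := fun k l => (S.q_lt_one _ _).le
  have h1 : |∏ u, ∏ v, if v < u ∧ u < π 0 then b.Q (c v) (c u) else 1| ≤
      r ^ (∑ i ∈ range h, i) := by
    have h2 : ∀ u : Fin (n + 1), |∏ v, if v < u ∧ u < π 0 then b.Q (c v) (c u) else 1| ≤
        if (u : ℕ) < h then r ^ (u : ℕ) else 1 := fun u => by
      rw [Finset.abs_prod]
      split_ifs with hu
      · have h3 : u < π 0 := Fin.lt_def.2 (hu.trans_le hh)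
        calc ∏ v, |if v < u ∧ u < π 0 then b.Q (c v) (c u) else 1|
            ≤ ∏ v, if v < u then r else 1 := by
              refine prod_le_prod (fun _ _ => by positivity) fun v _ => ?_
              by_cases hv : v < u
              · simpa [hv, h3] using hQ _ _
              · simp [hv]
          _ = r ^ (u : ℕ) := by
              rw [← prod_filter, prod_const, filter_gt_eq_Iio, Fin.card_Iio]
      · refine prod_le_one (fun _ _ => by positivity) fun v _ => ?_
        split_ifs
        · exact hQ1 _ _
        · simp
    rw [Finset.abs_prod]
    refine (prod_le_prod (fun _ _ => by positivity) fun u _ => h2 u).trans_eq ?_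
    rw [Fin.prod_univ_eq_prod_range (fun u => if u < h then r ^ u else 1) (n + 1), ← prod_filter,
      ← prod_pow_eq_pow_sum]
    refine prod_congr ?_ fun _ _ => rfl
    ext i
    have := (π 0).2
    simp only [mem_filter, mem_range]
    omega
  rw [crossingWeight, abs_mul, abs_mul]
  have h2 := b.abs_prod_ite_le_one (fun u v => 0 < v ∧ v < u ∧ u < π 0 ∧ π u < π v)
    (fun _ v => c (π v)) fun u _ => c (π u)
  have h3 := b.abs_prod_ite_le_one (fun u v => π 0 < v ∧ v < u ∧ π v = v ∧ π u ≠ u)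
    (fun _ v => c v) fun u _ => c u
  calc _ ≤ r ^ (∑ i ∈ range h, i) * 1 * 1 := by gcongr
    _ = _ := by ring

theorem exists_norm_innerU_conj_le :
    ∃ M : ℝ, 1 ≤ M ∧ ∀ k l, ‖S.innerU (b.vec k).conj (b.vec l)‖ ≤ M := by
  refine ⟨1 + ∑ k, ∑ l, ‖S.innerU (b.vec k).conj (b.vec l)‖, ?_, fun k l => ?_⟩
  · have : 0 ≤ ∑ k, ∑ l, ‖S.innerU (b.vec k).conj (b.vec l)‖ := by positivity
    linarith
  · have h1 := single_le_sum (f := fun l => ‖S.innerU (b.vec k).conj (b.vec l)‖)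
      (fun _ _ => norm_nonneg _) (mem_univ l)
    have h2 := single_le_sum (f := fun k => ∑ l, ‖S.innerU (b.vec k).conj (b.vec l)‖)
      (fun _ _ => by positivity) (mem_univ k)
    linarith

theorem norm_pairWeight_le {M : ℝ} (hM1 : 1 ≤ M)
    (hM : ∀ k l, ‖S.innerU (b.vec k).conj (b.vec l)‖ ≤ M) {n : ℕ} (π : Perm (Fin (n + 1)))
    (c : Fin (n + 1) → Fin d) : ‖b.pairWeight π c‖ ≤ M ^ (n + 1) := by
  rw [pairWeight, norm_prod]
  refine (prod_le_prod (fun _ _ => norm_nonneg _) fun k _ => (?_ : _ ≤ M)).trans_eq (by simp)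
  split_ifs
  · exact hM _ _
  · simpa

/-- The vacuum component of an element of the algebraic Fock space. -/
noncomputable def vacuumCoord : b.Tens →ₗ[ℂ] ℂ := LinearMap.proj Fin.elim0 ∘ₗ b.coord 0

theorem vacuumCoord_one : b.vacuumCoord 1 = 1 := by
  rw [← b.tens_zero Fin.elim0]
  simp [vacuumCoord, coord_tens]

theorem vacuumCoord_creation (k : Fin d) (x : b.Tens) :
    b.vacuumCoord (b.creation (b.vec k) x) = 0 := by
  simp [vacuumCoord, coord_creation_zero]

theorem innerT_one (x : b.Tens) : b.innerT 1 x = b.vacuumCoord x := by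
  have h1 : ∀ n, 1 ≤ n → b.coord n 1 = 0 := fun n hn => by
    rw [← b.tens_zero Fin.elim0, coord_tens_ne _ _ _ (by omega)]
  have h2 : ∀ w, b.coord 0 1 w = 1 := fun w => by
    rw [Subsingleton.elim w Fin.elim0]
    exact b.vacuumCoord_one
  rw [b.innerT_eq _ _ 1 h1, sum_range_one, Fintype.sum_eq_single Fin.elim0 fun w hw =>
    (hw (Subsingleton.elim _ _)).elim, h2]
  have h3 : coordP b.Q 0 (b.coord 0 x) Fin.elim0 = b.coord 0 x Fin.elim0 := by
    simp only [coordP, LinearMap.coe_mk, AddHom.coe_mk, invWeight, univ_eq_empty, prod_empty]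
    rw [Fintype.sum_eq_single 1 fun σ hσ => (hσ (Subsingleton.elim _ _)).elim]
    simp
  rw [h3]
  simp [vacuumCoord]

theorem vacuumCoord_tensorOn {n : ℕ} (s : Fin n → Bool) (c : Fin n → Fin d) :
    b.vacuumCoord (b.tensorOn s c) = if ∃ k, s k then 0 else 1 := by
  induction n with
  | zero =>
    have : b.tensorOn s c = 1 := by simp [tensorOn]
    rw [this, vacuumCoord_one]
    simp
  | succ n ih =>
    rw [tensorOn_snoc]
    by_cases h : s (Fin.last n)
    · rw [if_pos h, vacuumCoord_creation, if_pos ⟨_, h⟩]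
    · rw [if_neg h, Module.End.one_apply, ih]
      simp [Fin.exists_fin_succ', h]

theorem norm_vacuumCoord_dualMap_tens_le {r M : ℝ} (hr : 0 ≤ r) (hQ : ∀ k l, |b.Q k l| ≤ r)
    (hM1 : 1 ≤ M) (hM : ∀ k l, ‖S.innerU (b.vec k).conj (b.vec l)‖ ≤ M) (α : Fin d) {n : ℕ}
    (w : Fin n → Fin d) : ‖b.vacuumCoord (b.dualMap α (b.tens w))‖ ≤
      (n + 1).factorial * M ^ (n + 1) * r ^ (∑ i ∈ range (n / 2), i) := by
  have hw : w = (w ∘ Fin.rev) ∘ Fin.rev := funext fun i => by simp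
  have h1 : ∀ π ∈ dualPartitions n, ∀ c : Fin (n + 1) → Fin d,
      ‖b.vacuumCoord (b.dualCoeff π c • b.singletonTensor π c)‖ ≤
        M ^ (n + 1) * r ^ (∑ i ∈ range (n / 2), i) := fun π hπ c => by
    rw [map_smul, singletonTensor_eq, vacuumCoord_tensorOn]
    split_ifs with h
    · rw [smul_zero, norm_zero]
      positivity
    · push Not at h
      have hf : ∀ k, π k ≠ k := fun k => by simpa using h k
      have h2 := b.abs_crossingWeight_le hr hQ π (half_le_of_fixedPointFree hπ hf) c
      have h3 := b.norm_pairWeight_le hM1 hM π c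
      rw [smul_eq_mul, mul_one, dualCoeff, norm_mul, norm_mul, norm_pow, norm_neg, norm_one,
        one_pow, one_mul, Complex.norm_real, Real.norm_eq_abs, mul_comm]
      gcongr
  rw [hw, dualMap_tens, map_sum]
  refine (norm_sum_le _ _).trans ((sum_le_sum fun π hπ => h1 π hπ _).trans ?_)
  rw [sum_const, nsmul_eq_mul, mul_assoc]
  gcongr
  refine (card_le_univ _).trans_eq ?_
  rw [Fintype.card_perm, Fintype.card_fin]

/-- The functional `x ↦ ⟨Ω, D_α x⟩` is bounded. -/
theorem exists_norm_vacuumCoord_dualMap_le (α : Fin d) :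
    ∃ K, ∀ x, ‖b.vacuumCoord (b.dualMap α x)‖ ≤ K * ‖b.toPre x‖ := by
  obtain ⟨r₀, hr₀, hr₁, hQ₀⟩ := b.exists_Q_le
  obtain ⟨M, hM1, hM⟩ := b.exists_norm_innerU_conj_le
  obtain ⟨r, hr, hr1⟩ := exists_between hr₁
  have hr0 : 0 < r := hr₀.trans_lt hr
  have hQ : ∀ k l, |b.Q k l| ≤ r := fun k l => (hQ₀ k l).trans hr.le
  refine b.exists_bound_of_summable (b.vacuumCoord ∘ₗ b.dualMap α)
    (fun n => (n + 1).factorial * M ^ (n + 1) * r ^ (∑ i ∈ range (n / 2), i))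
    (fun n w => b.norm_vacuumCoord_dualMap_tens_le hr0.le hQ hM1 hM α w)
    (fun n => by positivity) fun L hL => ?_
  have := (summable_factorial_mul_pow_mul_pow_sum hr0 hr1 (B := L * M) (by positivity)).mul_left M
  refine this.congr fun n => ?_
  rw [mul_pow]
  ring

/-! ### The dual system on the Fock space -/

/-- The operator `D_α` on the Fock space, with the algebraic Fock space as its domain. -/
noncomputable def dualOp (α : Fin d) : b.Fock →ₗ.[ℂ] b.Fock where
  domain := b.fockAlg
  toFun := b.emb ∘ₗ b.dualMap α ∘ₗ
    (LinearEquiv.ofInjective b.emb b.emb_injective).symm.toLinearMap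

theorem emb_mem_fockAlg (x : b.Tens) : b.emb x ∈ b.fockAlg := ⟨x, rfl⟩

theorem dualOp_emb (α : Fin d) (x : b.Tens) (h : b.emb x ∈ (b.dualOp α).domain) :
    b.dualOp α ⟨b.emb x, h⟩ = b.emb (b.dualMap α x) := by
  exact congrArg (fun y => b.emb (b.dualMap α y))
    ((LinearEquiv.ofInjective b.emb b.emb_injective).symm_apply_apply x)

theorem norm_emb (x : b.Tens) : ‖b.emb x‖ = ‖b.toPre x‖ :=
  UniformSpace.Completion.norm_coe _

theorem inner_vacuum_emb (x : b.Tens) : inner ℂ b.vacuum (b.emb x) = b.vacuumCoord x := by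
  rw [← innerT_one, ← inner_toPre]
  exact UniformSpace.Completion.inner_coe _ _

theorem gen_emb (l : Fin d) (x : b.Tens) : b.gen l (b.emb x) =
    b.emb ((b.creation (b.vec l) + b.annihilation (b.vec l).conj) x) :=
  b.wick_emb _ _

theorem norm_vacuum : ‖b.vacuum‖ = 1 := by
  have h := b.inner_vacuum_emb 1
  rw [vacuumCoord_one] at h
  have h2 := inner_self_eq_norm_sq (𝕜 := ℂ) b.vacuum
  rw [vacuum] at h2 h ⊢
  rw [h] at h2
  rw [← sq_eq_sq₀ (norm_nonneg _) zero_le_one, ← h2]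
  simp

theorem starProjection_vacuum_emb (x : b.Tens) :
    (ℂ ∙ b.vacuum).starProjection (b.emb x) = b.vacuumCoord x • b.vacuum := by
  rw [Submodule.starProjection_unit_singleton ℂ b.norm_vacuum, inner_vacuum_emb]

theorem vacuumCoord_tens {n : ℕ} (w : Fin n → Fin d) :
    b.vacuumCoord (b.tens w) = if n = 0 then 1 else 0 := by
  split_ifs with h
  · subst h
    rw [tens_zero, vacuumCoord_one]
  · simp [vacuumCoord, b.coord_tens_ne 0 n h]

theorem dualMap_commutator (α l : Fin d) (x : b.Tens) :
    b.dualMap α ((b.creation (b.vec l) + b.annihilation (b.vec l).conj) x) -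
      (b.creation (b.vec l) + b.annihilation (b.vec l).conj) (b.dualMap α x) =
        S.innerU (b.vec l).conj (b.vec α) • b.vacuumCoord x • 1 := by
  have h : b.dualMap α ∘ₗ (b.creation (b.vec l) + b.annihilation (b.vec l).conj) -
      (b.creation (b.vec l) + b.annihilation (b.vec l).conj) ∘ₗ b.dualMap α =
        S.innerU (b.vec l).conj (b.vec α) • b.vacuumCoord.smulRight 1 := by
    refine b.wordBasis.ext fun ⟨n, w⟩ => ?_
    rw [wordBasis_apply]
    refine (b.dualMap_commutator_tens α l w).trans ?_
    rw [LinearMap.smul_apply, LinearMap.smulRight_apply, vacuumCoord_tens, smul_smul]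
  exact LinearMap.congr_fun h x

theorem isNormalizedDualSystem_dualOp : b.IsNormalizedDualSystem b.dualOp where
  fockAlg_le_domain _ := le_rfl
  vacuum_mem_adjointDomain α := by
    obtain ⟨K, hK⟩ := b.exists_norm_vacuumCoord_dualMap_le α
    refine (LinearMap.mkContinuous (innerₛₗ ℂ b.vacuum ∘ₗ (b.dualOp α).toFun) K ?_).continuous
    rintro ⟨_, x, rfl⟩
    have h : (innerₛₗ ℂ b.vacuum ∘ₗ (b.dualOp α).toFun) ⟨b.emb x, x, rfl⟩ =
        b.vacuumCoord (b.dualMap α x) := by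
      rw [← inner_vacuum_emb, ← b.dualOp_emb α x ⟨x, rfl⟩]
      rfl
    rw [h]
    refine (hK x).trans_eq ?_
    rw [← norm_emb]
    rfl
  commutator α l := by
    rintro _ ⟨x, rfl⟩
    have hA : b.gen l (b.emb x) ∈ (b.dualOp α).domain := by
      rw [gen_emb]
      exact b.emb_mem_fockAlg _
    have hx : b.emb x ∈ (b.dualOp α).domain := b.emb_mem_fockAlg x
    refine ⟨hx, hA, ?_⟩
    have h1 : b.dualOp α ⟨b.gen l (b.emb x), hA⟩ =
        b.emb (b.dualMap α ((b.creation (b.vec l) + b.annihilation (b.vec l).conj) x)) := by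
      rw [← b.dualOp_emb α _ (b.emb_mem_fockAlg _)]
      congr 2
      exact b.gen_emb l x
    rw [h1, dualOp_emb, gen_emb, ← map_sub, dualMap_commutator, starProjection_vacuum_emb,
      map_smul, map_smul]
    rfl
  innerU_eq_vacuum_state k l := by
    have h : b.gen k b.vacuum = b.emb (b.creation (b.vec k) 1) := by
      rw [vacuum, gen_emb, LinearMap.add_apply, annihilation_one, add_zero]
    rw [h, gen_emb, inner_vacuum_emb, LinearMap.add_apply, map_add, vacuumCoord_creation,
      annihilation_conj_creation, annihilation_one, map_zero, smul_zero, add_zero, map_smul,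
      vacuumCoord_one]
    simp
  map_vacuum α := ⟨b.emb_mem_fockAlg 1, by
    have := b.dualOp_emb α 1 (b.emb_mem_fockAlg 1)
    rwa [dualMap_one, map_zero] at this⟩

/-- A normalized dual system is determined on the algebraic Fock space, as `Ω` is cyclic: `e_l ⊗ x`
is `A_l x` up to a tensor shorter than `x`, and the commutator relation determines `D_α A_l x`. -/
theorem eq_dualMap_of_isNormalizedDualSystem {D : Fin d → b.Fock →ₗ.[ℂ] b.Fock}
    (hD : b.IsNormalizedDualSystem D) (α : Fin d) (x : b.Tens) :
    D α ⟨b.emb x, hD.fockAlg_le_domain α (b.emb_mem_fockAlg x)⟩ = b.emb (b.dualMap α x) := by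
  obtain ⟨F, hF⟩ : ∃ F : b.Tens →ₗ[ℂ] b.Fock, ∀ y,
      F y = D α ⟨b.emb y, hD.fockAlg_le_domain α (b.emb_mem_fockAlg y)⟩ :=
    ⟨(D α).toFun ∘ₗ Submodule.inclusion (hD.fockAlg_le_domain α) ∘ₗ b.emb.rangeRestrict,
      fun _ => rfl⟩
  rw [← hF]
  have hcomm : ∀ l y, F ((b.creation (b.vec l) + b.annihilation (b.vec l).conj) y) -
      b.gen l (F y) = S.innerU (b.vec l).conj (b.vec α) • b.vacuumCoord y • b.vacuum :=
    fun l y => by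
      obtain ⟨h1, h2, h3⟩ := hD.commutator α l _ (b.emb_mem_fockAlg y)
      rw [starProjection_vacuum_emb] at h3
      rw [← h3]
      have e : F ((b.creation (b.vec l) + b.annihilation (b.vec l).conj) y) =
          D α ⟨b.gen l (b.emb y), h2⟩ :=
        (hF _).trans (congrArg (D α) (Subtype.ext (b.gen_emb l y).symm))
      rw [e, hF]
  set Δ : b.Tens →ₗ[ℂ] b.Fock := F - b.emb ∘ₗ b.dualMap α with hΔ
  have hΔ1 : Δ 1 = 0 := by
    obtain ⟨h, h0⟩ := hD.map_vacuum α
    have e : F 1 = D α ⟨b.vacuum, h⟩ := hF 1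
    rw [hΔ, LinearMap.sub_apply, e, h0, LinearMap.comp_apply, dualMap_one, map_zero, sub_zero]
  have hΔc : ∀ l y, Δ (b.creation (b.vec l) y) =
      b.gen l (Δ y) - Δ (b.annihilation (b.vec l).conj y) := fun l y => by
    have h1 := hcomm l y
    have h2 := congrArg b.emb (b.dualMap_commutator α l y)
    rw [map_sub, ← gen_emb, map_smul, map_smul] at h2
    rw [← vacuum, ← h1] at h2
    rw [eq_sub_iff_add_eq, ← map_add, ← LinearMap.add_apply, hΔ, LinearMap.sub_apply,
      LinearMap.sub_apply, map_sub, LinearMap.comp_apply, LinearMap.comp_apply]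
    rw [sub_eq_sub_iff_add_eq_add] at h2 ⊢
    exact h2.symm.trans (add_comm _ _)
  have key : ∀ n (c : Fin n → Fin d), Δ (b.tensorOn (fun _ => true) c) = 0 := by
    have hstep : ∀ n (c : Fin (n + 1) → Fin d), b.tensorOn (fun _ => true) c =
        b.creation (b.vec (c (Fin.last n))) (b.tensorOn (fun _ => true) (c ∘ Fin.castSucc)) :=
      fun n c => by
        rw [tensorOn_snoc, if_pos rfl]
        rfl
    intro n
    induction n using Nat.twoStepInduction with
    | zero =>
      intro c
      rw [tensorOn_eq_tens, tens_zero, hΔ1]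
    | one =>
      intro c
      rw [hstep, tensorOn_eq_tens, tens_zero, hΔc, hΔ1, annihilation_one, map_zero, map_zero,
        sub_zero]
    | more n ih ih' =>
      intro c
      rw [hstep, hΔc, ih', map_zero, zero_sub, neg_eq_zero, annihilation_tensorOn, map_sum]
      refine sum_eq_zero fun p _ => ?_
      rw [map_smul]
      exact (congrArg _ (ih _)).trans (smul_zero _)
  have hΔ0 : Δ = 0 := b.wordBasis.ext fun ⟨n, w⟩ => by
    have h := key n (w ∘ Fin.rev)
    have hw : (w ∘ Fin.rev) ∘ Fin.rev = w := funext fun i => by simp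
    rw [tensorOn_eq_tens, hw] at h
    rw [wordBasis_apply]
    exact h
  exact sub_eq_zero.1 (LinearMap.congr_fun hΔ0 x)

theorem dualOp_le {D : Fin d → b.Fock →ₗ.[ℂ] b.Fock} (hD : b.IsNormalizedDualSystem D)
    (α : Fin d) : b.dualOp α ≤ D α := by
  refine ⟨hD.fockAlg_le_domain α, ?_⟩
  rintro ⟨_, x, rfl⟩ ⟨y, hy⟩ h
  obtain rfl : b.emb x = y := h
  exact (b.dualOp_emb α x _).trans (b.eq_dualMap_of_isNormalizedDualSystem hD α x).symm

end HomogeneousBasis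

end MixedQ

theorem proposition3p2 {H N : Type*} [NormedAddCommGroup H] [InnerProductSpace ℝ H]
    (S : MixedQ.MixedQData H N) {d : ℕ} (b : MixedQ.HomogeneousBasis S d) :
    ∃ D : Fin d → b.Fock →ₗ.[ℂ] b.Fock,
      -- the domain of each `D α` is the algebraic Fock space, and `D α` is given there by the formula;
      -- here `a k` is the letter `α_{k+1}`, so that `b.tens (a ∘ Fin.rev)` is `e_{α_n ⋯ α_1}`, and
      -- `Fin.cons α a` lists the letters `α_0 = α, α_1, …, α_n`
      (∀ α, (D α).domain = b.fockAlg) ∧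
      (∀ α, ∃ h : b.vacuum ∈ (D α).domain, D α ⟨b.vacuum, h⟩ = 0) ∧
      (∀ (α : Fin d) (n : ℕ) (a : Fin n → Fin d),
        ∃ h : b.emb (b.tens (a ∘ Fin.rev)) ∈ (D α).domain,
          D α ⟨b.emb (b.tens (a ∘ Fin.rev)), h⟩ =
            ∑ π ∈ MixedQ.dualPartitions n,
              ((-1 : ℂ) ^ ((π 0 : ℕ) - 1) *
                (b.crossingWeight π (Fin.cons α a) : ℂ) * b.pairWeight π (Fin.cons α a)) •
                  b.emb (b.singletonTensor π (Fin.cons α a))) ∧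
      -- they form a normalized dual system, and every other one extends them
      b.IsNormalizedDualSystem D ∧
      ∀ D' : Fin d → b.Fock →ₗ.[ℂ] b.Fock, b.IsNormalizedDualSystem D' → ∀ α, D α ≤ D' α := by
  refine ⟨b.dualOp, fun _ => rfl, b.isNormalizedDualSystem_dualOp.map_vacuum, fun α n a =>
    ⟨b.emb_mem_fockAlg _, (b.dualOp_emb α _ _).trans ?_⟩, b.isNormalizedDualSystem_dualOp,
    fun _ hD α => b.dualOp_le hD α⟩
  rw [b.dualMap_tens, map_sum]
  simp only [map_smul]
  rfl
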